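/- Let $\pi : S' \to S$ be a finite locally free morphism of schemes which is Gorenstein (flat, with all fibres Gorenstein schemes), and let $\omega = \omega_\pi$ be its dualizing sheaf, i.e. the $\mathcal{O}_{S'}$-module corresponding to the $\pi_*\mathcal{O}_{S'}$-module $\mathcal{H}om_{\mathcal{O}_S}(\pi_*\mathcal{O}_{S'}, \mathcal{O}_S)$. Let $X$ be an $S$-scheme such that the Weil restriction $$T \longmapsto \mathrm{Hom}_{S'}(T \times_S S',\, X \times_S S')$$ is representable by an $S$-scheme $\mathcal{R}X$ (for example, $X \to S$ quasiprojective with $S$ locally noetherian and $\pi$ of constant degree). Write $\mathcal{U} = \mathcal{R}X \times_S S'$, with projections $\rho : \mathcal{U} \to \mathcal{R}X$ and $q : \mathcal{U} \to S'$, and let $f : \mathcal{U} \to X$ be the universal map. Then there is an isomorphism of $\mathcal{O}_{\mathcal{R}X}$-modules $$\Omega_{\mathcal{R}X/S} \;\cong\; \rho_*\bigl(f^*\Omega_{X/S} \otimes_{\mathcal{O}_{\mathcal{U}}} q^*\omega\bigr).$$ In particular, let $k$ be a commutative ring, $m \ge 0$ an integer, $X$ a $k$-scheme, and let $J_mX$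 be its $m$-th jet space, i.e. the $k$-scheme representing $T \mapsto \mathrm{Hom}_k(T \times_k \operatorname{Spec} k[t]/(t^{m+1}), X)$. Let $\rho : J_mX \times_k \operatorname{Spec} k[t]/(t^{m+1}) \to J_mX$ and $q : J_mX \times_k \operatorname{Spec} k[t]/(t^{m+1}) \to \operatorname{Spec} k[t]/(t^{m+1})$ be the projections, $f : J_mX \times_k \operatorname{Spec} k[t]/(t^{m+1}) \to X$ the universal jet and $\omega_m$ the dualizing sheaf of $\operatorname{Spec} k[t]/(t^{m+1}) \to \operatorname{Spec} k$. Then $$\Omega_{J_mX/k} \;\cong\; \rho_*\bigl(f^*\Omega_{X/k} \otimes q^*\omega_m\bigr).$$ -/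

import Mathlib

open CategoryTheory Limits TopologicalSpace Opposite AlgebraicGeometry

universe u

noncomputable section

namespace WeilDiff

/-! ### Gorenstein rings, schemes and morphisms -/

/-- A Gorenstein local ring: a Noetherian local ring which has finite injective dimension as a
module over itself. -/
structure IsGorensteinLocalRing (A : Type u) [CommRing A] : Prop where
  isLocalRing : IsLocalRing A
  isNoetherianRing : IsNoetherianRing A
  finite_injectiveDimension : ∃ n : ℕ, HasInjectiveDimensionLE (ModuleCat.of.{u} A A) n

/-- A Gorenstein scheme: locally Noetherian, with all local rings Gorenstein. -/
structure IsGorensteinScheme (X : Scheme.{u}) : Prop where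
  isLocallyNoetherian : IsLocallyNoetherian X
  stalk : ∀ x : X, IsGorensteinLocalRing (X.presheaf.stalk x)

/-- A Gorenstein morphism: flat, with all fibres Gorenstein schemes. -/
structure IsGorensteinMorphism {X Y : Scheme.{u}} (f : X ⟶ Y) : Prop where
  flat : Flat f
  fiber : ∀ y : Y, IsGorensteinScheme (f.fiber y)

/-- A finite locally free morphism, i.e. an affine morphism `f` such that `f_* 𝒪` is locally free
of finite rank; equivalently, `f` is finite, flat and locally of finite presentation. -/
structure IsFiniteLocallyFree {X Y : Scheme.{u}} (f : X ⟶ Y) : Prop where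
  finite : IsFinite f
  flat : Flat f
  locallyOfFinitePresentation : LocallyOfFinitePresentation f

/-! ### Sheaves of modules -/

/-- The sheaf of `𝒪_X`-modules associated to a presheaf of `𝒪_X`-modules. -/
def sheafify {X : Scheme.{u}} (P : X.PresheafOfModules) : X.Modules :=
  (PresheafOfModules.sheafification (𝟙 X.ringCatSheaf.obj)).obj P

/-- The presheaf underlying a sheaf of modules, over the structure presheaf of commutative rings. -/
def toPresheaf {X : Scheme.{u}} (M : X.Modules) :
    PresheafOfModules.{u} (X.presheaf ⋙ forget₂ CommRingCat.{u} RingCat.{u}) :=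
  (Scheme.Modules.toPresheafOfModules X).obj M

/-- The tensor product `M ⊗ N` over `𝒪_X`: the sheaf associated to `U ↦ M(U) ⊗_{𝒪(U)} N(U)`. -/
def tensor {X : Scheme.{u}} (M N : X.Modules) : X.Modules :=
  sheafify (PresheafOfModules.Monoidal.tensorObj (toPresheaf M) (toPresheaf N))

/-- The morphism of presheaves of rings `f⁻¹ 𝒪_S ⟶ 𝒪_X` attached to `f : X ⟶ S`, where
`(f⁻¹ 𝒪_S)(U)` is the colimit of the `𝒪_S(V)` over the opens `V` which contain `f(U)`. -/
def inverseImageHom {X S : Scheme.{u}} (f : X ⟶ S) :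
    (TopCat.Presheaf.pullback CommRingCat.{u} f.base).obj S.presheaf ⟶ X.presheaf :=
  ((TopCat.Presheaf.pullbackPushforwardAdjunction CommRingCat.{u} f.base).homEquiv
    S.presheaf X.presheaf).symm f.c

/-- The sheaf of relative Kähler differentials `Ω_{X/S}`: the sheaf associated to
`U ↦ Ω_{𝒪_X(U) / (f⁻¹ 𝒪_S)(U)}`. -/
def kaehler {X S : Scheme.{u}} (f : X ⟶ S) : X.Modules :=
  sheafify (X := X)
    (PresheafOfModules.DifferentialsConstruction.relativeDifferentials' (inverseImageHom f))

/-! ### The dualizing sheaf of a finite morphism -/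

section Dualizing

variable {S' S : Scheme.{u}} (π : S' ⟶ S)

/-- Sections over `V` of the sheaf `ℋom_{𝒪_S}(π_* 𝒪_{S'}, 𝒪_S)`: families of `𝒪_S(W)`-linear maps
`𝒪_{S'}(π⁻¹ W) → 𝒪_S(W)`, for `W ⊆ V` open, compatible with restriction. -/
def homSections (V : S.Opens) :
    AddSubgroup (∀ W : {W : S.Opens // W ≤ V}, Γ(S', π ⁻¹ᵁ W.1) →+ Γ(S, W.1)) where
  carrier := {φ |
    (∀ W (r : Γ(S, W.1)) (a : Γ(S', π ⁻¹ᵁ W.1)), φ W (π.app W.1 r * a) = r * φ W a) ∧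
    ∀ (W W' : {W : S.Opens // W ≤ V}) (h : W'.1 ≤ W.1) (a : Γ(S', π ⁻¹ᵁ W.1)),
      S.presheaf.map (homOfLE h).op (φ W a) =
        φ W' (S'.presheaf.map ((Opens.map π.base).map (homOfLE h)).op a)}
  add_mem' := by
    rintro φ ψ ⟨h₁, h₂⟩ ⟨k₁, k₂⟩
    refine ⟨fun W r a ↦ ?_, fun W W' h a ↦ ?_⟩
    · simp [h₁, k₁, mul_add]
    · simp [h₂ W W' h, k₂ W W' h]
  zero_mem' := ⟨fun W r a ↦ by simp, fun W W' h a ↦ by simp⟩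
  neg_mem' := by
    rintro φ ⟨h₁, h₂⟩
    refine ⟨fun W r a ↦ ?_, fun W W' h a ↦ ?_⟩
    · simp [h₁]
    · simp [h₂ W W' h]

variable {π}

@[ext]
theorem homSections_ext {V : S.Opens} {φ ψ : homSections π V}
    (h : ∀ W a, φ.1 W a = ψ.1 W a) : φ = ψ :=
  Subtype.ext (funext fun W ↦ AddMonoidHom.ext fun a ↦ h W a)

/-- Restriction of functions on `π⁻¹ V` to `π⁻¹ W`, for `W ⊆ V`. -/
def resPre (π : S' ⟶ S) {V W : S.Opens} (h : W ≤ V) : Γ(S', π ⁻¹ᵁ V) →+* Γ(S', π ⁻¹ᵁ W) :=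
  (S'.presheaf.map ((Opens.map π.base).map (homOfLE h)).op).hom

theorem resPre_resPre {U V W : S.Opens} (h : V ≤ U) (k : W ≤ V) (a : Γ(S', π ⁻¹ᵁ U)) :
    resPre π k (resPre π h a) = resPre π (k.trans h) a := by
  simp only [resPre, ← CommRingCat.comp_apply, ← Functor.map_comp]
  rfl

/-- The `𝒪_{S'}(π⁻¹ V)`-module structure: `(s • φ)(a) = φ(s a)`. -/
instance homSectionsModule (V : S.Opens) : Module Γ(S', π ⁻¹ᵁ V) (homSections π V) where
  smul s φ := ⟨fun W ↦ (φ.1 W).comp (AddMonoidHom.mulLeft (resPre π W.2 s)), by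
    refine ⟨fun W r a ↦ ?_, fun W W' h a ↦ ?_⟩
    · rw [AddMonoidHom.comp_apply, AddMonoidHom.comp_apply, AddMonoidHom.coe_mulLeft,
        ← φ.2.1, mul_left_comm]
    · rw [AddMonoidHom.comp_apply, AddMonoidHom.comp_apply, AddMonoidHom.coe_mulLeft,
        AddMonoidHom.coe_mulLeft, φ.2.2 W W' h, map_mul]
      congr 2
      exact resPre_resPre W.2 h s⟩
  one_smul φ := by
    ext W a
    change φ.1 W (resPre π W.2 1 * a) = φ.1 W a
    simp
  mul_smul s t φ := by
    ext W a
    change φ.1 W (resPre π W.2 (s * t) * a) = φ.1 W (resPre π W.2 t * (resPre π W.2 s * a))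
    rw [map_mul (resPre π W.2), ← mul_assoc, mul_comm (resPre π W.2 s)]
  smul_zero s := rfl
  smul_add s φ ψ := rfl
  add_smul s t φ := by
    ext W a
    change φ.1 W (resPre π W.2 (s + t) * a) =
      φ.1 W (resPre π W.2 s * a) + φ.1 W (resPre π W.2 t * a)
    rw [map_add, add_mul, map_add]
  zero_smul φ := by
    ext W a
    change φ.1 W (resPre π W.2 0 * a) = 0
    simp

theorem smul_homSections_apply {V : S.Opens} (s : Γ(S', π ⁻¹ᵁ V)) (φ : homSections π V)
    (W : {W : S.Opens // W ≤ V}) (a : Γ(S', π ⁻¹ᵁ W.1)) :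
    (s • φ).1 W a = φ.1 W (resPre π W.2 s * a) := rfl

/-- Restriction of sections of `ℋom_{𝒪_S}(π_* 𝒪_{S'}, 𝒪_S)`. -/
def homSectionsRes {V V' : S.Opens} (h : V' ≤ V) : homSections π V →+ homSections π V' where
  toFun φ := ⟨fun W ↦ φ.1 ⟨W.1, W.2.trans h⟩, fun W r a ↦ φ.2.1 ⟨W.1, W.2.trans h⟩ r a,
    fun W W' k a ↦ φ.2.2 ⟨W.1, W.2.trans h⟩ ⟨W'.1, W'.2.trans h⟩ k a⟩
  map_zero' := rfl
  map_add' _ _ := rfl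

variable (π)

/-- The presheaf of rings `π_* 𝒪_{S'}` on `S`. -/
abbrev pushforwardRing : S.Opensᵒᵖ ⥤ RingCat.{u} :=
  (Opens.map π.base).op ⋙ S'.ringCatSheaf.obj

instance homSectionsModule' (V : S.Opensᵒᵖ) :
    Module ((pushforwardRing π).obj V) (homSections π V.unop) :=
  homSectionsModule V.unop

/-- `ℋom_{𝒪_S}(π_* 𝒪_{S'}, 𝒪_S)` as a module over `π_* 𝒪_{S'}`. -/
def homModule : PresheafOfModules.{u} (pushforwardRing π) where
  obj V := ModuleCat.of _ (homSections π V.unop)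
  map {V V'} i := ModuleCat.ofHom
    (Y := (ModuleCat.restrictScalars ((pushforwardRing π).map i).hom).obj
      (ModuleCat.of _ (homSections π V'.unop)))
    { toFun := homSectionsRes i.unop.le
      map_add' := (homSectionsRes i.unop.le).map_add
      map_smul' s φ := by
        apply homSections_ext
        intro W a
        exact congrArg (fun z ↦ φ.1 ⟨W.1, W.2.trans i.unop.le⟩ (z * a))
          (resPre_resPre i.unop.le W.2 s).symm }
  map_id V := rfl
  map_comp f g := rfl

/-- The dualizing sheaf `ω_π` of a finite (locally free) morphism `π : S' ⟶ S`: the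
`𝒪_{S'}`-module which corresponds to the `π_* 𝒪_{S'}`-module `ℋom_{𝒪_S}(π_* 𝒪_{S'}, 𝒪_S)`, i.e.
the pullback of the latter along the morphism of ringed spaces `(S', 𝒪_{S'}) ⟶ (S, π_* 𝒪_{S'})`
which is `π` on points and the identity on functions. -/
def dualizingSheaf : S'.Modules :=
  sheafify ((PresheafOfModules.pullback.{u} (F := Opens.map π.base)
    (𝟙 (pushforwardRing π))).obj (homModule π))

end Dualizing

/-! ### Weil restriction -/

section Weil

variable {S' S : Scheme.{u}} (π : S' ⟶ S)

/-- The Weil restriction of `Y` over `S'` along `π : S' ⟶ S`, as a functor on `S`-schemes: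
`T ↦ Hom_{S'}(T ×_S S', Y)`. -/
def weilRestriction (Y : Over S') : (Over S)ᵒᵖ ⥤ Type u :=
  (Over.pullback π).op ⋙ yoneda.obj Y

variable {π}

/-- The universal object `𝒰 = R ×_S S'` over an `S`-scheme `R`. -/
abbrev univ (π : S' ⟶ S) (R : Over S) : Scheme.{u} := pullback R.hom π

/-- The projection `ρ : 𝒰 ⟶ R`. -/
abbrev univProj (π : S' ⟶ S) (R : Over S) : univ π R ⟶ R.left := pullback.fst R.hom π

/-- The projection `𝒰 ⟶ S'`. -/
abbrev univBase (π : S' ⟶ S) (R : Over S) : univ π R ⟶ S' := pullback.snd R.hom π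

/-- The universal map `𝒰 ⟶ X` when `R` represents the Weil restriction of `X ×_S S'`: it
corresponds to the identity of `R`. -/
def univMap {X R : Over S}
    (h : (weilRestriction π ((Over.pullback π).obj X)).RepresentableBy R) :
    univ π R ⟶ X.left :=
  (show (Over.pullback π).obj R ⟶ (Over.pullback π).obj X from h.homEquiv (𝟙 R)).left ≫
    pullback.fst X.hom π

end Weil

/-! ### Jet spaces -/

section Jets

/-- The universal jet `Spec k[t]/(t^(m+1)) ⟶ Spec k`. -/
def jetHom (k : CommRingCat.{u}) (m : ℕ) :
    Spec (.of (Polynomial k ⧸ Ideal.span {(Polynomial.X : Polynomial k) ^ (m + 1)})) ⟶ Spec k :=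
  Spec.map (CommRingCat.ofHom
    (algebraMap k (Polynomial k ⧸ Ideal.span {(Polynomial.X : Polynomial k) ^ (m + 1)})))

/-- The functor of `m`-jets in a `k`-scheme `X`: `T ↦ Hom_k(T ×_k Spec k[t]/(t^(m+1)), X)`. -/
def jetFunctor (k : CommRingCat.{u}) (m : ℕ) (X : Over (Spec k)) :
    (Over (Spec k))ᵒᵖ ⥤ Type u :=
  (Over.pullback (jetHom k m) ⋙ Over.map (jetHom k m)).op ⋙ yoneda.obj X

/-- The universal jet `J ×_k Spec k[t]/(t^(m+1)) ⟶ X` when `J` is the `m`-th jet space of `X`. -/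
def univJet {k : CommRingCat.{u}} {m : ℕ} {X J : Over (Spec k)}
    (h : (jetFunctor k m X).RepresentableBy J) : univ (jetHom k m) J ⟶ X.left :=
  (show (Over.map (jetHom k m)).obj ((Over.pullback (jetHom k m)).obj J) ⟶ X from
    h.homEquiv (𝟙 J)).left

end Jets

end WeilDiff

end

/-! Take affine charts `Spec A` of `S` with preimage `Spec B` in `S'`, and `Spec C` of the Weil
restriction `R` over `Spec A`. Put `D = C ⊗ B` (over `A`) and let `N` be the sections of
`f^*Ω_{X/S}` over `Spec D`. A derivation of `C` over `A` with values in a `C`-module `M` is a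
deformation of `Spec C ⟶ R` along the square-zero extension `C ⊕ M`. By the universal property of
`R` this is a deformation of the universal map `Spec D ⟶ X` along the base-changed extension, whose
kernel is `D ⊗ M` (over `C`), that is, a `D`-linear map `N → D ⊗ M`. So `Hom_C(Ω[C⁄A], M) = Hom_D(N,
D ⊗ M)`.

Locally on `S` the dualizing sheaf is generated by one form `tr : B → A` having dual bases (a
Frobenius form). Composition with the trace then gives `Hom_D(N, D ⊗ M) = Hom_C(N, M)`, and Yoneda
identifies `N` with `Ω[C⁄A]`. The isomorphism is explicit: it is `t ∘ θ`, where `θ : N → Ω[D⁄B] = D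
⊗ Ω[C⁄A]` pulls differentials back along the universal map and `t = tr ⊗ id`. The Yoneda argument is
`bijective_trace_comp`, its input on duality is `exists_linearMap_trace_eq`, and its input on
deformations is `exists_deformation` together with `IsWeilChart.exists_ofDifferential`; they are put
together in `IsWeilChart.bijective_trace`.

The choice of `tr` disappears after twisting by the dualizing sheaf. The global map is `n ⊗ tr ↦ t
(θ n)`; replacing `tr` by `tr (u · -)` amounts to replacing `n` by `u n`, so the local maps agree on
overlaps (`TraceChart.IsTrace.of_chart`) and glue to a morphism which is bijective on affine charts
(`IsWeilRestriction.nonempty_iso`).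

The generator exists for the following reason. An Artinian local Gorenstein ring is self-injective,
hence has a simple socle. A linear form on a fibre which is nonzero on the socle of every local
factor is therefore nondegenerate. It lifts, up to a scalar, to a neighbourhood, where its Gram
determinant becomes invertible after shrinking (`IsGorensteinMorphism.exists_traceChart`). For jets,
the coefficient of `t^m` is such a form over every base ring. -/

noncomputable section

namespace WeilDiff

/-! ### Part: sheaves of modules, derivations and Kähler differentials on schemes. -/

/-! ### Sheafification of presheaves of modules -/

/-- Sheafification is left adjoint to the inclusion of sheaves of modules in presheaves. -/
def sheafifyAdjunction (X : Scheme.{u}) :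
    PresheafOfModules.sheafification (𝟙 X.ringCatSheaf.obj) ⊣
      Scheme.Modules.toPresheafOfModules X :=
  PresheafOfModules.sheafificationAdjunction (𝟙 X.ringCatSheaf.obj)

/-- The canonical morphism from a presheaf of modules to the associated sheaf. -/
def toSheafify {X : Scheme.{u}} (P : X.PresheafOfModules) :
    P ⟶ (Scheme.Modules.toPresheafOfModules X).obj (sheafify P) :=
  (sheafifyAdjunction X).unit.app P

/-- The morphism from the associated sheaf induced by a morphism to a sheaf. -/
def sheafifyDesc {X : Scheme.{u}} {P : X.PresheafOfModules} {M : X.Modules}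
    (φ : P ⟶ (Scheme.Modules.toPresheafOfModules X).obj M) : sheafify P ⟶ M :=
  ((sheafifyAdjunction X).homEquiv P M).symm φ

theorem toSheafify_desc {X : Scheme.{u}} {P : X.PresheafOfModules} {M : X.Modules}
    (φ : P ⟶ (Scheme.Modules.toPresheafOfModules X).obj M) :
    toSheafify P ≫ (Scheme.Modules.toPresheafOfModules X).map (sheafifyDesc φ) = φ := by
  exact (Adjunction.homEquiv_unit _ _ _ _).symm.trans
    (((sheafifyAdjunction X).homEquiv P M).apply_symm_apply φ)

theorem sheafify_hom_ext {X : Scheme.{u}} {P : X.PresheafOfModules} {M : X.Modules}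
    {φ ψ : sheafify P ⟶ M}
    (h : toSheafify P ≫ (Scheme.Modules.toPresheafOfModules X).map φ =
      toSheafify P ≫ (Scheme.Modules.toPresheafOfModules X).map ψ) : φ = ψ := by
  apply ((sheafifyAdjunction X).homEquiv P M).injective
  exact (Adjunction.homEquiv_unit _ _ _ _).trans (h.trans (Adjunction.homEquiv_unit _ _ _ _).symm)

/-! ### Derivations with values in a sheaf of modules -/

/-- An `𝒪_S`-linear derivation from `𝒪_X` to a sheaf of `𝒪_X`-modules. -/
structure SheafDerivation {X S : Scheme.{u}} (f : X ⟶ S) (M : X.Modules) where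
  /-- The action on sections. -/
  d (U : X.Opens) : Γ(X, U) →+ Γ(M, U)
  leibniz (U : X.Opens) (a b : Γ(X, U)) : d U (a * b) = a • d U b + b • d U a
  map {U V : X.Opens} (h : V ≤ U) (a : Γ(X, U)) :
    d V (X.presheaf.map (homOfLE h).op a) = M.presheaf.map (homOfLE h).op (d U a)
  const (V : S.Opens) (a : Γ(S, V)) : d (f ⁻¹ᵁ V) (f.app V a) = 0

namespace SheafDerivation

variable {X S : Scheme.{u}} {f : X ⟶ S} {M N : X.Modules}

@[ext]
theorem ext {δ ε : SheafDerivation f M} (h : ∀ U a, δ.d U a = ε.d U a) : δ = ε := by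
  cases δ
  cases ε
  congr
  funext U
  ext a
  exact h U a

/-- Postcomposition of a derivation with a morphism of sheaves of modules. -/
def comp (δ : SheafDerivation f M) (φ : M ⟶ N) : SheafDerivation f N where
  d U := (φ.app U).hom.comp (δ.d U)
  leibniz U a b := by
    change φ.app U (δ.d U (a * b)) = a • φ.app U (δ.d U b) + b • φ.app U (δ.d U a)
    rw [δ.leibniz, map_add, Scheme.Modules.Hom.app_smul, Scheme.Modules.Hom.app_smul]
  map {U V} h a := by
    change φ.app V (δ.d V _) = N.presheaf.map _ (φ.app U (δ.d U a))
    rw [δ.map h]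
    exact ConcreteCategory.congr_hom (φ.mapPresheaf.naturality (homOfLE h).op) (δ.d U a)
  const V a := by
    change φ.app _ (δ.d _ _) = 0
    rw [δ.const, map_zero]

end SheafDerivation

/-- The presheaf whose associated sheaf is `kaehler f`. -/
abbrev kaehlerPre {X S : Scheme.{u}} (f : X ⟶ S) : X.PresheafOfModules :=
  PresheafOfModules.DifferentialsConstruction.relativeDifferentials' (inverseImageHom f)

/-- The universal derivation, on the level of presheaves. -/
def kaehlerPreD {X S : Scheme.{u}} (f : X ⟶ S) :
    (PresheafOfModules.DifferentialsConstruction.relativeDifferentials'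
      (inverseImageHom f)).Derivation' (inverseImageHom f) :=
  PresheafOfModules.DifferentialsConstruction.derivation' (inverseImageHom f)

/-- The unit of the adjunction between inverse and direct images of presheaves of rings. -/
def inverseImageUnit {X S : Scheme.{u}} (f : X ⟶ S) :
    S.presheaf ⟶ (TopCat.Presheaf.pushforward CommRingCat.{u} f.base).obj
      ((TopCat.Presheaf.pullback CommRingCat.{u} f.base).obj S.presheaf) :=
  (TopCat.Presheaf.pullbackPushforwardAdjunction CommRingCat.{u} f.base).unit.app S.presheaf

theorem inverseImageUnit_comp {X S : Scheme.{u}} (f : X ⟶ S) :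
    inverseImageUnit f ≫
      (TopCat.Presheaf.pushforward CommRingCat.{u} f.base).map (inverseImageHom f) = f.c := by
  have := ((TopCat.Presheaf.pullbackPushforwardAdjunction CommRingCat.{u} f.base).homEquiv
    S.presheaf X.presheaf).apply_symm_apply f.c
  rwa [Adjunction.homEquiv_unit] at this

theorem inverseImageUnit_app {X S : Scheme.{u}} (f : X ⟶ S) (V : S.Opens) (a : Γ(S, V)) :
    (inverseImageHom f).app (op (f ⁻¹ᵁ V)) ((inverseImageUnit f).app (op V) a) = f.app V a :=
  ConcreteCategory.congr_hom (NatTrans.congr_app (inverseImageUnit_comp f) (op V)) a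

/-- The canonical map from sections of a presheaf of modules to sections of the associated sheaf. -/
def sheafifyUnit {X : Scheme.{u}} (P : X.PresheafOfModules) (U : X.Opens) :
    P.obj (op U) →+ Γ(sheafify P, U) :=
  ((toSheafify P).app (op U)).hom.toAddMonoidHom

theorem sheafifyUnit_smul {X : Scheme.{u}} (P : X.PresheafOfModules) (U : X.Opens)
    (a : X.ringCatSheaf.obj.obj (op U)) (x : P.obj (op U)) :
    sheafifyUnit P U (a • x) = (show Γ(X, U) from a) • sheafifyUnit P U x :=
  ((toSheafify P).app (op U)).hom.map_smul a x

theorem sheafifyUnit_map {X : Scheme.{u}} (P : X.PresheafOfModules) {U V : X.Opens} (h : V ≤ U)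
    (x : P.obj (op U)) :
    sheafifyUnit P V (P.map (homOfLE h).op x) =
      (sheafify P).presheaf.map (homOfLE h).op (sheafifyUnit P U x) :=
  PresheafOfModules.naturality_apply (toSheafify P) (homOfLE h).op x

theorem sheafifyDesc_app {X : Scheme.{u}} {P : X.PresheafOfModules} {M : X.Modules}
    (φ : P ⟶ (Scheme.Modules.toPresheafOfModules X).obj M) (U : X.Opens) (x : P.obj (op U)) :
    (sheafifyDesc φ).app U (sheafifyUnit P U x) = (φ.app (op U)).hom x :=
  congrArg (fun ψ : P ⟶ (Scheme.Modules.toPresheafOfModules X).obj M ↦ (ψ.app (op U)).hom x)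
    (toSheafify_desc φ)

/-- The universal derivation with values in the sheaf of Kähler differentials. -/
def kaehlerD {X S : Scheme.{u}} (f : X ⟶ S) : SheafDerivation f (kaehler f) where
  d U := (sheafifyUnit (kaehlerPre f) U).comp ((kaehlerPreD f).d (X := op U))
  leibniz U a b :=
    (congrArg (sheafifyUnit (kaehlerPre f) U) ((kaehlerPreD f).d_mul a b)).trans <|
      ((sheafifyUnit (kaehlerPre f) U).map_add _ _).trans <|
        congrArg₂ _ (sheafifyUnit_smul _ _ _ _) (sheafifyUnit_smul _ _ _ _)
  map {U V} h a :=
    (congrArg (sheafifyUnit (kaehlerPre f) V) ((kaehlerPreD f).d_map (homOfLE h).op a)).trans <|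
      sheafifyUnit_map _ _ _
  const V a := by
    change sheafifyUnit (kaehlerPre f) _ ((kaehlerPreD f).d _) = 0
    rw [← inverseImageUnit_app f V a]
    refine (congrArg (sheafifyUnit (kaehlerPre f) _)
      (PresheafOfModules.Derivation'.d_app (kaehlerPreD f) _)).trans ?_
    exact map_zero _

namespace SheafDerivation

variable {X S : Scheme.{u}} {f : X ⟶ S} {M : X.Modules} (δ : SheafDerivation f M)

/-- The subring of sections killed by a derivation. -/
def ker (U : X.Opens) : Subring Γ(X, U) where
  carrier := {a | δ.d U a = 0}
  mul_mem' {a b} (ha : δ.d U a = 0) (hb : δ.d U b = 0) := by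
    change δ.d U (a * b) = 0
    rw [δ.leibniz, ha, hb, smul_zero, smul_zero, add_zero]
  one_mem' := by
    have := δ.leibniz U 1 1
    rw [mul_one, one_smul] at this
    exact left_eq_add.mp this
  add_mem' {a b} (ha : δ.d U a = 0) (hb : δ.d U b = 0) := by
    change δ.d U (a + b) = 0
    rw [map_add, ha, hb, add_zero]
  zero_mem' := map_zero _
  neg_mem' {a} (ha : δ.d U a = 0) := by
    change δ.d U (-a) = 0
    rw [map_neg, ha, neg_zero]

theorem mem_ker {U : X.Opens} {a : Γ(X, U)} : a ∈ δ.ker U ↔ δ.d U a = 0 := Iff.rfl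

theorem map_mem_ker {U V : X.Opensᵒᵖ} (i : U ⟶ V) {a : Γ(X, U.unop)} (ha : a ∈ δ.ker U.unop) :
    X.presheaf.map i a ∈ δ.ker V.unop := by
  rw [mem_ker] at ha ⊢
  have := δ.map (leOfHom i.unop) a
  rw [ha, map_zero] at this
  exact this

/-- The presheaf of rings of sections killed by a derivation. -/
def kerPresheaf : TopCat.Presheaf CommRingCat.{u} X where
  obj U := CommRingCat.of (δ.ker U.unop)
  map {U V} i := CommRingCat.ofHom <|
    ((X.presheaf.map i).hom.comp (δ.ker U.unop).subtype).codRestrict (δ.ker V.unop)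
      fun a ↦ δ.map_mem_ker i a.2
  map_id U := CommRingCat.hom_ext <| RingHom.ext fun a ↦
    Subtype.ext (ConcreteCategory.congr_hom (X.presheaf.map_id U) a.1)
  map_comp i j := CommRingCat.hom_ext <| RingHom.ext fun a ↦
    Subtype.ext (ConcreteCategory.congr_hom (X.presheaf.map_comp i j) a.1)

/-- The inclusion of the sections killed by a derivation. -/
def kerι : δ.kerPresheaf ⟶ X.presheaf where
  app U := CommRingCat.ofHom (δ.ker U.unop).subtype

/-- The factorization of `f.c` through the sections killed by a derivation. -/
def kerLift : S.presheaf ⟶ (TopCat.Presheaf.pushforward CommRingCat.{u} f.base).obj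
    δ.kerPresheaf where
  app V := CommRingCat.ofHom <| (f.app V.unop).hom.codRestrict (δ.ker (f ⁻¹ᵁ V.unop))
    fun a ↦ δ.const V.unop a
  naturality V W i := by
    ext a
    exact Subtype.ext (ConcreteCategory.congr_hom (f.c.naturality i) a)

/-- Sections of the presheaf inverse image of `𝒪_S` are colimit classes and `δ` is only known to
vanish on functions pulled back from opens of `S`. The sections killed by `δ` form a presheaf of
rings through which `f.c` factors, so by adjunction the map from the inverse image factors through
it as well. -/
theorem inverseImageHom_eq :
    ((TopCat.Presheaf.pullbackPushforwardAdjunction CommRingCat.{u} f.base).homEquiv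
      S.presheaf δ.kerPresheaf).symm δ.kerLift ≫ δ.kerι = inverseImageHom f := by
  rw [inverseImageHom, ← Adjunction.homEquiv_naturality_right_symm]
  rfl

theorem d_inverseImageHom (U : X.Opensᵒᵖ)
    (a : ((TopCat.Presheaf.pullback CommRingCat.{u} f.base).obj S.presheaf).obj U) :
    δ.d U.unop ((inverseImageHom f).app U a) = 0 := by
  rw [← δ.inverseImageHom_eq]
  exact (((((TopCat.Presheaf.pullbackPushforwardAdjunction CommRingCat.{u} f.base).homEquiv
      S.presheaf δ.kerPresheaf).symm δ.kerLift).app U).hom a).2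

/-- The derivation of presheaves given by a derivation with values in a sheaf. -/
def toDerivation' : PresheafOfModules.Derivation' (toPresheaf M) (inverseImageHom f) where
  d {U} := δ.d U.unop
  d_mul {U} a b := δ.leibniz U.unop a b
  d_map i a := δ.map (leOfHom i.unop) a
  d_app {U} a := δ.d_inverseImageHom U a

/-- The morphism from the sheaf of Kähler differentials induced by a derivation. -/
def desc : kaehler f ⟶ M :=
  sheafifyDesc (P := kaehlerPre f)
    ((PresheafOfModules.DifferentialsConstruction.isUniversal' (inverseImageHom f)).desc
      δ.toDerivation')

theorem desc_d (U : X.Opens) (a : Γ(X, U)) : δ.desc.app U ((kaehlerD f).d U a) = δ.d U a :=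
  (sheafifyDesc_app (P := kaehlerPre f) _ U _).trans
    (PresheafOfModules.Derivation.congr_d
      ((PresheafOfModules.DifferentialsConstruction.isUniversal' (inverseImageHom f)).fac
        δ.toDerivation') (X := op U) a)

end SheafDerivation

theorem kaehler_hom_ext {X S : Scheme.{u}} {f : X ⟶ S} {M : X.Modules} {φ ψ : kaehler f ⟶ M}
    (h : ∀ U (a : Γ(X, U)), φ.app U ((kaehlerD f).d U a) = ψ.app U ((kaehlerD f).d U a)) :
    φ = ψ := by
  refine sheafify_hom_ext (P := kaehlerPre f)
    ((PresheafOfModules.DifferentialsConstruction.isUniversal'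
      (inverseImageHom f)).postcomp_injective _ _ ?_)
  ext U a
  exact h U.unop a

section Functoriality

variable {X Y S T : Scheme.{u}} {f : X ⟶ S} {g : Y ⟶ T} {M : Y.Modules}

/-- The derivation `𝒪_X → j_* 𝒪_Y → j_* M` induced by a derivation `𝒪_Y → M`. -/
def SheafDerivation.along (δ : SheafDerivation g M) (j : Y ⟶ X) (i : T ⟶ S)
    (h : j ≫ f = g ≫ i) :
    SheafDerivation f ((Scheme.Modules.pushforward j).obj M) where
  d W := (δ.d (j ⁻¹ᵁ W)).comp (j.app W).hom.toAddMonoidHom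
  leibniz W a b :=
    (congrArg (δ.d (j ⁻¹ᵁ W)) (map_mul (j.app W).hom a b)).trans (δ.leibniz _ _ _)
  map {U V} h a :=
    (congrArg (δ.d (j ⁻¹ᵁ V))
      (ConcreteCategory.congr_hom (j.c.naturality (homOfLE h).op) a)).trans (δ.map _ _)
  const V a := by
    -- The two composites give preimages that are only propositionally equal; quantifying over `u`
    -- allows substitution and avoids transporting sections.
    have key : ∀ u : Y ⟶ S, u = g ≫ i → δ.d (u ⁻¹ᵁ V) (u.app V a) = 0 := by
      rintro _ rfl
      exact (congrArg (δ.d _) (ConcreteCategory.congr_hom (Scheme.Hom.comp_app g i V) a)).trans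
        (δ.const (i ⁻¹ᵁ V) (i.app V a))
    exact (congrArg (δ.d _) (ConcreteCategory.congr_hom (Scheme.Hom.comp_app j f V) a)).symm.trans
      (key (j ≫ f) h)

/-- The functoriality of Kähler differentials. -/
def kaehlerMap (f : X ⟶ S) (g : Y ⟶ T) (j : Y ⟶ X) (i : T ⟶ S) (h : j ≫ f = g ≫ i) :
    kaehler f ⟶ (Scheme.Modules.pushforward j).obj (kaehler g) :=
  ((kaehlerD g).along j i h).desc

theorem kaehlerMap_d (j : Y ⟶ X) (i : T ⟶ S) (h : j ≫ f = g ≫ i) (W : X.Opens) (a : Γ(X, W)) :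
    (kaehlerMap f g j i h).app W ((kaehlerD f).d W a) = (kaehlerD g).d (j ⁻¹ᵁ W) (j.app W a) :=
  ((kaehlerD g).along j i h).desc_d W a

end Functoriality

section OpenImmersion

variable {X Y S T : Scheme.{u}} {f : X ⟶ S} {g : Y ⟶ T} {M : X.Modules}

theorem d_eq_zero_of_appLE (δ : SheafDerivation f M) (V : S.Opens) (U : X.Opens)
    (h : U ≤ f ⁻¹ᵁ V) (a : Γ(S, V)) : δ.d U (f.appLE V U h a) = 0 := by
  have := δ.map h (f.app V a)
  rw [δ.const, map_zero] at this
  exact this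

theorem image_preimage_le_of_comp_eq (j : Y ⟶ X) (i : T ⟶ S) [IsOpenImmersion j]
    [IsOpenImmersion i] (h : j ≫ f = g ≫ i) (V : T.Opens) : j ''ᵁ g ⁻¹ᵁ V ≤ f ⁻¹ᵁ i ''ᵁ V := by
  rintro _ ⟨y, hy, rfl⟩
  exact ⟨g.base y, hy, (congrArg (fun u : Y ⟶ S ↦ u.base y) h).symm⟩

/-- Functions coming from `T` become, on the image of `j`, functions coming from an open of `S`.
This makes the restriction of a derivation to an open subscheme vanish on the constants of the
smaller base. -/
theorem app_comp_appIso_inv (j : Y ⟶ X) (i : T ⟶ S) [IsOpenImmersion j]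
    [IsOpenImmersion i] (h : j ≫ f = g ≫ i) (V : T.Opens) :
    g.app V ≫ (j.appIso (g ⁻¹ᵁ V)).inv = (i.appIso V).inv ≫
      f.appLE (i ''ᵁ V) (j ''ᵁ g ⁻¹ᵁ V) (image_preimage_le_of_comp_eq j i h V) := by
  have key : ∀ (u : Y ⟶ S) (e : g ⁻¹ᵁ V ≤ u ⁻¹ᵁ i ''ᵁ V), u = g ≫ i →
      (i.appIso V).inv ≫ u.appLE (i ''ᵁ V) (g ⁻¹ᵁ V) e = g.app V := by
    rintro _ e rfl
    rw [← Scheme.Hom.appLE_comp_appLE _ _ _ V _ (i.preimage_image_eq V).ge le_rfl,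
      ← Scheme.Hom.appIso_hom', Iso.inv_hom_id_assoc, Scheme.Hom.app_eq_appLE]
  have e : g ⁻¹ᵁ V ≤ j ⁻¹ᵁ j ''ᵁ g ⁻¹ᵁ V := (j.preimage_image_eq _).ge
  rw [← cancel_mono (j.appIso (g ⁻¹ᵁ V)).hom, Category.assoc, Iso.inv_hom_id, Category.comp_id,
    Category.assoc, Scheme.Hom.appIso_hom', Scheme.Hom.appLE_comp_appLE]
  exact (key (j ≫ f) _ h).symm

/-- The restriction of a derivation along an open immersion. -/
def SheafDerivation.restrict (δ : SheafDerivation f M) (j : Y ⟶ X) (i : T ⟶ S)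
    [IsOpenImmersion j] [IsOpenImmersion i] (h : j ≫ f = g ≫ i) :
    SheafDerivation g (M.restrict j) where
  d U := (δ.d (j ''ᵁ U)).comp (j.appIso U).inv.hom.toAddMonoidHom
  leibniz U a b :=
    (congrArg (δ.d (j ''ᵁ U)) (map_mul (j.appIso U).inv.hom a b)).trans (δ.leibniz _ _ _)
  map {U V} h a := by
    refine (congrArg (δ.d (j ''ᵁ V)) ?_).trans (δ.map (Scheme.Hom.image_mono j h) _)
    exact ConcreteCategory.congr_hom (j.appIso_inv_naturality (homOfLE h).op) a
  const V a := by
    refine (congrArg (δ.d _) ?_).trans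
      (d_eq_zero_of_appLE δ (i ''ᵁ V) _ (image_preimage_le_of_comp_eq j i h V) ((i.appIso V).inv a))
    exact ConcreteCategory.congr_hom (app_comp_appIso_inv j i h V) a

theorem restrict_hom_ext (j : Y ⟶ X) [IsOpenImmersion j] {M : X.Modules} {N : Y.Modules}
    {φ ψ : M.restrict j ⟶ N}
    (h : (Scheme.Modules.restrictAdjunction j).homEquiv _ _ φ =
      (Scheme.Modules.restrictAdjunction j).homEquiv _ _ ψ) : φ = ψ :=
  ((Scheme.Modules.restrictAdjunction j).homEquiv _ _).injective h

theorem restrict_homEquiv_app (j : Y ⟶ X) [IsOpenImmersion j] {M : X.Modules} {N : Y.Modules}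
    (φ : M.restrict j ⟶ N) (W : X.Opens) (x : Γ(M, W)) :
    ((Scheme.Modules.restrictAdjunction j).homEquiv _ _ φ).app W x =
      φ.app (j ⁻¹ᵁ W) (M.presheaf.map (homOfLE (j.image_preimage_le W)).op x) := by
  rw [Adjunction.homEquiv_unit]
  rfl

theorem restrict_homEquiv_symm_app (j : Y ⟶ X) [IsOpenImmersion j] {M : X.Modules} {N : Y.Modules}
    (φ : M ⟶ (Scheme.Modules.pushforward j).obj N) (U : Y.Opens) (x : Γ(M, j ''ᵁ U)) :
    (((Scheme.Modules.restrictAdjunction j).homEquiv M N).symm φ).app U x =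
      N.presheaf.map (eqToHom (j.preimage_image_eq U).symm).op (φ.app (j ''ᵁ U) x) := by
  rw [Adjunction.homEquiv_counit]
  rfl

theorem kaehlerD_map {X S : Scheme.{u}} (f : X ⟶ S) {U V : X.Opens} (h : V ≤ U) (a : Γ(X, U)) :
    (kaehler f).presheaf.map (homOfLE h).op ((kaehlerD f).d U a) =
      (kaehlerD f).d V (X.presheaf.map (homOfLE h).op a) :=
  ((kaehlerD f).map h a).symm

theorem restrict_homEquiv_symm_kaehlerMap_d (f : X ⟶ S) (g : Y ⟶ T) (j : Y ⟶ X) (i : T ⟶ S)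
    [IsOpenImmersion j] (h : j ≫ f = g ≫ i) (U : Y.Opens) (a : Γ(X, j ''ᵁ U)) :
    (((Scheme.Modules.restrictAdjunction j).homEquiv _ _).symm (kaehlerMap f g j i h)).app U
      ((kaehlerD f).d (j ''ᵁ U) a) = (kaehlerD g).d U ((j.appIso U).hom a) := by
  refine (restrict_homEquiv_symm_app j _ U _).trans ?_
  rw [kaehlerMap_d]
  refine (kaehlerD_map g (j.preimage_image_eq U).ge _).trans (congrArg _ ?_)
  exact (ConcreteCategory.congr_hom (j.appIso_hom U) a).symm

theorem SheafDerivation.restrict_desc_d (f : X ⟶ S) (g : Y ⟶ T) (j : Y ⟶ X) (i : T ⟶ S)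
    [IsOpenImmersion j] [IsOpenImmersion i] (h : j ≫ f = g ≫ i) (U : Y.Opens) (a : Γ(Y, U)) :
    ((kaehlerD f).restrict j i h).desc.app U ((kaehlerD g).d U a) =
      (kaehlerD f).d (j ''ᵁ U) ((j.appIso U).inv a) :=
  SheafDerivation.desc_d _ U a

/-- Kähler differentials commute with restriction to open subschemes. -/
def kaehlerRestrictIso (f : X ⟶ S) (g : Y ⟶ T) (j : Y ⟶ X) (i : T ⟶ S) [IsOpenImmersion j]
    [IsOpenImmersion i] (h : j ≫ f = g ≫ i) : (kaehler f).restrict j ≅ kaehler g where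
  -- Both directions come from universal properties, so that the two composites need only be
  -- compared on differentials of functions.
  hom := ((Scheme.Modules.restrictAdjunction j).homEquiv _ _).symm (kaehlerMap f g j i h)
  inv := ((kaehlerD f).restrict j i h).desc
  hom_inv_id := by
    refine restrict_hom_ext j (kaehler_hom_ext fun W a ↦ ?_)
    rw [restrict_homEquiv_app, restrict_homEquiv_app, kaehlerD_map]
    refine (congrArg (((kaehlerD f).restrict j i h).desc.app (j ⁻¹ᵁ W))
      (restrict_homEquiv_symm_kaehlerMap_d f g j i h (j ⁻¹ᵁ W) _)).trans ?_
    refine (SheafDerivation.restrict_desc_d f g j i h _ _).trans ?_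
    exact congrArg ((kaehlerD f).d _) (ConcreteCategory.congr_hom (j.appIso _).hom_inv_id _)
  inv_hom_id := by
    refine kaehler_hom_ext fun U a ↦ ?_
    refine (congrArg ((((Scheme.Modules.restrictAdjunction j).homEquiv _ _).symm
      (kaehlerMap f g j i h)).app U) (SheafDerivation.restrict_desc_d f g j i h U a)).trans ?_
    refine (restrict_homEquiv_symm_kaehlerMap_d f g j i h U _).trans ?_
    exact congrArg ((kaehlerD g).d _) (ConcreteCategory.congr_hom (j.appIso _).inv_hom_id _)

end OpenImmersion

/-! ### Sections of sheaves of modules -/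

section Sections

variable {X : Scheme.{u}} {M N : X.Modules}

/-- Restriction of sections of a sheaf of modules. -/
def res (M : X.Modules) {U V : X.Opens} (h : V ≤ U) : Γ(M, U) →+ Γ(M, V) :=
  (M.presheaf.map (homOfLE h).op).hom

/-- Restriction of functions. -/
def resO (X : Scheme.{u}) {U V : X.Opens} (h : V ≤ U) : Γ(X, U) →+* Γ(X, V) :=
  (X.presheaf.map (homOfLE h).op).hom

theorem res_smul {U V : X.Opens} (h : V ≤ U) (a : Γ(X, U)) (x : Γ(M, U)) :
    res M h (a • x) = resO X h a • res M h x :=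
  M.map_smul (homOfLE h) a x

theorem res_res {U V W : X.Opens} (h : V ≤ U) (k : W ≤ V) (x : Γ(M, U)) :
    res M k (res M h x) = res M (k.trans h) x :=
  (ConcreteCategory.congr_hom (M.presheaf.map_comp (homOfLE h).op (homOfLE k).op) x).symm

theorem resO_resO {U V W : X.Opens} (h : V ≤ U) (k : W ≤ V) (x : Γ(X, U)) :
    resO X k (resO X h x) = resO X (k.trans h) x :=
  (ConcreteCategory.congr_hom (X.presheaf.map_comp (homOfLE h).op (homOfLE k).op) x).symm

@[simp]
theorem res_self {U : X.Opens} (h : U ≤ U) (x : Γ(M, U)) : res M h x = x :=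
  ConcreteCategory.congr_hom (M.presheaf.map_id (op U)) x

@[simp]
theorem resO_self {U : X.Opens} (h : U ≤ U) (x : Γ(X, U)) : resO X h x = x :=
  ConcreteCategory.congr_hom (X.presheaf.map_id (op U)) x

theorem app_res (φ : M ⟶ N) {U V : X.Opens} (h : V ≤ U) (x : Γ(M, U)) :
    φ.app V (res M h x) = res N h (φ.app U x) :=
  ConcreteCategory.congr_hom (φ.mapPresheaf.naturality (homOfLE h).op) x

theorem section_ext {U : X.Opens} {s t : Γ(M, U)}
    (h : ∀ x ∈ U, ∃ (V : X.Opens) (hV : V ≤ U), x ∈ V ∧ res M hV s = res M hV t) : s = t :=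
  TopCat.Presheaf.IsSheaf.section_ext M.isSheaf (U := op U) h

theorem section_glue {ι : Type u} (U : X.Opens) (V : ι → X.Opens) (hV : ∀ i, V i ≤ U)
    (hU : ∀ x ∈ U, ∃ i, x ∈ V i) (s : ∀ i, Γ(M, V i))
    (hs : ∀ i j, res M (inf_le_left : V i ⊓ V j ≤ V i) (s i) =
      res M (inf_le_right : V i ⊓ V j ≤ V j) (s j)) :
    ∃ t : Γ(M, U), ∀ i, res M (hV i) t = s i := by
  obtain ⟨t, ht, -⟩ := TopCat.Sheaf.existsUnique_gluing' ⟨M.presheaf, M.isSheaf⟩ V U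
    (fun i ↦ homOfLE (hV i)) (fun x hx ↦ by simpa using hU x hx) s hs
  exact ⟨t, ht⟩

theorem resO_ext {U : X.Opens} {s t : Γ(X, U)}
    (h : ∀ x ∈ U, ∃ (V : X.Opens) (hV : V ≤ U), x ∈ V ∧ resO X hV s = resO X hV t) : s = t :=
  TopCat.Presheaf.IsSheaf.section_ext X.sheaf.2 (U := op U) h

/-- The morphism of sheaves of modules given by its action on sections. -/
def homOfSections (β : ∀ U, Γ(M, U) →+ Γ(N, U))
    (nat : ∀ {U V : X.Opens} (h : V ≤ U) (x : Γ(M, U)), β V (res M h x) = res N h (β U x))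
    (smul : ∀ U (a : Γ(X, U)) (x : Γ(M, U)), β U (a • x) = a • β U x) : M ⟶ N where
  val := PresheafOfModules.homMk
    { app U := AddCommGrpCat.ofHom (β U.unop)
      naturality U V i := by
        ext x
        exact nat (leOfHom i.unop) x }
    fun U a x ↦ smul U.unop a x

end Sections

/-- A natural map between sheaves, defined on the open subsets of a given one, is bijective if it is
bijective locally. -/
theorem bijective_of_local {X : TopCat.{u}} {F : Opens X → Type*} {G : Opens X → Type*}
    (rF : ∀ {U V : Opens X}, V ≤ U → F U → F V) (rG : ∀ {U V : Opens X}, V ≤ U → G U → G V)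
    (rG_rG : ∀ {U V W : Opens X} (h : V ≤ U) (k : W ≤ V) (x : G U),
      rG k (rG h x) = rG (k.trans h) x)
    (sepF : ∀ (U : Opens X) (s t : F U),
      (∀ x ∈ U, ∃ (V : Opens X) (hV : V ≤ U), x ∈ V ∧ rF hV s = rF hV t) → s = t)
    (glueF : ∀ {ι : Type u} (U : Opens X) (V : ι → Opens X) (hV : ∀ i, V i ≤ U)
      (_ : ∀ x ∈ U, ∃ i, x ∈ V i) (s : ∀ i, F (V i))
      (_ : ∀ i j, rF (inf_le_left : V i ⊓ V j ≤ V i) (s i) =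
        rF (inf_le_right : V i ⊓ V j ≤ V j) (s j)),
      ∃ t : F U, ∀ i, rF (hV i) t = s i)
    (sepG : ∀ (U : Opens X) (s t : G U),
      (∀ x ∈ U, ∃ (V : Opens X) (hV : V ≤ U), x ∈ V ∧ rG hV s = rG hV t) → s = t)
    (R : Opens X) (α : ∀ U, U ≤ R → F U → G U)
    (nat : ∀ {U V : Opens X} (h : V ≤ U) (k : U ≤ R) (x : F U),
      α V (h.trans k) (rF h x) = rG h (α U k x))
    (inj : ∀ U (k : U ≤ R) (s t : F U), α U k s = α U k t →
      ∀ x ∈ U, ∃ (V : Opens X) (hV : V ≤ U), x ∈ V ∧ rF hV s = rF hV t)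
    (surj : ∀ U (k : U ≤ R) (s : G U), ∀ x ∈ U, ∃ (V : Opens X) (hV : V ≤ U), x ∈ V ∧
      ∃ t, α V (hV.trans k) t = rG hV s)
    (U : Opens X) (k : U ≤ R) : Function.Bijective (α U k) := by
  have hinj : ∀ U (k : U ≤ R), Function.Injective (α U k) := fun U k s t h ↦
    sepF U s t (inj U k s t h)
  refine ⟨hinj U k, fun s ↦ ?_⟩
  choose V hV hx t ht using fun x : U ↦ surj U k s x.1 x.2
  -- Local preimages agree on overlaps because injectivity is already known on every smaller open.
  obtain ⟨y, hy⟩ := glueF U V hV (fun x hx' ↦ ⟨⟨x, hx'⟩, hx _⟩) t fun i j ↦ by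
    apply hinj _ (inf_le_left.trans ((hV i).trans k))
    rw [nat _ ((hV i).trans k), nat _ ((hV j).trans k), ht, ht, rG_rG, rG_rG]
  refine ⟨y, sepG U _ _ fun x hx' ↦ ⟨V ⟨x, hx'⟩, hV _, hx _, ?_⟩⟩
  rw [← nat _ k, hy, ht]

/-- Additive maps defined on a basis of open subsets extend. -/
theorem exists_extension {X : Scheme.{u}} (F G : TopCat.Presheaf Ab.{u} X) (hG : G.IsSheaf)
    {ι : Type*} (B : ι → X.Opens) (hB : Opens.IsBasis (Set.range B))
    (α : ∀ i, F.obj (op (B i)) →+ G.obj (op (B i)))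
    (nat : ∀ i j (h : B j ≤ B i) (x : F.obj (op (B i))),
      α j (F.map (homOfLE h).op x) = G.map (homOfLE h).op (α i x)) :
    ∃ β : F ⟶ G, ∀ i x, β.app (op (B i)) x = α i x := by
  refine ⟨TopCat.Sheaf.restrictHomEquivHom F ⟨G, hG⟩ hB
    { app i := AddCommGrpCat.ofHom (α i.unop)
      naturality i j h := by
        ext x
        exact nat i.unop j.unop (leOfHom h.unop.hom) x }, fun i x ↦ ?_⟩
  exact ConcreteCategory.congr_hom (TopCat.Sheaf.extend_hom_app F ⟨G, hG⟩ hB _ i) x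

/-! ### Part: affine schemes, modules of differentials and quasi-coherence. -/

/-! ### Square-zero extensions -/

/-- The square-zero extension `D ⊕ Q` of the ring `D` by the module `Q`. -/
@[ext]
structure SqZero (D : Type*) (Q : Type*) where
  /-- The component in the ring. -/
  fst : D
  /-- The component in the module. -/
  snd : Q

namespace SqZero

section

variable {D : Type*} [CommRing D] {Q : Type*} [AddCommGroup Q]

instance : Zero (SqZero D Q) := ⟨⟨0, 0⟩⟩
instance : One (SqZero D Q) := ⟨⟨1, 0⟩⟩
instance : Add (SqZero D Q) := ⟨fun x y ↦ ⟨x.1 + y.1, x.2 + y.2⟩⟩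
instance : Neg (SqZero D Q) := ⟨fun x ↦ ⟨-x.1, -x.2⟩⟩

@[simp] theorem fst_zero : (0 : SqZero D Q).fst = 0 := rfl
@[simp] theorem snd_zero : (0 : SqZero D Q).snd = 0 := rfl
@[simp] theorem fst_one : (1 : SqZero D Q).fst = 1 := rfl
@[simp] theorem snd_one : (1 : SqZero D Q).snd = 0 := rfl
@[simp] theorem fst_add (x y : SqZero D Q) : (x + y).fst = x.fst + y.fst := rfl
@[simp] theorem snd_add (x y : SqZero D Q) : (x + y).snd = x.snd + y.snd := rfl

end

variable {D : Type*} [CommRing D] {Q : Type*} [AddCommGroup Q] [Module D Q]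

instance : Mul (SqZero D Q) := ⟨fun x y ↦ ⟨x.1 * y.1, x.1 • y.2 + y.1 • x.2⟩⟩

@[simp] theorem fst_mul (x y : SqZero D Q) : (x * y).fst = x.fst * y.fst := rfl
@[simp] theorem snd_mul (x y : SqZero D Q) :
    (x * y).snd = x.fst • y.snd + y.fst • x.snd := rfl

instance : CommRing (SqZero D Q) where
  add_assoc x y z := SqZero.ext (add_assoc _ _ _) (add_assoc _ _ _)
  zero_add x := SqZero.ext (zero_add _) (zero_add _)
  add_zero x := SqZero.ext (add_zero _) (add_zero _)
  add_comm x y := SqZero.ext (add_comm _ _) (add_comm _ _)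
  neg_add_cancel x := SqZero.ext (neg_add_cancel _) (neg_add_cancel _)
  mul_assoc x y z := SqZero.ext (mul_assoc _ _ _) <| by
    simp only [snd_mul, fst_mul, smul_add, smul_smul, mul_comm z.fst, add_assoc]
  one_mul x := SqZero.ext (one_mul _) (by simp)
  mul_one x := SqZero.ext (mul_one _) (by simp)
  mul_comm x y := SqZero.ext (mul_comm _ _) (add_comm _ _)
  left_distrib x y z := SqZero.ext (left_distrib _ _ _) <| by
    simp only [snd_mul, fst_add, snd_add, smul_add, add_smul]
    abel
  right_distrib x y z := SqZero.ext (right_distrib _ _ _) <| by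
    simp only [snd_mul, fst_add, snd_add, smul_add, add_smul]
    abel
  zero_mul x := SqZero.ext (zero_mul _) (by simp)
  mul_zero x := SqZero.ext (mul_zero _) (by simp)
  nsmul := nsmulRec
  zsmul := zsmulRec

/-- The projection to the ring. -/
def fstHom (D Q : Type*) [CommRing D] [AddCommGroup Q] [Module D Q] : SqZero D Q →+* D where
  toFun := fst
  map_one' := rfl
  map_mul' _ _ := rfl
  map_zero' := rfl
  map_add' _ _ := rfl

/-- The inclusion of the ring. -/
def inl (D Q : Type*) [CommRing D] [AddCommGroup Q] [Module D Q] : D →+* SqZero D Q where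
  toFun d := ⟨d, 0⟩
  map_one' := rfl
  map_mul' _ _ := SqZero.ext rfl (by simp)
  map_zero' := rfl
  map_add' _ _ := SqZero.ext rfl (by simp)

/-- The inclusion of the module. -/
def inr (D Q : Type*) [CommRing D] [AddCommGroup Q] [Module D Q] : Q →+ SqZero D Q where
  toFun q := ⟨0, q⟩
  map_zero' := rfl
  map_add' _ _ := SqZero.ext (by simp) rfl

@[simp] theorem fst_inl (d : D) : (inl D Q d).fst = d := rfl
@[simp] theorem snd_inl (d : D) : (inl D Q d).snd = 0 := rfl
@[simp] theorem fst_inr (q : Q) : (inr D Q q).fst = 0 := rfl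
@[simp] theorem snd_inr (q : Q) : (inr D Q q).snd = q := rfl

/-- The ring homomorphism to a square-zero extension given by a derivation. -/
def lift {C : Type*} [CommRing C] (φ : C →+* D) (d : C →+ Q)
    (h : ∀ a b, d (a * b) = φ a • d b + φ b • d a) : C →+* SqZero D Q where
  toFun c := ⟨φ c, d c⟩
  map_one' := SqZero.ext (map_one φ) <| by
    have := h 1 1
    rw [mul_one, map_one φ, one_smul] at this
    simpa using this
  map_mul' a b := SqZero.ext (map_mul φ a b) (h a b)
  map_zero' := SqZero.ext (map_zero φ) (map_zero d)
  map_add' a b := SqZero.ext (map_add φ a b) (map_add d a b)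

/-- This is what allows derivations to be extended to localizations: an element inverted in the ring
is inverted in the square-zero extension too. -/
theorem isUnit_of_fst {x : SqZero D Q} (h : IsUnit x.fst) : IsUnit x := by
  obtain ⟨u, hu⟩ := h
  -- The inverse of `(u, q)` is `(u⁻¹, -u⁻² q)`, since the module squares to zero.
  refine IsUnit.of_mul_eq_one ⟨(u⁻¹ : Dˣ), -(((u⁻¹ : Dˣ) : D) • ((u⁻¹ : Dˣ) : D) • x.snd)⟩ ?_
  refine SqZero.ext ?_ ?_
  · simp [← hu]
  · simp [snd_mul, ← hu, smul_smul]

/-- The functoriality of square-zero extensions. -/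
def map {D' : Type*} [CommRing D'] {Q' : Type*} [AddCommGroup Q'] [Module D' Q'] (φ : D →+* D')
    (m : Q →+ Q') (h : ∀ d q, m (d • q) = φ d • m q) : SqZero D Q →+* SqZero D' Q' where
  toFun x := ⟨φ x.fst, m x.snd⟩
  map_one' := SqZero.ext (map_one φ) (map_zero m)
  map_mul' a b := SqZero.ext (map_mul φ _ _) (by simp [h])
  map_zero' := SqZero.ext (map_zero φ) (map_zero m)
  map_add' a b := SqZero.ext (map_add φ _ _) (map_add m _ _)

end SqZero

/-! ### Derivations on affine schemes -/

section Affine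

variable {C : CommRingCat.{u}} {M : (Spec C).Modules}

/-- The basic open subset `D(e)` of an affine scheme. -/
def specOpen (e : C) : (Spec C).Opens := PrimeSpectrum.basicOpen e

theorem specOpen_one : specOpen (1 : C) = ⊤ := PrimeSpectrum.basicOpen_one

instance (e : C) : IsLocalization.Away e Γ(Spec C, specOpen e) :=
  StructureSheaf.IsLocalization.to_basicOpen C e

theorem exists_basicOpen_le {U : (Spec C).Opens} {x : Spec C} (hx : x ∈ U) :
    ∃ e : C, specOpen e ≤ U ∧ x ∈ specOpen e := by
  obtain ⟨_, ⟨_, ⟨e, rfl⟩, rfl⟩, hxe, he⟩ :=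
    PrimeSpectrum.isBasis_basic_opens.exists_subset_of_mem_open hx U.2
  exact ⟨e, he, hxe⟩

theorem resO_algebraMap {U V : (Spec C).Opens} (h : V ≤ U) (c : C) :
    resO (Spec C) h (algebraMap C Γ(Spec C, U) c) = algebraMap C Γ(Spec C, V) c := rfl

theorem algebraMap_smul_section {U : (Spec C).Opens} (c : C) (x : Γ(M, U)) :
    algebraMap C Γ(Spec C, U) c • x = c • x := algebraMap_smul _ _ _

theorem res_smul_Spec {U V : (Spec C).Opens} (h : V ≤ U) (c : C) (x : Γ(M, U)) :
    res M h (c • x) = c • res M h x := by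
  rw [← algebraMap_smul_section, res_smul, resO_algebraMap, algebraMap_smul_section]

theorem isUnit_algebraMap_basicOpen (e : C) :
    IsUnit (algebraMap C Γ(Spec C, specOpen e) e) :=
  IsLocalization.Away.algebraMap_isUnit e

/-- On a basic open `D(e)` a function `t` satisfies `t e^n = c` with `c` global; the Leibniz rule
gives `e^n • d t = 0`, and `e` is invertible there. The sheaf `M` may be any sheaf of modules. -/
theorem derivation_eq_zero (d : ∀ U, Γ(Spec C, U) →+ Γ(M, U))
    (leibniz : ∀ U (a b : Γ(Spec C, U)), d U (a * b) = a • d U b + b • d U a)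
    (map : ∀ {U V : (Spec C).Opens} (h : V ≤ U) (a : Γ(Spec C, U)),
      d V (resO (Spec C) h a) = res M h (d U a))
    (zero : ∀ c : C, d ⊤ (algebraMap C Γ(Spec C, ⊤) c) = 0) (U : (Spec C).Opens)
    (s : Γ(Spec C, U)) : d U s = 0 := by
  refine section_ext fun x hx ↦ ?_
  obtain ⟨e, he, hxe⟩ := exists_basicOpen_le hx
  refine ⟨_, he, hxe, ?_⟩
  rw [map_zero, ← map]
  generalize resO (Spec C) he s = t
  have hz : ∀ c : C, d (specOpen e) (algebraMap C _ c) = 0 := fun c ↦ by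
    rw [← resO_algebraMap le_top c, map, zero, map_zero]
  obtain ⟨⟨c, y⟩, hc⟩ := IsLocalization.surj (Submonoid.powers e) t
  have hu := IsLocalization.map_units Γ(Spec C, specOpen e) y
  have := hz c
  rw [← hc, leibniz, hz, smul_zero, zero_add] at this
  obtain ⟨v, hv⟩ := hu
  rw [← hv] at this
  exact (smul_eq_zero_iff_eq v).mp this

/-- The lift of a derivation to a localization. -/
theorem exists_derivation_basicOpen (d : C →+ Γ(M, ⊤))
    (leibniz : ∀ a b, d (a * b) = a • d b + b • d a)
    (e : C) : ∃ l : Γ(Spec C, specOpen e) →+*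
      SqZero Γ(Spec C, specOpen e) Γ(M, specOpen e),
      (∀ c, (l c).fst = c) ∧ ∀ c : C, (l (algebraMap C _ c)).snd = res M le_top (d c) := by
  -- A derivation is a ring homomorphism to the square-zero extension lifting the structure map. As
  -- `e` goes to a unit, it extends to the localization, with no computation of the quotient rule.
  let ψ : C →+* SqZero Γ(Spec C, specOpen e) Γ(M, specOpen e) :=
    SqZero.lift (algebraMap C _) ((res M le_top).comp d) fun a b ↦ by
      simp only [AddMonoidHom.comp_apply, leibniz, map_add, res_smul_Spec, algebraMap_smul_section]
  have hψ : IsUnit (ψ e) := SqZero.isUnit_of_fst (isUnit_algebraMap_basicOpen e)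
  refine ⟨IsLocalization.Away.lift e hψ, fun c ↦ ?_, fun c ↦ ?_⟩
  · have : (SqZero.fstHom _ _).comp (IsLocalization.Away.lift e hψ) = RingHom.id _ := by
      refine IsLocalization.ringHom_ext (Submonoid.powers e) (RingHom.ext fun c ↦ ?_)
      simp only [RingHom.comp_apply, IsLocalization.Away.lift_eq]
      rfl
    exact congrArg (fun r : _ →+* _ ↦ r c) this
  · rw [IsLocalization.Away.lift_eq]
    rfl

theorem exists_derivation (d : C →+ Γ(M, ⊤)) (leibniz : ∀ a b, d (a * b) = a • d b + b • d a) :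
    ∃ D : ∀ U, Γ(Spec C, U) →+ Γ(M, U),
      (∀ U (a b : Γ(Spec C, U)), D U (a * b) = a • D U b + b • D U a) ∧
      (∀ {U V : (Spec C).Opens} (h : V ≤ U) (a : Γ(Spec C, U)),
        D V (resO (Spec C) h a) = res M h (D U a)) ∧
      ∀ c : C, D ⊤ (algebraMap C _ c) = d c := by
  choose l hl₁ hl₂ using exists_derivation_basicOpen (M := M) d leibniz
  obtain ⟨β, hβ⟩ := exists_extension
    ((Spec C).presheaf ⋙ forget₂ CommRingCat RingCat ⋙ forget₂ RingCat Ab) M.presheaf M.isSheaf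
    (fun e : C ↦ specOpen e) PrimeSpectrum.isBasis_basic_opens
    (fun e ↦ AddMonoidHom.mk' (fun c ↦ (l e c).snd) fun a b ↦ by rw [map_add]; rfl) (by
      intro e e' h x
      have hm : ∀ (a : Γ(Spec C, specOpen e)) (q : Γ(M, specOpen e)),
          res M h (a • q) = resO _ h a • res M h q := res_smul h
      -- Compatibility with restriction is an equality of ring homomorphisms out of a localization,
      -- hence is checked on `C`.
      have : (SqZero.map (resO (Spec C) h) (res M h) hm).comp (l e) =
          (l e').comp (resO (Spec C) h) := by
        refine IsLocalization.ringHom_ext (Submonoid.powers e) (RingHom.ext fun c ↦ ?_)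
        refine SqZero.ext ?_ ?_
        · exact (congrArg (resO (Spec C) h) (hl₁ e _)).trans (hl₁ e' _).symm
        · refine (congrArg (res M h) (hl₂ e c)).trans ?_
          rw [res_res]
          exact (hl₂ e' c).symm
      exact (congrArg (fun r : _ →+* _ ↦ (r x).snd) this).symm)
  have nat : ∀ {U V : (Spec C).Opens} (h : V ≤ U) (a : Γ(Spec C, U)),
        (β.app (op V)).hom (resO (Spec C) h a) = res M h ((β.app (op U)).hom a) := fun h a ↦
    ConcreteCategory.congr_hom (β.naturality (homOfLE h).op) a
  refine ⟨fun U ↦ (β.app (op U)).hom, fun U a b ↦ ?_, nat, fun c ↦ ?_⟩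
  · refine section_ext fun x hx ↦ ?_
    obtain ⟨e, he, hxe⟩ := exists_basicOpen_le hx
    refine ⟨_, he, hxe, ?_⟩
    have hb : ∀ y, (β.app (op (specOpen e))).hom y = (l e y).snd := hβ e
    rw [map_add, res_smul, res_smul, ← nat, ← nat, ← nat, hb, hb, hb, map_mul, map_mul,
      SqZero.snd_mul, hl₁, hl₁]
  · refine section_ext fun x hx ↦ ?_
    refine ⟨specOpen (1 : C), le_top, (by rw [specOpen_one]; exact hx), ?_⟩
    have hb : ∀ y, (β.app (op (specOpen 1))).hom y = (l 1 y).snd := hβ 1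
    rw [← nat, hb]
    exact hl₂ 1 c

end Affine

section Tilde

variable {C : CommRingCat.{u}}

/-- The identification of a module with the global sections of the associated sheaf. -/
def tildeTop (Q : ModuleCat.{u} C) : Q →ₗ[C] Γ(tilde Q, (⊤ : (Spec C).Opens)) :=
  (tilde.toOpen Q ⊤).hom

theorem tildeTop_bijective (Q : ModuleCat.{u} C) : Function.Bijective (tildeTop Q) :=
  ConcreteCategory.bijective_of_isIso (tilde.toOpen Q ⊤)

/-- The morphism from `tilde Q` given by its action on global sections. -/
def tildeDesc {Q : ModuleCat.{u} C} {M : (Spec C).Modules}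
    (m : Q →ₗ[C] Γ(M, (⊤ : (Spec C).Opens))) : tilde Q ⟶ M :=
  (tilde.adjunction.homEquiv Q M).symm (ModuleCat.ofHom (Y := moduleSpecΓFunctor.obj M) m)

theorem tildeDesc_top {Q : ModuleCat.{u} C} {M : (Spec C).Modules}
    (m : Q →ₗ[C] Γ(M, (⊤ : (Spec C).Opens))) (q : Q) :
    (tildeDesc m).app ⊤ (tildeTop Q q) = m q := by
  have := (Adjunction.homEquiv_unit _ _ _ _).symm.trans
    ((tilde.adjunction.homEquiv Q M).apply_symm_apply
      (ModuleCat.ofHom (Y := moduleSpecΓFunctor.obj M) m))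
  exact ConcreteCategory.congr_hom this q

theorem tilde_hom_ext {Q : ModuleCat.{u} C} {M : (Spec C).Modules} {φ ψ : tilde Q ⟶ M}
    (h : ∀ q : Q, φ.app ⊤ (tildeTop Q q) = ψ.app ⊤ (tildeTop Q q)) : φ = ψ := by
  apply (tilde.adjunction.homEquiv Q M).injective
  refine (Adjunction.homEquiv_unit _ _ _ _).trans
    (Eq.trans ?_ (Adjunction.homEquiv_unit _ _ _ _).symm)
  ext q
  exact h q

/-- The action of a morphism of sheaves of modules on global sections. -/
def topHom {M N : (Spec C).Modules} (φ : M ⟶ N) :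
    Γ(M, (⊤ : (Spec C).Opens)) →ₗ[C] Γ(N, (⊤ : (Spec C).Opens)) where
  toFun := φ.app ⊤
  map_add' := map_add _
  map_smul' c x := by
    rw [← algebraMap_smul_section, Scheme.Modules.Hom.app_smul, algebraMap_smul_section]
    rfl

end Tilde

section Affine

variable {A C : CommRingCat.{u}} [Algebra A C]

/-- The morphism of spectra given by an algebra. -/
abbrev specAlg (A C : CommRingCat.{u}) [Algebra A C] :
    Spec C ⟶ Spec A := Spec.map (CommRingCat.ofHom (algebraMap A C))

theorem specAlg_app_algebraMap (V : (Spec A).Opens) (a : A) :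
    (specAlg A C).app V (algebraMap A Γ(Spec A, V) a) =
      algebraMap C Γ(Spec C, specAlg A C ⁻¹ᵁ V) (algebraMap A C a) := by
  have h := ConcreteCategory.congr_hom
    (Scheme.ΓSpecIso_inv_naturality (CommRingCat.ofHom (algebraMap A C))) a
  have h₂ := ConcreteCategory.congr_hom ((specAlg A C).c.naturality (homOfLE (le_top : V ≤ ⊤)).op)
    ((Scheme.ΓSpecIso A).inv a)
  refine h₂.trans ?_
  exact congrArg (resO (Spec C) le_top) h.symm

variable {M : (Spec C).Modules}

/-- A derivation on an affine scheme is given by its action on global sections. -/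
theorem exists_specDerivation (d : C →+ Γ(M, (⊤ : (Spec C).Opens)))
    (leibniz : ∀ a b : C, d (a * b) = a • d b + b • d a)
    (hd : ∀ a : A, d (algebraMap A C a) = 0) :
    ∃ D : SheafDerivation (specAlg A C) M, ∀ c : C, D.d ⊤ (algebraMap C _ c) = d c := by
  obtain ⟨D, h₁, h₂, h₃⟩ := exists_derivation (M := M) d leibniz
  refine ⟨⟨D, h₁, h₂, fun V a ↦ ?_⟩, h₃⟩
  refine derivation_eq_zero (C := A) (M := (Scheme.Modules.pushforward (specAlg A C)).obj M)
    (fun V ↦ (D (specAlg A C ⁻¹ᵁ V)).comp ((specAlg A C).app V).hom.toAddMonoidHom)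
    (fun V a b ↦ ?_) (fun {V W} h a ↦ ?_) (fun a ↦ ?_) V a
  · exact (congrArg (D _) (map_mul ((specAlg A C).app V).hom a b)).trans (h₁ _ _ _)
  · refine (congrArg (D _) (ConcreteCategory.congr_hom
      ((specAlg A C).c.naturality (homOfLE h).op) a)).trans (h₂ _ _)
  · refine (congrArg (D _) (specAlg_app_algebraMap ⊤ a)).trans ?_
    exact (h₃ _).trans (hd a)

theorem specDerivation_ext {D D' : SheafDerivation (specAlg A C) M}
    (h : ∀ c : C, D.d ⊤ (algebraMap C _ c) = D'.d ⊤ (algebraMap C _ c)) : D = D' := by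
  refine SheafDerivation.ext fun U a ↦ sub_eq_zero.mp ?_
  refine derivation_eq_zero (M := M) (fun U ↦ D.d U - D'.d U) (fun U a b ↦ ?_)
    (fun {U V} h a ↦ ?_) (fun c ↦ ?_) U a
  · simp only [AddMonoidHom.sub_apply, D.leibniz, D'.leibniz, smul_sub]
    abel
  · simp only [AddMonoidHom.sub_apply, map_sub]
    exact congrArg₂ _ (D.map h a) (D'.map h a)
  · exact sub_eq_zero.mpr (h c)

/-- The `A`-module structure on sections of a sheaf of modules over the spectrum of an
`A`-algebra. -/
theorem kaehler_algebraMap_leibniz (D : SheafDerivation (specAlg A C) M) (a b : C) :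
    D.d ⊤ (algebraMap C Γ(Spec C, ⊤) (a * b)) =
      a • D.d ⊤ (algebraMap C _ b) + b • D.d ⊤ (algebraMap C _ a) := by
  rw [map_mul, D.leibniz]
  exact congrArg₂ _ (algebraMap_smul_section _ _)
    (algebraMap_smul_section _ _)

theorem specDerivation_algebraMap (D : SheafDerivation (specAlg A C) M) (a : A) :
    D.d ⊤ (algebraMap C Γ(Spec C, ⊤) (algebraMap A C a)) = 0 := by
  have := D.const ⊤ (algebraMap A Γ(Spec A, ⊤) a)
  rwa [specAlg_app_algebraMap] at this

/-- The module of Kähler differentials is the module of global sections of the sheaf of Kähler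
differentials. -/
theorem exists_omegaLinearMap (D : SheafDerivation (specAlg A C) M) :
    ∃ m : Ω[C⁄A] →ₗ[C] Γ(M, (⊤ : (Spec C).Opens)),
      ∀ c, m (KaehlerDifferential.D A C c) = D.d ⊤ (algebraMap C _ c) := by
  let _ : Module A Γ(M, (⊤ : (Spec C).Opens)) := Module.compHom _ (algebraMap A C)
  have : IsScalarTower A C Γ(M, (⊤ : (Spec C).Opens)) :=
    IsScalarTower.of_algebraMap_smul fun _ _ ↦ rfl
  let d : Derivation A C Γ(M, (⊤ : (Spec C).Opens)) :=
    { toFun := fun c ↦ D.d ⊤ (algebraMap C _ c)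
      map_add' := fun a b ↦ by rw [map_add, map_add]
      map_smul' := fun a b ↦ by
        rw [Algebra.smul_def, kaehler_algebraMap_leibniz, specDerivation_algebraMap, smul_zero,
          add_zero]
        rfl
      map_one_eq_zero' := by
        have := kaehler_algebraMap_leibniz D 1 1
        rw [mul_one, one_smul] at this
        exact left_eq_add.mp this
      leibniz' := kaehler_algebraMap_leibniz D }
  exact ⟨d.liftKaehlerDifferential, fun c ↦ d.liftKaehlerDifferential_comp_D c⟩

variable (A C) in
/-- The quasi-coherent sheaf associated to the module of Kähler differentials. -/
def omegaTilde : (Spec C).Modules := tilde (ModuleCat.of C (Ω[C⁄A]))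

variable (A C) in
/-- The identification of the module of Kähler differentials with the global sections of
the associated sheaf. -/
def omegaTop : Ω[C⁄A] →ₗ[C] Γ(omegaTilde A C, (⊤ : (Spec C).Opens)) :=
  tildeTop (ModuleCat.of C (Ω[C⁄A]))

theorem exists_omegaDerivation : ∃ D : SheafDerivation (specAlg A C) (omegaTilde A C),
    ∀ c : C, D.d ⊤ (algebraMap C _ c) = omegaTop A C (KaehlerDifferential.D A C c) :=
  exists_specDerivation
    ((omegaTop A C).toAddMonoidHom.comp (KaehlerDifferential.D A C).toLinearMap.toAddMonoidHom)
    (fun a b ↦ by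
      refine (congrArg (omegaTop A C) ((KaehlerDifferential.D A C).leibniz a b)).trans ?_
      rw [map_add, map_smul, map_smul]
      rfl)
    (fun a ↦ (congrArg (omegaTop A C) ((KaehlerDifferential.D A C).map_algebraMap a)).trans
      (map_zero _))

theorem exists_omegaTildeDesc (D : SheafDerivation (specAlg A C) M) :
    ∃ φ : omegaTilde A C ⟶ M, ∀ c : C,
      φ.app ⊤ (omegaTop A C (KaehlerDifferential.D A C c)) = D.d ⊤ (algebraMap C _ c) := by
  obtain ⟨m, hm⟩ := exists_omegaLinearMap D
  exact ⟨tildeDesc (Q := ModuleCat.of C (Ω[C⁄A])) m, fun c ↦ (tildeDesc_top _ _).trans (hm c)⟩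

theorem omegaTilde_hom_ext {φ ψ : omegaTilde A C ⟶ M}
    (h : ∀ c : C, φ.app ⊤ (omegaTop A C (KaehlerDifferential.D A C c)) =
      ψ.app ⊤ (omegaTop A C (KaehlerDifferential.D A C c))) : φ = ψ := by
  refine tilde_hom_ext fun q ↦ ?_
  have : (topHom φ).comp (omegaTop A C) = (topHom ψ).comp (omegaTop A C) := by
    refine LinearMap.ext_on (KaehlerDifferential.span_range_derivation A C) ?_
    rintro _ ⟨c, rfl⟩
    exact h c
  exact congrArg (fun l : _ →ₗ[C] _ ↦ l q) this

theorem kaehlerSpec_hom_ext {φ ψ : kaehler (specAlg A C) ⟶ M}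
    (h : ∀ c : C, φ.app ⊤ ((kaehlerD (specAlg A C)).d ⊤ (algebraMap C _ c)) =
      ψ.app ⊤ ((kaehlerD (specAlg A C)).d ⊤ (algebraMap C _ c))) : φ = ψ := by
  have : (kaehlerD (specAlg A C)).comp φ = (kaehlerD (specAlg A C)).comp ψ := specDerivation_ext h
  exact kaehler_hom_ext fun U a ↦ congrArg (fun D : SheafDerivation _ _ ↦ D.d U a) this

variable (A C) in
/-- The sheaf of Kähler differentials of an affine scheme. -/
theorem exists_kaehlerSpecIso : ∃ e : kaehler (specAlg A C) ≅ omegaTilde A C,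
      ∀ c : C, e.hom.app ⊤ ((kaehlerD (specAlg A C)).d ⊤ (algebraMap C _ c)) =
        omegaTop A C (KaehlerDifferential.D A C c) := by
  obtain ⟨D, hD⟩ := exists_omegaDerivation (A := A) (C := C)
  obtain ⟨φ, hφ⟩ := exists_omegaTildeDesc (kaehlerD (specAlg A C))
  have hdesc : ∀ c : C, D.desc.app ⊤ ((kaehlerD (specAlg A C)).d ⊤ (algebraMap C _ c)) =
      omegaTop A C (KaehlerDifferential.D A C c) := fun c ↦ (D.desc_d ⊤ _).trans (hD c)
  refine ⟨⟨D.desc, φ, kaehlerSpec_hom_ext fun c ↦ ?_, omegaTilde_hom_ext fun c ↦ ?_⟩, hdesc⟩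
  · exact (congrArg (φ.app ⊤) (hdesc c)).trans (hφ c)
  · exact (congrArg (D.desc.app ⊤) (hφ c)).trans (hdesc c)

end Affine

/-! ### Quasi-coherent sheaves -/

/-- The whole space pulls back to the whole space, so each comparison category has an object to
which every other one maps. Finality makes the pullback of the structure sheaf the structure sheaf,
so that presentations pull back. -/
instance {X Y : Scheme.{u}} (g : X ⟶ Y) : (Opens.map g.base).Final := by
  have : IsFiltered Y.Opens := inferInstance
  refine ⟨fun V ↦ ?_⟩
  have : Nonempty (StructuredArrow V (Opens.map g.base)) :=
    ⟨StructuredArrow.mk (Y := ⊤) (homOfLE le_top : V ⟶ (Opens.map g.base).obj ⊤)⟩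
  refine zigzag_isConnected fun a b ↦ ?_
  exact Zigzag.trans
    (Zigzag.of_hom (StructuredArrow.homMk (homOfLE le_top) rfl : a ⟶
      StructuredArrow.mk (Y := ⊤) (homOfLE le_top : V ⟶ (Opens.map g.base).obj ⊤)))
    (Zigzag.of_inv (StructuredArrow.homMk (homOfLE le_top) rfl))

/-- The pullback of a presentation. -/
def presentationPullback {X Y : Scheme.{u}} (g : X ⟶ Y) {M : Y.Modules} (p : M.Presentation) :
    ((Scheme.Modules.pullback g).obj M).Presentation :=
  let F : SheafOfModules.{u} Y.ringCatSheaf ⥤ SheafOfModules.{u} X.ringCatSheaf :=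
    Scheme.Modules.pullback g
  have : PreservesColimitsOfSize.{u, u} F :=
    (Scheme.Modules.pullbackPushforwardAdjunction g).leftAdjoint_preservesColimits
  have : (SheafOfModules.pushforward.{u} g.toRingCatSheafHom).IsRightAdjoint :=
    (Scheme.Modules.pullbackPushforwardAdjunction g).isRightAdjoint
  have : IsIso (SheafOfModules.pullbackObjUnitToUnit.{u} g.toRingCatSheafHom) :=
    SheafOfModules.instIsIsoPullbackObjUnitToUnitOfFinal g.toRingCatSheafHom
  p.map F (asIso (SheafOfModules.pullbackObjUnitToUnit g.toRingCatSheafHom)).symm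

/-- The transport of a presentation. -/
def presentationOfIso {X : Scheme.{u}} {M N : X.Modules} (e : M ≅ N) (p : M.Presentation) :
    N.Presentation :=
  have : IsIso (C := SheafOfModules.{u} X.ringCatSheaf) (X := M) (Y := N) e.hom :=
    ⟨e.inv, e.hom_inv_id, e.inv_hom_id⟩
  SheafOfModules.Presentation.ofIsIso.{u, u, u} (M := M) (N := N) e.hom p

theorem nonempty_presentation_tilde {C : CommRingCat.{u}} (Q : ModuleCat.{u} C) :
    Nonempty (tilde Q).Presentation :=
  ⟨presentationTilde.{u} _ .univ (by simp) _ (Submodule.span_eq _)⟩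

/-- A sheaf of modules with local presentations is quasi-coherent. -/
theorem isQuasicoherent_of_local {Y : Scheme.{u}} (M : Y.Modules)
    (h : ∀ y : Y, ∃ (Z : Scheme.{u}) (j : Z ⟶ Y) (_ : IsOpenImmersion j),
      y ∈ j.opensRange ∧ Nonempty (M.restrict j).Presentation) : M.IsQuasicoherent := by
  choose Z j hj hy p using h
  refine SheafOfModules.QuasicoherentData.isQuasicoherent (M := M)
    { I := Y
      X := fun y ↦ (j y).opensRange
      coversTop := by
        rw [Opens.coversTop_iff, IsOpenCover, eq_top_iff]
        exact fun y _ ↦ Opens.mem_iSup.mpr ⟨y, hy y⟩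
      presentation := fun y ↦ ?_ }
  let U := (j y).opensRange
  let t : U.toScheme ⟶ Z y := (j y).isoOpensRange.inv
  have ht : t ≫ j y = U.ι := (j y).isoOpensRange_inv_comp
  -- Quasi-coherence is formulated on the slice site of `U`, whereas the given presentation lives on
  -- the scheme `Z y`; this isomorphism and the equivalence `overEquiv` carry one to the other.
  let iso : Scheme.Modules.restrictFunctor (j y) ⋙ Scheme.Modules.restrictFunctor t ≅
      SheafOfModules.overFunctor Y.ringCatSheaf U ⋙ (Scheme.Modules.overEquiv U).functor :=
    (Scheme.Modules.restrictFunctorComp _ _).symm ≪≫ Scheme.Modules.restrictFunctorCongr ht ≪≫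
      (Scheme.Modules.overFunctorEquiv U).symm
  let q := presentationOfIso (iso.app M)
    (Scheme.Modules.presentationRestrict t (p y).some)
  let F : SheafOfModules.{u} U.toScheme.ringCatSheaf ⥤ SheafOfModules.{u} (Y.ringCatSheaf.over U) :=
    (Scheme.Modules.overEquiv U).inverse
  have : PreservesColimitsOfSize.{u, u} F :=
    (Scheme.Modules.overEquiv U).symm.toAdjunction.leftAdjoint_preservesColimits
  let q' := SheafOfModules.Presentation.map q F
    ((Scheme.Modules.overEquiv U).unitIso.app (SheafOfModules.unit (Y.ringCatSheaf.over U)))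
  exact q'.ofIsIso ((Scheme.Modules.overEquiv U).unitIso.app (M.over U)).inv

/-- A linear map between the global sections of sheaves of modules, the first being quasi-coherent,
comes from a unique morphism. -/
theorem existsUnique_hom_of_isQuasicoherent {D : CommRingCat.{u}} (M : (Spec D).Modules)
    {N : (Spec D).Modules} (hM : M.IsQuasicoherent)
    (m : Γ(M, (⊤ : (Spec D).Opens)) →ₗ[D] Γ(N, (⊤ : (Spec D).Opens))) :
    ∃! φ : M ⟶ N, ∀ x, φ.app ⊤ x = m x := by
  let Q : ModuleCat.{u} D := moduleSpecΓFunctor.obj M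
  let m₀ : Q →ₗ[D] Γ(M, (⊤ : (Spec D).Opens)) := LinearMap.id
  -- For quasi-coherent `M` the counit is an isomorphism, so `M` can be replaced by the sheaf
  -- associated to its global sections, out of which morphisms to an arbitrary `N` are known.
  have he : tildeDesc m₀ = tilde.adjunction.counit.app M := by
    refine (Adjunction.homEquiv_counit _ _ _ _).trans ?_
    exact (congrArg (· ≫ tilde.adjunction.counit.app M)
      ((tilde.functor D).map_id Q)).trans (Category.id_comp _)
  have : IsIso (tildeDesc m₀) := by
    rw [he]
    exact Scheme.Modules.isIso_fromTildeΓ_of_isQuasicoherent M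
  have h₀ : ∀ q : Q, (tildeDesc m₀).app ⊤ (tildeTop Q q) = q := tildeDesc_top m₀
  have hinv : ∀ x : Q, (inv (tildeDesc m₀)).app ⊤ x = tildeTop Q x := fun x ↦ by
    have h := congrArg (fun φ : tilde Q ⟶ tilde Q ↦ φ.app ⊤ (tildeTop Q x))
      (IsIso.hom_inv_id (tildeDesc m₀))
    exact (congrArg ((inv (tildeDesc m₀)).app ⊤) (h₀ x).symm).trans h
  refine ⟨inv (tildeDesc m₀) ≫ tildeDesc (Q := Q) m, fun x ↦ ?_, fun φ hφ ↦ ?_⟩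
  · exact (congrArg ((tildeDesc (Q := Q) m).app ⊤) (hinv x)).trans (tildeDesc_top (Q := Q) m x)
  · rw [IsIso.eq_inv_comp]
    refine tilde_hom_ext fun q ↦ ?_
    exact ((congrArg (φ.app ⊤) (h₀ q)).trans (hφ q)).trans (tildeDesc_top (Q := Q) m q).symm

/-- Local affine charts of a morphism. -/
theorem exists_affine_chart {X S : Scheme.{u}} (f : X ⟶ S) (x : X) (V : X.Opens) (hx : x ∈ V)
    (W : S.Opens) (hW : f x ∈ W) :
    ∃ (A C : CommRingCat.{u}) (_ : Algebra A C) (j : Spec C ⟶ X) (i : Spec A ⟶ S)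
      (_ : IsOpenImmersion j) (_ : IsOpenImmersion i),
      x ∈ j.opensRange ∧ j.opensRange ≤ V ∧ i.opensRange ≤ W ∧ j ≫ f = specAlg A C ≫ i := by
  obtain ⟨_, ⟨W', hW', rfl⟩, hfW', hW'W⟩ :=
    S.isBasis_affineOpens.exists_subset_of_mem_open hW W.2
  obtain ⟨_, ⟨V', hV', rfl⟩, hxV', hV'V⟩ :=
    X.isBasis_affineOpens.exists_subset_of_mem_open (show x ∈ V ⊓ f ⁻¹ᵁ W' from ⟨hx, hfW'⟩)
      (V ⊓ f ⁻¹ᵁ W').2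
  have hV' : IsAffineOpen V' := hV'
  have hW' : IsAffineOpen W' := hW'
  have hle : V' ≤ f ⁻¹ᵁ W' := fun y hy ↦ (hV'V hy).2
  refine ⟨Γ(S, W'), Γ(X, V'), (f.appLE W' V' hle).hom.toAlgebra, hV'.fromSpec, hW'.fromSpec,
    inferInstance, inferInstance, ?_, ?_, ?_, ?_⟩
  · rw [hV'.opensRange_fromSpec]
    exact hxV'
  · rw [hV'.opensRange_fromSpec]
    exact fun y hy ↦ (hV'V hy).1
  · rw [hW'.opensRange_fromSpec]
    exact hW'W
  · exact (IsAffineOpen.SpecMap_appLE_fromSpec f hW' hV' hle).symm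

/-- Pullbacks of the sheaf of Kähler differentials are quasi-coherent. -/
theorem isQuasicoherent_pullback_kaehler {X S Z : Scheme.{u}} (f : X ⟶ S) (g : Z ⟶ X) :
    ((Scheme.Modules.pullback g).obj (kaehler f)).IsQuasicoherent := by
  refine isQuasicoherent_of_local _ fun z ↦ ?_
  obtain ⟨A, C, _, j, i, _, _, hz, -, -, hji⟩ :=
    exists_affine_chart f (g z) ⊤ trivial ⊤ trivial
  -- On the preimage of an affine chart of `X` the sheaf is a pullback of `omegaTilde A C`, which
  -- has a presentation.
  let W : Z.Opens := g ⁻¹ᵁ j.opensRange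
  have hW : Set.range (W.ι ≫ g) ⊆ Set.range j := by
    rintro _ ⟨w, rfl⟩
    exact w.2
  let g' : W.toScheme ⟶ Spec C := IsOpenImmersion.lift j (W.ι ≫ g) hW
  have hg' : g' ≫ j = W.ι ≫ g := IsOpenImmersion.lift_fac j (W.ι ≫ g) hW
  refine ⟨W, W.ι, inferInstance, ?_, ?_⟩
  · rw [Scheme.Opens.opensRange_ι]
    exact hz
  · obtain ⟨e, -⟩ := exists_kaehlerSpecIso A C
    let iso : omegaTilde A C ≅ (Scheme.Modules.pullback j).obj (kaehler f) :=
      e.symm ≪≫ (kaehlerRestrictIso f (specAlg A C) j i hji).symm ≪≫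
        (Scheme.Modules.restrictFunctorIsoPullback j).app (kaehler f)
    let iso₂ : (Scheme.Modules.pullback g').obj (omegaTilde A C) ≅
        ((Scheme.Modules.pullback g).obj (kaehler f)).restrict W.ι :=
      (Scheme.Modules.pullback g').mapIso iso ≪≫
        (Scheme.Modules.pullbackComp g' j).app (kaehler f) ≪≫
        (Scheme.Modules.pullbackCongr hg').app (kaehler f) ≪≫
        ((Scheme.Modules.pullbackComp W.ι g).app (kaehler f)).symm ≪≫
        ((Scheme.Modules.restrictFunctorIsoPullback W.ι).app _).symm
    exact ⟨presentationOfIso iso₂ (presentationPullback g' (nonempty_presentation_tilde _).some)⟩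

/-! ### Part: infinitesimal deformations of morphisms of schemes. -/

/-! ### Deformations of morphisms -/

/-- The two functions to be compared live on opens that are only propositionally equal. They are
compared through a restriction map along an arbitrary inclusion `k`, which avoids transport. -/
theorem schemeHom_ext_of_app {X Y : Scheme.{u}} {f g : X ⟶ Y} (hb : f.base = g.base)
    (h : ∀ (U : Y.Opens) (k : g ⁻¹ᵁ U ≤ f ⁻¹ᵁ U) (a : Γ(Y, U)),
      resO X k (f.app U a) = g.app U a) : f = g := by
  refine Scheme.Hom.ext hb fun U ↦ ?_
  have hk : g ⁻¹ᵁ U ≤ f ⁻¹ᵁ U := le_of_eq (by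
    change (Opens.map g.base).obj U = (Opens.map f.base).obj U
    rw [hb])
  ext a
  exact h U hk a

theorem preimage_le {X Y : Scheme.{u}} (f : X ⟶ Y) {U V : Y.Opens} (k : V ≤ U) :
    f ⁻¹ᵁ V ≤ f ⁻¹ᵁ U :=
  fun _ hx ↦ k hx

section Deform

variable {T X S : Scheme.{u}} (h : T ⟶ X)

/-- The conditions for `a ↦ h^# a + e a` to be a morphism of sheaves of rings. -/
structure IsDeformation (e : ∀ U : X.Opens, Γ(X, U) →+ Γ(T, h ⁻¹ᵁ U)) : Prop where
  leibniz (U : X.Opens) (a b : Γ(X, U)) : e U (a * b) = h.app U a * e U b + h.app U b * e U a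
  sq (U : X.Opens) (a b : Γ(X, U)) : e U a * e U b = 0
  nat {U V : X.Opens} (k : V ≤ U) (a : Γ(X, U)) :
    e V (resO X k a) = resO T (preimage_le h k) (e U a)

variable {h} {e : ∀ U : X.Opens, Γ(X, U) →+ Γ(T, h ⁻¹ᵁ U)} (he : IsDeformation h e)

/-- The action on functions of a deformation of a morphism. -/
def IsDeformation.ringHom (U : X.Opens) : Γ(X, U) →+* Γ(T, h ⁻¹ᵁ U) where
  toFun a := h.app U a + e U a
  map_one' := by
    have h₁ := he.leibniz U 1 1
    rw [mul_one, map_one (h.app U).hom, one_mul] at h₁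
    rw [left_eq_add.mp h₁, map_one (h.app U).hom, add_zero]
  map_mul' a b := by
    rw [he.leibniz, map_mul (h.app U).hom, mul_add, add_mul, add_mul, he.sq]
    ring
  map_zero' := by rw [map_zero (h.app U).hom, map_zero, add_zero]
  map_add' a b := by
    rw [map_add (h.app U).hom, map_add]
    abel

/-- The morphism of presheafed spaces underlying a deformation. -/
def IsDeformation.presheafedHom : T.toPresheafedSpace.Hom X.toPresheafedSpace where
  base := h.base
  c :=
    { app U := CommRingCat.ofHom (he.ringHom U.unop)
      naturality U V k := by
        ext a
        have h₁ := ConcreteCategory.congr_hom (h.c.naturality k) a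
        have h₂ := he.nat (leOfHom k.unop) a
        exact (congrArg₂ (fun (x y : Γ(T, h ⁻¹ᵁ V.unop)) ↦ x + y) h₁ h₂).trans
          (map_add (resO T (preimage_le h (leOfHom k.unop))) _ _).symm }

/-- On stalks the new map differs from that of `h` by an element of square zero. Subtracting a
nilpotent from a unit leaves a unit, so locality is inherited from `h`. -/
theorem IsDeformation.isLocalHom (x : T) : IsLocalHom (he.presheafedHom.stalkMap x).hom := by
  refine ⟨fun s hs ↦ ?_⟩
  obtain ⟨U, hx, a, rfl⟩ := X.presheaf.exists_germ_eq s
  have hx' : x ∈ h ⁻¹ᵁ U := hx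
  let ψ : Γ(T, h ⁻¹ᵁ U) →+* T.presheaf.stalk x := (T.presheaf.germ (h ⁻¹ᵁ U) x hx').hom
  have h₁ : (he.presheafedHom.stalkMap x).hom (X.presheaf.germ U (h x) hx a) =
      ψ (h.app U a + e U a) :=
    PresheafedSpace.stalkMap_germ_apply (he.presheafedHom :
      T.toPresheafedSpace ⟶ X.toPresheafedSpace) U x hx a
  have h₂ : (h.stalkMap x).hom (X.presheaf.germ U (h x) hx a) =
      ψ (h.app U a) := h.germ_stalkMap_apply U x hx a
  have hs' : IsUnit (ψ (h.app U a + e U a)) := h₁ ▸ hs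
  refine isUnit_of_map_unit (h.stalkMap x).hom _ ((congrArg IsUnit h₂).mpr ?_)
  have hn : IsNilpotent (-ψ (e U a)) :=
    ⟨2, by rw [neg_sq, pow_two, ← map_mul, he.sq, map_zero]⟩
  have := hn.isUnit_add_left_of_commute hs' (Commute.all _ _)
  rwa [map_add, add_neg_cancel_right] at this

/-- The deformation of a morphism of schemes. -/
def IsDeformation.hom : T ⟶ X := ⟨⟨he.presheafedHom, he.isLocalHom⟩⟩

theorem IsDeformation.hom_comp {f : X ⟶ S} (hf : ∀ V (a : Γ(S, V)), e (f ⁻¹ᵁ V) (f.app V a) = 0) :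
    he.hom ≫ f = h ≫ f := by
  refine schemeHom_ext_of_app rfl fun V k a ↦ (resO_self k _).trans ?_
  exact (congrArg (h.app _ _ + ·) (hf V a)).trans (add_zero _)

theorem IsDeformation.comp_hom {Z : Scheme.{u}} {i : Z ⟶ T}
    (hi : ∀ U (a : Γ(X, U)), i.app _ (e U a) = 0) : i ≫ he.hom = i ≫ h := by
  refine schemeHom_ext_of_app rfl fun V k a ↦ (resO_self k _).trans ?_
  refine (map_add (i.app (h ⁻¹ᵁ V)).hom _ _).trans ?_
  exact (congrArg (i.app _ (h.app _ _) + ·) (hi V a)).trans (add_zero _)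

end Deform

/-! ### Split square-zero extensions of affine schemes -/

/-- The structure sheaf as a sheaf of modules. -/
def structureModule (X : Scheme.{u}) : X.Modules := SheafOfModules.unit X.ringCatSheaf

theorem tilde_section_local {D : CommRingCat.{u}} (Q : ModuleCat.{u} D) (e : D)
    (x : Γ(tilde Q, specOpen e)) : ∃ (n : ℕ) (q : Q),
      e ^ n • x = res (tilde Q) le_top (tildeTop Q q) := by
  obtain ⟨⟨q, ⟨_, n, rfl⟩⟩, h⟩ := IsLocalizedModule.surj (Submonoid.powers e)
    (tilde.toOpen Q (PrimeSpectrum.basicOpen e)).hom x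
  exact ⟨n, q, h⟩

theorem algebraMap_top_bijective (D : CommRingCat.{u}) :
    Function.Bijective (algebraMap D Γ(Spec D, ⊤)) :=
  ConcreteCategory.bijective_of_isIso (Scheme.ΓSpecIso D).inv

/-- The maps `β` form a morphism of sheaves of modules out of `tilde Q`, hence are determined by
`Q`. Identities about ideals of functions on all opens are thereby reduced to global sections. -/
theorem tilde_pushforward_eq_zero {D : CommRingCat.{u}} {Q : ModuleCat.{u} D} {Z : Scheme.{u}}
    (t : Z ⟶ Spec D) (β : ∀ U : (Spec D).Opens, Γ(tilde Q, U) →+ Γ(Z, t ⁻¹ᵁ U))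
    (smul : ∀ U a x, β U (a • x) = t.app U a * β U x)
    (nat : ∀ {U V : (Spec D).Opens} (k : V ≤ U) (x : Γ(tilde Q, U)),
      β V (res _ k x) = resO Z (preimage_le t k) (β U x))
    (top : ∀ q : Q, β ⊤ (tildeTop Q q) = 0) (U : (Spec D).Opens) (x : Γ(tilde Q, U)) :
    β U x = 0 := by
  let φ : tilde Q ⟶ (Scheme.Modules.pushforward t).obj (structureModule Z) :=
    homOfSections β nat smul
  have : φ = 0 := tilde_hom_ext fun q ↦ top q
  exact congrArg (fun φ : tilde Q ⟶ (Scheme.Modules.pushforward t).obj (structureModule Z) ↦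
    φ.app U x) this

section Split

variable {D E : CommRingCat.{u}} [Algebra D E] (p : E →ₐ[D] D)

/-- The kernel of a retraction of an algebra, as a module. -/
abbrev kerModule : ModuleCat.{u} D := ModuleCat.of D (RingHom.ker p)

/-- The structure sheaf of the spectrum of an algebra, as a sheaf of modules. -/
def algSheaf (D E : CommRingCat.{u}) [Algebra D E] : (Spec D).Modules :=
  (Scheme.Modules.pushforward (specAlg D E)).obj (structureModule (Spec E))

theorem isQuasicoherent_algSheaf : (algSheaf D E).IsQuasicoherent := by
  rw [isQuasicoherent_iff_isIso_fromTildeΓ]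
  have : IsIso (Scheme.Modules.fromTildeΓ (structureModule (Spec E))) :=
    isIso_fromTildeΓ_iff.mpr ⟨_, ⟨tildeSelf⟩⟩
  exact isIso_fromTildeΓ_pushforward _ _

variable (D E) in
/-- The global sections of the structure sheaf of the spectrum of an algebra. -/
def algSheafTop : E →ₗ[D] Γ(algSheaf D E, (⊤ : (Spec D).Opens)) where
  toFun x := algebraMap E Γ(Spec E, ⊤) x
  map_add' := map_add _
  map_smul' d x := by
    refine Eq.trans ?_ (algebraMap_smul_section
      (M := algSheaf D E) (U := ⊤) d (algebraMap E Γ(Spec E, ⊤) x))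
    refine (congrArg (algebraMap E Γ(Spec E, ⊤)) (Algebra.smul_def d x)).trans ?_
    refine (map_mul (algebraMap E Γ(Spec E, ⊤)) _ _).trans ?_
    exact congrArg (· * algebraMap E Γ(Spec E, ⊤) x) (specAlg_app_algebraMap ⊤ d).symm

/-- The inclusion of the kernel into the structure sheaf. -/
def kerHom : tilde (kerModule p) ⟶ algSheaf D E :=
  tildeDesc ((algSheafTop D E).comp ((RingHom.ker p).subtype.restrictScalars D))

theorem kerHom_top (q : RingHom.ker p) :
    (kerHom p).app ⊤ (tildeTop (kerModule p) q) = algebraMap E Γ(Spec E, ⊤) (q : E) :=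
  tildeDesc_top _ _

/-- The projection of an algebra to the kernel of a retraction. -/
def toKer : E →ₗ[D] RingHom.ker p where
  toFun x := ⟨x - algebraMap D E (p x), by
    rw [RingHom.mem_ker, map_sub, AlgHom.commutes, Algebra.algebraMap_self_apply, sub_self]⟩
  map_add' x y := Subtype.ext <| by
    simp only [map_add, Submodule.coe_add]
    ring
  map_smul' d x := Subtype.ext <| by
    simp [Algebra.smul_def, mul_sub]

/-- As a `D`-module, `E` is the direct sum of `D` and the kernel, with projection `x ↦ x - p x`. A
retraction of sheaves makes the inclusion of the kernel injective on every open, affine or not. -/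
theorem exists_kerHom_retraction : ∃ σ : algSheaf D E ⟶ tilde (kerModule p),
    kerHom p ≫ σ = 𝟙 _ := by
  have hb : Function.Bijective (algSheafTop D E) := algebraMap_top_bijective E
  obtain ⟨σ, hσ, -⟩ := existsUnique_hom_of_isQuasicoherent (algSheaf D E)
    isQuasicoherent_algSheaf ((tildeTop (kerModule p)).comp ((toKer p).comp
      (LinearEquiv.ofBijective _ hb).symm.toLinearMap))
  refine ⟨σ, tilde_hom_ext fun q ↦ ?_⟩
  refine ((congrArg (σ.app ⊤) (kerHom_top p q)).trans (hσ _)).trans ?_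
  refine congrArg (tildeTop (kerModule p)) ?_
  have h₁ : (LinearEquiv.ofBijective _ hb).symm (algebraMap E Γ(Spec E, ⊤) (q : E)) = (q : E) :=
    (LinearEquiv.ofBijective _ hb).symm_apply_apply (q : E)
  refine (congrArg (toKer p) h₁).trans (Subtype.ext ?_)
  have h₂ : p (q : E) = 0 := q.2
  change (q : E) - algebraMap D E (p (q : E)) = (q : E)
  rw [h₂, map_zero, sub_zero]

/-- The action on sections of the inclusion of the kernel. -/
def kerSection (U : (Spec D).Opens) : Γ(tilde (kerModule p), U) →+ Γ(Spec E, specAlg D E ⁻¹ᵁ U) :=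
  ((kerHom p).app U).hom

theorem kerSection_injective (U : (Spec D).Opens) : Function.Injective (kerSection p U) := by
  obtain ⟨σ, hσ⟩ := exists_kerHom_retraction p
  refine Function.LeftInverse.injective (g := σ.app U) fun x ↦ ?_
  exact congrArg (fun φ : tilde (kerModule p) ⟶ _ ↦ φ.app U x) hσ

theorem kerSection_smul (U : (Spec D).Opens) (a : Γ(Spec D, U)) (x : Γ(tilde (kerModule p), U)) :
    kerSection p U (a • x) = (specAlg D E).app U a * kerSection p U x :=
  (kerHom p).app_smul a x

theorem kerSection_res {U V : (Spec D).Opens} (k : V ≤ U) (x : Γ(tilde (kerModule p), U)) :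
    kerSection p V (res _ k x) =
      resO (Spec E) (preimage_le (specAlg D E) k) (kerSection p U x) :=
  app_res (kerHom p) k x

theorem app_kerSection {i : Spec D ⟶ Spec E} (hi : i = Spec.map (CommRingCat.ofHom p.toRingHom))
    (U : (Spec D).Opens) (x : Γ(tilde (kerModule p), U)) :
    i.app _ (kerSection p U x) = 0 := by
  refine tilde_pushforward_eq_zero (i ≫ specAlg D E)
    (fun U ↦ (i.app _).hom.toAddMonoidHom.comp (kerSection p U)) (fun U a x ↦ ?_)
    (fun {U V} k x ↦ ?_) (fun q ↦ ?_) U x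
  · refine (congrArg (i.app _) (kerSection_smul p U a x)).trans ?_
    exact map_mul (i.app _).hom _ _
  · refine (congrArg (i.app _) (kerSection_res p k x)).trans ?_
    exact ConcreteCategory.congr_hom (i.c.naturality
      ((Opens.map (specAlg D E).base).map (homOfLE k)).op) _
  · refine (congrArg (i.app _) (kerHom_top p q)).trans ?_
    subst hi
    algebraize [p.toRingHom]
    refine (specAlg_app_algebraMap (A := E) (C := D) ⊤ (q : E)).trans ?_
    have h₂ : algebraMap E D (q : E) = 0 := q.2
    exact (congrArg _ h₂).trans (map_zero _)

/-- Linearity in one factor at a time: for a fixed global second factor the product is linear in the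
first, so `tilde_pushforward_eq_zero` applies. In general, on `D(e)` a power of `e` turns the second
factor into a global one, and `e` is invertible there. -/
theorem kerSection_mul (hp : ∀ x y : E, p x = 0 → p y = 0 → x * y = 0) (U : (Spec D).Opens)
    (x y : Γ(tilde (kerModule p), U)) : kerSection p U x * kerSection p U y = 0 := by
  have h₁ : ∀ (q : RingHom.ker p) (U : (Spec D).Opens) (x : Γ(tilde (kerModule p), U)),
      kerSection p U x * algebraMap E Γ(Spec E, specAlg D E ⁻¹ᵁ U) (q : E) = 0 := fun q ↦ by
    refine tilde_pushforward_eq_zero (specAlg D E)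
      (fun U ↦ (AddMonoidHom.mulRight (algebraMap E Γ(Spec E, specAlg D E ⁻¹ᵁ U) (q : E))).comp
        (kerSection p U))
      (fun U a x ↦ ?_) (fun {U V} k x ↦ ?_) (fun q' ↦ ?_)
    · exact (congrArg (· * algebraMap E Γ(Spec E, specAlg D E ⁻¹ᵁ U) (q : E))
        (kerSection_smul p U a x)).trans (mul_assoc _ _ _)
    · exact (congrArg (· * algebraMap E Γ(Spec E, specAlg D E ⁻¹ᵁ V) (q : E))
        (kerSection_res p k x)).trans
        (map_mul (resO (Spec E) (preimage_le (specAlg D E) k)) (kerSection p U x)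
          (algebraMap E Γ(Spec E, specAlg D E ⁻¹ᵁ U) (q : E))).symm
    · refine (congrArg (· * algebraMap E Γ(Spec E, ⊤) (q : E)) (kerHom_top p q')).trans ?_
      exact (map_mul (algebraMap E Γ(Spec E, ⊤)) _ _).symm.trans
        ((congrArg _ (hp _ _ q'.2 q.2)).trans (map_zero _))
  refine resO_ext fun z hz ↦ ?_
  obtain ⟨e, he, hze⟩ := exists_basicOpen_le (C := D) (x := specAlg D E z) (U := U) hz
  refine ⟨specAlg D E ⁻¹ᵁ specOpen e, (preimage_le (specAlg D E) he), hze, ?_⟩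
  rw [map_zero, map_mul]
  refine (congrArg₂ (· * ·) (kerSection_res p he x) (kerSection_res p he y)).symm.trans ?_
  generalize res (tilde (kerModule p)) he x = x'
  generalize res (tilde (kerModule p)) he y = y'
  obtain ⟨n, q, hq⟩ := tilde_section_local (kerModule p) e y'
  have hu : IsUnit ((specAlg D E).app (specOpen e) (algebraMap D _ (e ^ n))) := by
    rw [map_pow, map_pow]
    exact ((isUnit_algebraMap_basicOpen e).map ((specAlg D E).app (specOpen e)).hom).pow n
  refine hu.mul_right_eq_zero.mp ?_
  refine (mul_left_comm _ _ _).trans ?_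
  refine (congrArg (_ * ·) (kerSection_smul p _ (algebraMap D _ (e ^ n)) y').symm).trans ?_
  have hq' : algebraMap D Γ(Spec D, specOpen e) (e ^ n) • y' = res (tilde (kerModule p)) le_top
    (tildeTop (kerModule p) q) := (algebraMap_smul_section _ _).trans hq
  refine (congrArg (fun z ↦ _ * kerSection p _ z) hq').trans ?_
  refine (congrArg (_ * ·) ((kerSection_res p le_top _).trans
    (congrArg _ (kerHom_top p q)))).trans ?_
  exact h₁ q _ x'

end Split

/-! ### Part: algebra of Frobenius forms, traces of differentials and base change of square-zero
extensions. -/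

/-! ### Frobenius systems -/

section Frobenius

/-- A linear form `tr` on an algebra together with dual families for the pairing
`(x, y) ↦ tr (x y)`. -/
structure IsFrobeniusSystem {C D : Type*} [CommRing C] [CommRing D] [Algebra C D] {n : ℕ}
    (tr : D →ₗ[C] C) (b c : Fin n → D) : Prop where
  eq_sum (x : D) : x = ∑ i, tr (x * b i) • c i

variable {C D : Type*} [CommRing C] [CommRing D] [Algebra C D] {n : ℕ}
  {tr : D →ₗ[C] C} {b c : Fin n → D}

theorem IsFrobeniusSystem.eq_of_trace (h : IsFrobeniusSystem tr b c) {x y : D}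
    (hxy : ∀ z, tr (x * z) = tr (y * z)) : x = y := by
  rw [h.eq_sum x, h.eq_sum y]
  exact Finset.sum_congr rfl fun i _ ↦ by rw [hxy]

/-- The definition expands in one of the two families only. The pairing is nondegenerate, so it
suffices to pair both sides with `z`; expanding `z` by the definition gives the same sum. -/
theorem IsFrobeniusSystem.eq_sum' (h : IsFrobeniusSystem tr b c) (x : D) :
    x = ∑ i, tr (x * c i) • b i := by
  refine h.eq_of_trace fun z ↦ ?_
  conv_lhs => rw [h.eq_sum z]
  rw [Finset.mul_sum, map_sum, Finset.sum_mul, map_sum]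
  refine Finset.sum_congr rfl fun i _ ↦ ?_
  rw [mul_smul_comm, map_smul, smul_mul_assoc, map_smul, smul_eq_mul, smul_eq_mul, mul_comm,
    mul_comm z]

/-- The properties of the module `D ⊗ M`, for `M` a module over `C` and `D` a `C`-algebra with
a linear form. -/
structure IsTracePairing {M Q : Type*} [AddCommGroup M] [Module C M] [AddCommGroup Q] [Module D Q]
    (tr : D →ₗ[C] C) {n : ℕ} (b c : Fin n → D) (inr : M →+ Q) (τ : Q →+ M) : Prop where
  inr_smul (a : C) (m : M) : inr (a • m) = algebraMap C D a • inr m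
  trace_smul_inr (x : D) (m : M) : τ (x • inr m) = tr x • m
  eq_sum (q : Q) : q = ∑ i, c i • inr (τ (b i • q))

/-- Surjectivity in Frobenius duality `Hom_D(N, D ⊗ M) = Hom_C(N, M)`, with `Q` in the role of `D ⊗
M`. The lift is forced by `IsTracePairing.eq_sum`: it must be `x ↦ ∑ c_i ⊗ f (b_i x)`. Injectivity
is `IsTracePairing.linearMap_ext`. -/
theorem exists_linearMap_trace_eq {M Q N : Type*} [AddCommGroup M] [Module C M] [AddCommGroup Q]
    [Module D Q] [AddCommGroup N] [Module D N] (h : IsFrobeniusSystem tr b c)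
    {inr : M →+ Q} {τ : Q →+ M} (hQ : IsTracePairing tr b c inr τ) (f : N →+ M)
    (hf : ∀ (a : C) x, f (algebraMap C D a • x) = a • f x) :
    ∃ ψ : N →ₗ[D] Q, ∀ x, τ (ψ x) = f x := by
  refine ⟨{ toFun := fun x ↦ ∑ i, c i • inr (f (b i • x))
            map_add' := fun x y ↦ by
              simp only [smul_add, map_add, Finset.sum_add_distrib]
            map_smul' := fun d x ↦ ?_ }, fun x ↦ ?_⟩
  -- `D`-linearity holds because multiplication by `d` has transposed matrices in the two families:
  -- the coefficients `tr (d c_i b_j)` expand both `b_j d` in the `b_i` and `d c_i` in the `c_j`.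
  · have hL : ∀ j, c j • inr (f (b j • d • x)) =
        ∑ i, (algebraMap C D (tr (d * c i * b j)) * c j) • inr (f (b i • x)) := fun j ↦ by
      have : b j * d = ∑ i, algebraMap C D (tr (d * c i * b j)) * b i := by
        conv_lhs => rw [h.eq_sum' (b j * d)]
        refine Finset.sum_congr rfl fun i _ ↦ ?_
        rw [Algebra.smul_def]
        congr 3
        ring
      rw [smul_smul, this, Finset.sum_smul, map_sum, map_sum, Finset.smul_sum]
      refine Finset.sum_congr rfl fun i _ ↦ ?_
      rw [← smul_smul, hf, hQ.inr_smul, smul_smul, mul_comm]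
    have hR : ∀ i, d • c i • inr (f (b i • x)) =
        ∑ j, (algebraMap C D (tr (d * c i * b j)) * c j) • inr (f (b i • x)) := fun i ↦ by
      rw [smul_smul, ← Finset.sum_smul]
      congr 1
      conv_lhs => rw [h.eq_sum (d * c i)]
      exact Finset.sum_congr rfl fun j _ ↦ Algebra.smul_def _ _
    simp only [RingHom.id_apply, Finset.smul_sum]
    rw [Finset.sum_congr rfl fun j _ ↦ hL j, Finset.sum_congr rfl fun i _ ↦ hR i, Finset.sum_comm]
  · change τ (∑ i, c i • inr (f (b i • x))) = f x
    have h₁ : ∀ i, τ (c i • inr (f (b i • x))) = f ((algebraMap C D (tr (c i)) * b i) • x) :=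
      fun i ↦ by rw [hQ.trace_smul_inr, ← smul_smul, hf]
    have h₂ : (1 : D) = ∑ i, algebraMap C D (tr (c i)) * b i := by
      conv_lhs => rw [h.eq_sum' 1]
      simp only [one_mul, Algebra.smul_def]
    rw [map_sum, Finset.sum_congr rfl fun i _ ↦ h₁ i, ← map_sum, ← Finset.sum_smul, ← h₂, one_smul]

theorem IsTracePairing.linearMap_ext {M Q N : Type*} [AddCommGroup M] [Module C M] [AddCommGroup Q]
    [Module D Q] [AddCommGroup N] [Module D N]
    {inr : M →+ Q} {τ : Q →+ M} (hQ : IsTracePairing tr b c inr τ) {ψ ψ' : N →ₗ[D] Q}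
    (hψ : ∀ x, τ (ψ x) = τ (ψ' x)) : ψ = ψ' := by
  ext x
  rw [hQ.eq_sum (ψ x), hQ.eq_sum (ψ' x)]
  exact Finset.sum_congr rfl fun i _ ↦ by rw [← ψ.map_smul, ← ψ'.map_smul, hψ]

variable {A B : Type*} [CommRing A] [CommRing B] [Algebra A C] [Algebra B D]

/-- The compatibility of a linear map on `Ω[C⁄A]` with one on `Ω[D⁄B]`. -/
def IsLift {M Q : Type*} [AddCommGroup M] [Module C M] [AddCommGroup Q] [Module D Q]
    (inr : M →+ Q) (a : Ω[C⁄A] →ₗ[C] M) (l : Ω[D⁄B] →ₗ[D] Q) : Prop :=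
  ∀ x : C, l (KaehlerDifferential.D B D (algebraMap C D x)) =
    inr (a (KaehlerDifferential.D A C x))

/-- On a generator `y • d x`, with `x` in `C`, both sides are `tr y • a (d x)`. The lemma turns a
statement about `D`-linear lifts into one about the `C`-linear map `a` itself. -/
theorem trace_lift {M Q : Type*} [AddCommGroup M] [Module C M] [AddCommGroup Q] [Module D Q]
    {inr : M →+ Q} {τ : Q →+ M} (hQ : IsTracePairing tr b c inr τ)
    (span : Submodule.span D
      (Set.range fun x : C ↦ KaehlerDifferential.D B D (algebraMap C D x)) = ⊤)
    {t : Ω[D⁄B] →+ Ω[C⁄A]}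
    (ht : ∀ (y : D) (x : C), t (y • KaehlerDifferential.D B D (algebraMap C D x)) =
      tr y • KaehlerDifferential.D A C x)
    {a : Ω[C⁄A] →ₗ[C] M} {l : Ω[D⁄B] →ₗ[D] Q} (h : IsLift inr a l) (z : Ω[D⁄B]) :
    τ (l z) = a (t z) := by
  have hz : z ∈ Submodule.span D
      (Set.range fun x : C ↦ KaehlerDifferential.D B D (algebraMap C D x)) := span ▸ trivial
  induction hz using Submodule.closure_induction with
  | smul_mem y z hz =>
    obtain ⟨x, rfl⟩ := hz
    rw [l.map_smul, ht, a.map_smul, h, hQ.trace_smul_inr]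
  | zero => simp only [map_zero]
  | add x y _ _ hx hy => simp only [map_add, hx, hy]

/-- If the derivations of `C` with values in a module `M` correspond to the linear maps from `N` to
`D ⊗ M`, then `N` is identified with `Ω[C⁄A]` by the trace. -/
theorem bijective_trace_comp (h : IsFrobeniusSystem tr b c)
    (span : Submodule.span D
      (Set.range fun x : C ↦ KaehlerDifferential.D B D (algebraMap C D x)) = ⊤)
    {t : Ω[D⁄B] →+ Ω[C⁄A]}
    (ht : ∀ (y : D) (x : C), t (y • KaehlerDifferential.D B D (algebraMap C D x)) =
      tr y • KaehlerDifferential.D A C x)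
    (ht' : ∀ (a : C) (z : Ω[D⁄B]), t (algebraMap C D a • z) = a • t z)
    {N : Type*} [AddCommGroup N] [Module D N] [Module C N] [IsScalarTower C D N]
    (θ : N →ₗ[D] Ω[D⁄B])
    {Q₁ : Type*} [AddCommGroup Q₁] [Module D Q₁] {inr₁ : N →+ Q₁} {τ₁ : Q₁ →+ N}
    (h₁ : IsTracePairing tr b c inr₁ τ₁)
    (exists_lift : ∀ ψ : N →ₗ[D] Q₁, ∃ (a : Ω[C⁄A] →ₗ[C] N) (l : Ω[D⁄B] →ₗ[D] Q₁),
      IsLift inr₁ a l ∧ ψ = l ∘ₗ θ)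
    {Q₂ : Type*} [AddCommGroup Q₂] [Module D Q₂] {inr₂ : Ω[C⁄A] →+ Q₂} {τ₂ : Q₂ →+ Ω[C⁄A]}
    (h₂ : IsTracePairing tr b c inr₂ τ₂)
    (lift : ∀ a : Ω[C⁄A] →ₗ[C] Ω[C⁄A], ∃ l : Ω[D⁄B] →ₗ[D] Q₂, IsLift inr₂ a l)
    (lift_unique : ∀ (a a' : Ω[C⁄A] →ₗ[C] Ω[C⁄A]) (l l' : Ω[D⁄B] →ₗ[D] Q₂),
      IsLift inr₂ a l → IsLift inr₂ a' l' → l ∘ₗ θ = l' ∘ₗ θ → a = a') :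
    Function.Bijective fun x ↦ t (θ x) := by
  -- Yoneda with values in `N`: the map `ψ` dual to the identity comes from some `a : Ω[C⁄A] → N`,
  -- and taking traces in `ψ = l ∘ θ` shows that `a` is a left inverse of `t ∘ θ`.
  obtain ⟨ψ, hψ⟩ := exists_linearMap_trace_eq h h₁ (AddMonoidHom.id N)
    (fun a x ↦ algebraMap_smul D a x)
  obtain ⟨a, l, hl, rfl⟩ := exists_lift ψ
  have ha : ∀ x, a (t (θ x)) = x := fun x ↦ (trace_lift h₁ span ht hl (θ x)).symm.trans (hψ x)
  refine ⟨Function.LeftInverse.injective ha, fun y ↦ ⟨a y, ?_⟩⟩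
  -- Yoneda with values in `Ω[C⁄A]`: the composite `s = t ∘ θ ∘ a` and the identity agree after
  -- precomposition with `t ∘ θ`. Their lifts then agree after `θ`, and uniqueness forces `s` to be
  -- the identity.
  let s : Ω[C⁄A] →ₗ[C] Ω[C⁄A] :=
    { toFun := fun y ↦ t (θ (a y))
      map_add' := fun x y ↦ by simp only [map_add]
      map_smul' := fun r x ↦ by
        rw [map_smul, ← algebraMap_smul D r (a x), map_smul, ht']
        rfl }
  obtain ⟨l₁, hl₁⟩ := lift s
  obtain ⟨l₂, hl₂⟩ := lift LinearMap.id
  have : s = LinearMap.id := by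
    refine lift_unique _ _ _ _ hl₁ hl₂ (h₂.linearMap_ext fun x ↦ ?_)
    refine (trace_lift h₂ span ht hl₁ (θ x)).trans (Eq.trans ?_
      (trace_lift h₂ span ht hl₂ (θ x)).symm)
    exact congrArg (fun x ↦ t (θ x)) (ha x)
  exact LinearMap.congr_fun this y

end Frobenius

open TensorProduct

attribute [local instance] Algebra.TensorProduct.rightAlgebra

/-! ### Base change of linear forms -/

section BaseTrace

variable {A B : Type*} [CommRing A] [CommRing B] [Algebra A B] (l : B →ₗ[A] A)

/-- The base change of a linear form. -/
def baseTrace (C : Type*) [CommRing C] [Algebra A C] : C ⊗[A] B →ₗ[C] C :=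
  (AlgebraTensorModule.rid A C C).toLinearMap ∘ₗ l.baseChange C

variable {C C' : Type*} [CommRing C] [CommRing C'] [Algebra A C] [Algebra A C']

@[simp]
theorem baseTrace_tmul (x : C) (y : B) : baseTrace l C (x ⊗ₜ y) = l y • x := by
  simp [baseTrace]

theorem baseTrace_map (φ : C →ₐ[A] C') (z : C ⊗[A] B) :
    baseTrace l C' (Algebra.TensorProduct.map φ (AlgHom.id A B) z) = φ (baseTrace l C z) := by
  induction z with
  | zero => simp only [map_zero]
  | tmul x y => simp
  | add x y hx hy => simp only [map_add, hx, hy]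

variable {l}

theorem IsFrobeniusSystem.baseChange {n : ℕ} {b c : Fin n → B} (h : IsFrobeniusSystem l b c)
    (C : Type*) [CommRing C] [Algebra A C] :
    IsFrobeniusSystem (baseTrace l C) (fun i ↦ (1 : C) ⊗ₜ[A] b i) (fun i ↦ (1 : C) ⊗ₜ[A] c i) where
  eq_sum z := by
    induction z with
    | zero => simp
    | tmul x y =>
      conv_lhs => rw [h.eq_sum y, tmul_sum]
      refine Finset.sum_congr rfl fun i _ ↦ ?_
      rw [Algebra.TensorProduct.tmul_mul_tmul, baseTrace_tmul, mul_one, smul_tmul', smul_eq_mul,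
        mul_one, tmul_smul, smul_tmul']
    | add x y hx hy =>
      conv_lhs => rw [hx, hy]
      simp only [add_mul, map_add, add_smul, Finset.sum_add_distrib]

end BaseTrace

section Differentials

variable {A B C : Type*} [CommRing A] [CommRing B] [CommRing C] [Algebra A B] [Algebra A C]

theorem span_range_D_tensorProduct : Submodule.span (C ⊗[A] B)
    (Set.range fun x : C ↦ KaehlerDifferential.D B (C ⊗[A] B) (algebraMap C (C ⊗[A] B) x)) = ⊤ := by
  rw [eq_top_iff]
  rintro z -
  obtain ⟨w, rfl⟩ := (KaehlerDifferential.tensorKaehlerEquiv A B C (C ⊗[A] B)).surjective z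
  induction w with
  | zero => simp
  | add x y hx hy => simpa only [map_add] using add_mem hx hy
  | tmul x y =>
    have hy : y ∈ Submodule.span C (Set.range (KaehlerDifferential.D A C)) := by
      rw [KaehlerDifferential.span_range_derivation]
      trivial
    induction hy using Submodule.closure_induction generalizing x with
    | zero => simp
    | add y y' _ _ hy hy' => simpa only [tmul_add, map_add] using add_mem (hy x) (hy' x)
    | smul_mem r y hy =>
      obtain ⟨y, rfl⟩ := hy
      rw [← smul_tmul, KaehlerDifferential.tensorKaehlerEquiv_tmul_D]
      exact Submodule.smul_mem _ _ (Submodule.subset_span ⟨y, rfl⟩)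

/-- Under the base change isomorphism of `Ω[(C ⊗ B)⁄B]` with `(C ⊗ B) ⊗ Ω[C⁄A]`, the map is `tr ⊗
id`. -/
theorem exists_trace_differentials (tr : C ⊗[A] B →ₗ[C] C) :
    ∃ t : Ω[(C ⊗[A] B)⁄B] →+ Ω[C⁄A],
      (∀ y x, t (y • KaehlerDifferential.D B (C ⊗[A] B) (algebraMap C (C ⊗[A] B) x)) =
        tr y • KaehlerDifferential.D A C x) ∧
      ∀ (a : C) (z : Ω[(C ⊗[A] B)⁄B]), t (algebraMap C (C ⊗[A] B) a • z) = a • t z := by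
  let e := KaehlerDifferential.tensorKaehlerEquiv A B C (C ⊗[A] B)
  let t₀ : (C ⊗[A] B) ⊗[C] Ω[C⁄A] →ₗ[C] Ω[C⁄A] := TensorProduct.lift (LinearMap.lsmul C _ ∘ₗ tr)
  refine ⟨t₀.toAddMonoidHom.comp e.symm.toLinearMap.toAddMonoidHom, fun y x ↦ ?_, fun a z ↦ ?_⟩
  · have h : e.symm (y • KaehlerDifferential.D B (C ⊗[A] B) (algebraMap C (C ⊗[A] B) x)) =
        y ⊗ₜ KaehlerDifferential.D A C x := by
      rw [LinearEquiv.symm_apply_eq]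
      exact (KaehlerDifferential.tensorKaehlerEquiv_tmul_D A B C (C ⊗[A] B) y x).symm
    exact congrArg t₀ h
  · have h : e.symm (algebraMap C (C ⊗[A] B) a • z) = a • e.symm z :=
      (map_smul e.symm _ _).trans (algebraMap_smul _ _ _)
    exact (congrArg t₀ h).trans (map_smul t₀ _ _)

theorem exists_kaehler_desc {M : Type*} [AddCommGroup M] [Module C M] (d : C →+ M)
    (leibniz : ∀ a b, d (a * b) = a • d b + b • d a) (hd : ∀ a : A, d (algebraMap A C a) = 0) :
    ∃ a : Ω[C⁄A] →ₗ[C] M, ∀ x, a (KaehlerDifferential.D A C x) = d x := by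
  let _ : Module A M := Module.compHom _ (algebraMap A C)
  have : IsScalarTower A C M := IsScalarTower.of_algebraMap_smul fun _ _ ↦ rfl
  let d : Derivation A C M :=
    { toFun := d
      map_add' := map_add d
      map_smul' := fun a b ↦ by
        rw [Algebra.smul_def, leibniz, hd, smul_zero, add_zero]
        rfl
      map_one_eq_zero' := by
        have := hd 1
        rwa [map_one] at this
      leibniz' := leibniz }
  exact ⟨d.liftKaehlerDifferential, fun c ↦ d.liftKaehlerDifferential_comp_D c⟩

end Differentials

/-! ### Base change of square-zero extensions -/

section BaseSqZero

variable {A B C : Type*} [CommRing A] [CommRing B] [CommRing C] [Algebra A B] [Algebra A C]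
  {M : Type*} [AddCommGroup M] [Module C M]

instance SqZero.algebra : Algebra A (SqZero C M) :=
  ((SqZero.inl C M).comp (algebraMap A C)).toAlgebra

variable (A C M) in
/-- The projection of a square-zero extension, as a morphism of algebras. -/
def SqZero.fstAlgHom : SqZero C M →ₐ[A] C := ⟨SqZero.fstHom C M, fun _ ↦ rfl⟩

variable (A C M) in
/-- The inclusion into a square-zero extension, as a morphism of algebras. -/
def SqZero.inlAlgHom : C →ₐ[A] SqZero C M := ⟨SqZero.inl C M, fun _ ↦ rfl⟩

instance SqZero.baseAlgebra : Algebra (C ⊗[A] B) (SqZero C M ⊗[A] B) :=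
  (Algebra.TensorProduct.map (SqZero.inlAlgHom A C M) (AlgHom.id A B)).toRingHom.toAlgebra

variable (A B C M) in
/-- The base change of the projection of a square-zero extension. -/
def SqZero.baseFst : SqZero C M ⊗[A] B →ₐ[C ⊗[A] B] C ⊗[A] B :=
  { (Algebra.TensorProduct.map (SqZero.fstAlgHom A C M) (AlgHom.id A B)) with
    commutes' := fun x ↦ by
      change Algebra.TensorProduct.map (SqZero.fstAlgHom A C M) (AlgHom.id A B)
        (Algebra.TensorProduct.map (SqZero.inlAlgHom A C M) (AlgHom.id A B) x) = x
      induction x with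
      | zero => simp only [map_zero]
      | tmul x y => rfl
      | add x y hx hy => simp only [map_add, hx, hy] }

theorem SqZero.baseFst_apply (x : SqZero C M ⊗[A] B) : SqZero.baseFst A B C M x =
    Algebra.TensorProduct.map (SqZero.fstAlgHom A C M) (AlgHom.id A B) x := rfl

variable {l : B →ₗ[A] A} {n : ℕ} {b c : Fin n → B}

/-- The coefficients of `q` in the base-changed Frobenius system are traces. Their ring components
are traces of multiples of the image of `q` in `C ⊗ B`, which is zero, so only module components
remain. -/
theorem SqZero.eq_sum_of_baseFst_eq_zero (h : IsFrobeniusSystem l b c) {q : SqZero C M ⊗[A] B}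
    (hq : SqZero.baseFst A B C M q = 0) :
    q = ∑ i, SqZero.inr C M (baseTrace l (SqZero C M) (q * 1 ⊗ₜ b i)).snd ⊗ₜ c i := by
  conv_lhs => rw [(h.baseChange (SqZero C M)).eq_sum q]
  refine Finset.sum_congr rfl fun i _ ↦ ?_
  rw [smul_tmul', smul_eq_mul, mul_one]
  congr 1
  refine SqZero.ext ?_ rfl
  have h₁ := baseTrace_map l (SqZero.fstAlgHom A C M) (q * 1 ⊗ₜ b i)
  rw [← SqZero.baseFst_apply, map_mul, hq, zero_mul, map_zero] at h₁
  exact h₁.symm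

theorem SqZero.baseFst_mul_eq_zero (h : IsFrobeniusSystem l b c) {x y : SqZero C M ⊗[A] B}
    (hx : SqZero.baseFst A B C M x = 0) (hy : SqZero.baseFst A B C M y = 0) : x * y = 0 := by
  rw [SqZero.eq_sum_of_baseFst_eq_zero h hx, SqZero.eq_sum_of_baseFst_eq_zero h hy,
    Finset.sum_mul_sum]
  refine Finset.sum_eq_zero fun i _ ↦ Finset.sum_eq_zero fun j _ ↦ ?_
  rw [Algebra.TensorProduct.tmul_mul_tmul]
  have : ∀ m m' : M, SqZero.inr C M m * SqZero.inr C M m' = 0 := fun m m' ↦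
    SqZero.ext (mul_zero _) (by simp)
  rw [this, zero_tmul]

variable (A B C M) in
/-- The inclusion of a module into the kernel of the base change of the projection of its
square-zero extension. -/
def SqZero.baseInr : M →+ RingHom.ker (SqZero.baseFst A B C M) :=
  AddMonoidHom.mk' (fun m ↦ ⟨SqZero.inr C M m ⊗ₜ 1, by
    rw [RingHom.mem_ker, SqZero.baseFst_apply, Algebra.TensorProduct.map_tmul]
    exact zero_tmul _ _⟩) fun m m' ↦ Subtype.ext <|
      (congrArg (· ⊗ₜ[A] (1 : B)) (map_add (SqZero.inr C M) m m')).trans (add_tmul _ _ _)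

variable (C M) in
/-- The trace on the kernel of the base change of the projection of a square-zero extension. -/
def SqZero.baseSnd (l : B →ₗ[A] A) : RingHom.ker (SqZero.baseFst A B C M) →+ M :=
  AddMonoidHom.mk' (fun q ↦ (baseTrace l (SqZero C M) (q : SqZero C M ⊗[A] B)).snd) fun q q' ↦ by
    rw [Submodule.coe_add, map_add]
    rfl

/-- The kernel of the base-changed projection is the model of `D ⊗ M` to which Frobenius duality is
applied; it is at the same time the ideal of the infinitesimal extension used as test object. -/
theorem SqZero.isTracePairing (h : IsFrobeniusSystem l b c) :
    IsTracePairing (baseTrace l C) (fun i ↦ (1 : C) ⊗ₜ[A] b i) (fun i ↦ (1 : C) ⊗ₜ[A] c i)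
      (SqZero.baseInr A B C M) (SqZero.baseSnd C M l) where
  inr_smul a m := Subtype.ext <| by
    have : SqZero.inr C M (a • m) = SqZero.inl C M a * SqZero.inr C M m :=
      SqZero.ext (by simp) (by simp)
    change SqZero.inr C M (a • m) ⊗ₜ 1 = (SqZero.inl C M a ⊗ₜ 1) * (SqZero.inr C M m ⊗ₜ 1)
    rw [Algebra.TensorProduct.tmul_mul_tmul, mul_one, this]
  trace_smul_inr x m := by
    change (baseTrace l (SqZero C M) (Algebra.TensorProduct.map (SqZero.inlAlgHom A C M)
      (AlgHom.id A B) x * (SqZero.inr C M m ⊗ₜ 1))).snd = _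
    induction x with
    | zero => simp
    | tmul x y =>
      rw [Algebra.TensorProduct.map_tmul, Algebra.TensorProduct.tmul_mul_tmul, mul_one,
        baseTrace_tmul, baseTrace_tmul, Algebra.smul_def, Algebra.smul_def]
      change (SqZero.inl C M _ * (SqZero.inl C M x * _)).snd = _
      simp [smul_smul]
    | add x y hx hy =>
      rw [map_add, add_mul, map_add, map_add, add_smul, SqZero.snd_add, hx, hy]
  eq_sum q := Subtype.ext <| by
    have hq : SqZero.baseFst A B C M q = 0 := q.2
    conv_lhs => rw [SqZero.eq_sum_of_baseFst_eq_zero h hq]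
    rw [AddSubmonoidClass.coe_finsetSum]
    refine Finset.sum_congr rfl fun i _ ↦ ?_
    change _ = (SqZero.inlAlgHom A C M 1 ⊗ₜ c i) * (SqZero.inr C M
      (baseTrace l (SqZero C M) ((SqZero.inlAlgHom A C M 1 ⊗ₜ b i) * q.1)).snd ⊗ₜ 1)
    rw [map_one, Algebra.TensorProduct.tmul_mul_tmul, one_mul, mul_one, mul_comm q.1]

/-- The morphism to a square-zero extension given by a linear map on
differentials. -/
def SqZero.ofDifferential (a : Ω[C⁄A] →ₗ[C] M) : C →ₐ[A] SqZero C M where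
  __ := SqZero.lift (RingHom.id C) (a.toAddMonoidHom.comp
    (KaehlerDifferential.D A C).toLinearMap.toAddMonoidHom) fun x y ↦ by
      refine (congrArg a ((KaehlerDifferential.D A C).leibniz x y)).trans ?_
      rw [map_add, map_smul, map_smul]
      rfl
  commutes' x := SqZero.ext rfl <| by
    refine (congrArg a ((KaehlerDifferential.D A C).map_algebraMap x)).trans ?_
    rw [map_zero]
    rfl

theorem SqZero.baseFst_map_ofDifferential (a : Ω[C⁄A] →ₗ[C] M) (x : C ⊗[A] B) :
    SqZero.baseFst A B C M
      (Algebra.TensorProduct.map (SqZero.ofDifferential a) (AlgHom.id A B) x) = x := by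
  rw [SqZero.baseFst_apply]
  induction x with
  | zero => simp only [map_zero]
  | tmul x y => rfl
  | add x y hx hy => simp only [map_add, hx, hy]

/-- A derivation is a section of the square-zero extension. After base change to `B`, the difference
of this section and the trivial one is a `B`-derivation into the kernel, because products of two
kernel elements vanish. -/
theorem SqZero.exists_lift (h : IsFrobeniusSystem l b c) (a : Ω[C⁄A] →ₗ[C] M) :
    ∃ L : Ω[(C ⊗[A] B)⁄B] →ₗ[C ⊗[A] B] RingHom.ker (SqZero.baseFst A B C M),
      IsLift (SqZero.baseInr A B C M) a L ∧
      ∀ x, (L (KaehlerDifferential.D B (C ⊗[A] B) x) : SqZero C M ⊗[A] B) =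
        Algebra.TensorProduct.map (SqZero.ofDifferential a) (AlgHom.id A B) x -
          algebraMap (C ⊗[A] B) (SqZero C M ⊗[A] B) x := by
  let Φ := Algebra.TensorProduct.map (SqZero.ofDifferential a) (AlgHom.id A B)
  have hΦ : ∀ x, SqZero.baseFst A B C M (Φ x - algebraMap (C ⊗[A] B) (SqZero C M ⊗[A] B) x) = 0 :=
    fun x ↦ by
      rw [map_sub, SqZero.baseFst_map_ofDifferential, AlgHom.commutes,
        Algebra.algebraMap_self_apply, sub_self]
  obtain ⟨L, hL⟩ := exists_kaehler_desc (A := B) (C := C ⊗[A] B)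
    (M := RingHom.ker (SqZero.baseFst A B C M))
    (AddMonoidHom.mk' (fun x ↦ ⟨_, hΦ x⟩) fun x y ↦ Subtype.ext <| by
      simp only [map_add, Submodule.coe_add]
      ring)
    (fun x y ↦ Subtype.ext <| by
      have h₁ := SqZero.baseFst_mul_eq_zero h (hΦ x) (hΦ y)
      change Φ (x * y) - algebraMap (C ⊗[A] B) (SqZero C M ⊗[A] B) (x * y) =
        algebraMap (C ⊗[A] B) (SqZero C M ⊗[A] B) x *
          (Φ y - algebraMap (C ⊗[A] B) (SqZero C M ⊗[A] B) y) +
        algebraMap (C ⊗[A] B) (SqZero C M ⊗[A] B) y *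
          (Φ x - algebraMap (C ⊗[A] B) (SqZero C M ⊗[A] B) x)
      rw [map_mul, map_mul]
      linear_combination h₁)
    (fun y ↦ Subtype.ext (sub_eq_zero.mpr <| by
      change (SqZero.ofDifferential a) 1 ⊗ₜ[A] y = (SqZero.inlAlgHom A C M) 1 ⊗ₜ[A] y
      rw [map_one, map_one]))
  refine ⟨L, fun x ↦ (hL _).trans (Subtype.ext ?_), fun x ↦ congrArg Subtype.val (hL x)⟩
  change (SqZero.ofDifferential a) x ⊗ₜ[A] (1 : B) - (SqZero.inlAlgHom A C M) x ⊗ₜ[A] (1 : B) =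
    SqZero.inr C M (a (KaehlerDifferential.D A C x)) ⊗ₜ[A] (1 : B)
  rw [← sub_tmul]
  congr 1
  rw [sub_eq_iff_eq_add]
  exact SqZero.ext (zero_add x).symm (add_zero _).symm

theorem SqZero.exists_ofDifferential_eq (φ : C →ₐ[A] SqZero C M) (hφ : ∀ x, (φ x).fst = x) :
    ∃ a : Ω[C⁄A] →ₗ[C] M, φ = SqZero.ofDifferential a := by
  obtain ⟨a, ha⟩ := exists_kaehler_desc (A := A) (C := C) (M := M)
    (AddMonoidHom.mk' (fun x ↦ (φ x).snd) fun x y ↦ by rw [map_add]; rfl)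
    (fun x y ↦ by
      have := congrArg SqZero.snd (map_mul φ x y)
      rwa [SqZero.snd_mul, hφ, hφ] at this)
    (fun x ↦ by
      have := congrArg SqZero.snd (φ.commutes x)
      exact this)
  exact ⟨a, AlgHom.ext fun x ↦ SqZero.ext (hφ x) (ha x).symm⟩

theorem SqZero.ofDifferential_injective {a a' : Ω[C⁄A] →ₗ[C] M}
    (h : SqZero.ofDifferential a = SqZero.ofDifferential a') : a = a' := by
  refine LinearMap.ext_on (KaehlerDifferential.span_range_derivation A C) ?_
  rintro _ ⟨x, rfl⟩
  exact congrArg SqZero.snd (DFunLike.congr_fun h x)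

end BaseSqZero

/-! ### Part: deformations of the universal map and differentials of the Weil restriction on affine
charts. -/

/-! ### The universal property of the Weil restriction -/

/-- The scheme `R` over `S`, with the morphism `f : R ×_S S' ⟶ X` over `S`, represents the Weil
restriction of `X ×_S S'`. -/
structure IsWeilRestriction {S' S X R : Scheme.{u}} (π : S' ⟶ S) (x : X ⟶ S) (r : R ⟶ S)
    (f : pullback r π ⟶ X) : Prop where
  w : f ≫ x = pullback.fst r π ≫ r
  -- The square is any cartesian one rather than the chosen fibre product, so that spectra of tensor
  -- products can serve as test objects.
  existsUnique {T T' : Scheme.{u}} (τ : T ⟶ S) (ρ : T' ⟶ T) (q : T' ⟶ S')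
    (sq : IsPullback ρ q τ π) (y : T' ⟶ X) (hy : y ≫ x = ρ ≫ τ) :
    ∃! t : T ⟶ R, t ≫ r = τ ∧ ∃ u : T' ⟶ pullback r π,
      u ≫ pullback.fst r π = ρ ≫ t ∧ u ≫ pullback.snd r π = q ∧ u ≫ f = y

/-! ### Morphisms from pullbacks of the sheaf of differentials -/

section PullRes

variable {X S Z U : Scheme.{u}} (x : X ⟶ S) (f : U ⟶ X) (g : Z ⟶ U) [IsOpenImmersion g]

/-- The restriction along an open immersion of a pullback of the sheaf of differentials. -/
abbrev pullRes : Z.Modules :=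
  (Scheme.Modules.pullback f ⋙ Scheme.Modules.restrictFunctor g).obj (kaehler x)

theorem isQuasicoherent_pullRes : (pullRes x f g).IsQuasicoherent :=
  have := isQuasicoherent_pullback_kaehler x f
  Scheme.Modules.isQuasicoherent_restrictFunctor g _

variable {x f g} {M N : Z.Modules}

variable (x f g M) in
/-- Morphisms from `pullRes x f g` correspond to morphisms from the sheaf of differentials. -/
def pullResEquiv : (pullRes x f g ⟶ M) ≃
    (kaehler x ⟶ (Scheme.Modules.pushforward g ⋙ Scheme.Modules.pushforward f).obj M) :=
  ((Scheme.Modules.pullbackPushforwardAdjunction f).comp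
    (Scheme.Modules.restrictAdjunction g)).homEquiv (kaehler x) M

/-- Morphisms from `pullRes x f g` correspond to derivations. -/
def pullResDer (φ : pullRes x f g ⟶ M) :
    SheafDerivation x
      ((Scheme.Modules.pushforward g ⋙ Scheme.Modules.pushforward f).obj M) :=
  (kaehlerD x).comp (pullResEquiv x f g M φ)

theorem pullResDer_injective {φ ψ : pullRes x f g ⟶ M} (h : pullResDer φ = pullResDer ψ) :
    φ = ψ :=
  (pullResEquiv x f g M).injective
    (kaehler_hom_ext fun U a ↦ congrArg (fun δ : SheafDerivation x _ ↦ δ.d U a) h)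

theorem pullResDer_comp (φ : pullRes x f g ⟶ M) (l : M ⟶ N) :
    pullResDer (φ ≫ l) = (pullResDer φ).comp
      ((Scheme.Modules.pushforward g ⋙ Scheme.Modules.pushforward f).map l) :=
  congrArg (kaehlerD x).comp (((Scheme.Modules.pullbackPushforwardAdjunction f).comp
    (Scheme.Modules.restrictAdjunction g)).homEquiv_naturality_right φ l)

end PullRes

/-! ### Deformations given by derivations -/

theorem resO_app_congr {Y Z : Scheme.{u}} {f f' : Y ⟶ Z} (e : f = f') {U : Z.Opens} {W : Y.Opens}
    (k : W ≤ f ⁻¹ᵁ U) (k' : W ≤ f' ⁻¹ᵁ U) (a : Γ(Z, U)) :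
    resO Y k (f.app U a) = resO Y k' (f'.app U a) := by
  subst e
  rfl

theorem IsDeformation.eq_of_hom_eq {T X : Scheme.{u}} {h : T ⟶ X}
    {e e' : ∀ U : X.Opens, Γ(X, U) →+ Γ(T, h ⁻¹ᵁ U)} (he : IsDeformation h e)
    (he' : IsDeformation h e') (hh : he.hom = he'.hom) (U : X.Opens) (a : Γ(X, U)) :
    e U a = e' U a := by
  have h₁ : resO T (le_refl (h ⁻¹ᵁ U)) (h.app U a + e U a) = h.app U a + e' U a :=
    (resO_app_congr hh (U := U) le_rfl le_rfl a).trans (resO_self _ _)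
  rw [resO_self] at h₁
  exact add_left_cancel h₁

section DerivationDeformation

variable {X S : Scheme.{u}} {x : X ⟶ S} {D E : CommRingCat.{u}} [Algebra D E] {p : E →ₐ[D] D}
  {g : Spec D ⟶ X}
  (δ : SheafDerivation x ((Scheme.Modules.pushforward g).obj (tilde (kerModule p))))

/-- The action on functions of the deformation given by a derivation. -/
def SheafDerivation.kerSection (U : X.Opens) :
    Γ(X, U) →+ Γ(Spec E, (specAlg D E ≫ g) ⁻¹ᵁ U) :=
  (WeilDiff.kerSection p (g ⁻¹ᵁ U)).comp (δ.d U)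

theorem SheafDerivation.kerSection_mul (U : X.Opens) (a b : Γ(X, U)) : δ.kerSection U (a * b) =
    WeilDiff.kerSection p (g ⁻¹ᵁ U) (a • δ.d U b + b • δ.d U a) :=
  congrArg (WeilDiff.kerSection p (g ⁻¹ᵁ U)) (δ.leibniz U a b)

theorem kerSection_pushforward_smul (U : X.Opens) (a : Γ(X, U))
    (y : Γ((Scheme.Modules.pushforward g).obj (tilde (kerModule p)), U)) :
    kerSection p (g ⁻¹ᵁ U) (a • y) =
      (specAlg D E).app (g ⁻¹ᵁ U) (g.app U a) * kerSection p (g ⁻¹ᵁ U) y :=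
  kerSection_smul p (g ⁻¹ᵁ U) (g.app U a) y

theorem SheafDerivation.kerSection_smul (U : X.Opens) (a b : Γ(X, U)) :
    WeilDiff.kerSection p (g ⁻¹ᵁ U) (a • δ.d U b) =
      (specAlg D E ≫ g).app U a * δ.kerSection U b :=
  kerSection_pushforward_smul U a (δ.d U b)

theorem SheafDerivation.kerSection_leibniz (U : X.Opens) (a b : Γ(X, U)) :
    δ.kerSection U (a * b) = (specAlg D E ≫ g).app U a * δ.kerSection U b +
      (specAlg D E ≫ g).app U b * δ.kerSection U a := by
  rw [← δ.kerSection_smul U a b, ← δ.kerSection_smul U b a]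
  exact (δ.kerSection_mul U a b).trans
    (map_add (WeilDiff.kerSection p (g ⁻¹ᵁ U)) (a • δ.d U b) (b • δ.d U a))

theorem SheafDerivation.isDeformation (hp : ∀ x y : E, p x = 0 → p y = 0 → x * y = 0) :
    IsDeformation (specAlg D E ≫ g) δ.kerSection where
  leibniz := δ.kerSection_leibniz
  sq U a b := WeilDiff.kerSection_mul p hp (g ⁻¹ᵁ U) (δ.d U a) (δ.d U b)
  nat {U V} k a := by
    have h₁ : δ.kerSection V (resO X k a) =
        WeilDiff.kerSection p (g ⁻¹ᵁ V) (res (tilde (kerModule p)) (preimage_le g k) (δ.d U a)) :=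
      congrArg (WeilDiff.kerSection p (g ⁻¹ᵁ V)) (δ.map k a)
    exact h₁.trans (kerSection_res p (preimage_le g k) (δ.d U a))

theorem SheafDerivation.eq_of_hom_eq (hp : ∀ x y : E, p x = 0 → p y = 0 → x * y = 0)
    {δ δ' : SheafDerivation x ((Scheme.Modules.pushforward g).obj (tilde (kerModule p)))}
    (hh : (δ.isDeformation hp).hom = (δ'.isDeformation hp).hom) : δ = δ' :=
  SheafDerivation.ext fun U a ↦ kerSection_injective p (g ⁻¹ᵁ U)
    (IsDeformation.eq_of_hom_eq _ _ hh U a)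

/-- The deformation given by a derivation. -/
def SheafDerivation.deform (hp : ∀ x y : E, p x = 0 → p y = 0 → x * y = 0) : Spec E ⟶ X :=
  (δ.isDeformation hp).hom

theorem SheafDerivation.deform_comp (hp : ∀ x y : E, p x = 0 → p y = 0 → x * y = 0) :
    δ.deform hp ≫ x = specAlg D E ≫ g ≫ x :=
  ((δ.isDeformation hp).hom_comp fun V a ↦
    (congrArg (WeilDiff.kerSection p (g ⁻¹ᵁ x ⁻¹ᵁ V)) (δ.const V a)).trans
      (map_zero (WeilDiff.kerSection p (g ⁻¹ᵁ x ⁻¹ᵁ V)))).trans (Category.assoc _ _ _)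

theorem specMap_comp_specAlg :
    Spec.map (CommRingCat.ofHom p.toRingHom) ≫ specAlg D E = 𝟙 _ := by
  rw [← Spec.map_comp, ← CommRingCat.ofHom_comp, ← Spec.map_id]
  congr 1
  ext d
  exact p.commutes d

theorem SheafDerivation.comp_deform (hp : ∀ x y : E, p x = 0 → p y = 0 → x * y = 0) :
    Spec.map (CommRingCat.ofHom p.toRingHom) ≫ δ.deform hp = g :=
  ((δ.isDeformation hp).comp_hom (i := Spec.map (CommRingCat.ofHom p.toRingHom)) fun U a ↦
    app_kerSection p rfl (g ⁻¹ᵁ U) (δ.d U a)).trans <| by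
      rw [← Category.assoc, specMap_comp_specAlg, Category.id_comp]

end DerivationDeformation

/-! ### Morphisms to the Weil restriction -/

section HomExt

variable {S' S X R : Scheme.{u}} {π : S' ⟶ S} {x : X ⟶ S} {r : R ⟶ S} {f : pullback r π ⟶ X}

theorem IsWeilRestriction.comp_w (h : IsWeilRestriction π x r f) {T T' : Scheme.{u}} {ρ : T' ⟶ T}
    {t : T ⟶ R} {u : T' ⟶ pullback r π} (hu : u ≫ pullback.fst r π = ρ ≫ t) :
    (u ≫ f) ≫ x = ρ ≫ t ≫ r := by
  rw [Category.assoc, h.w, ← Category.assoc, hu, Category.assoc]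

theorem IsWeilRestriction.hom_ext (h : IsWeilRestriction π x r f) {T T' : Scheme.{u}} {τ : T ⟶ S}
    {ρ : T' ⟶ T} {q : T' ⟶ S'} (sq : IsPullback ρ q τ π) {t t' : T ⟶ R} (ht : t ≫ r = τ)
    (ht' : t' ≫ r = τ) {u u' : T' ⟶ pullback r π} (hu₁ : u ≫ pullback.fst r π = ρ ≫ t)
    (hu₂ : u ≫ pullback.snd r π = q) (hu₁' : u' ≫ pullback.fst r π = ρ ≫ t')
    (hu₂' : u' ≫ pullback.snd r π = q) (e : u ≫ f = u' ≫ f) : t = t' :=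
  (h.existsUnique τ ρ q sq (u ≫ f) (by rw [h.comp_w hu₁, ht])).unique ⟨ht, u, hu₁, hu₂, rfl⟩
    ⟨ht', u', hu₁', hu₂', e.symm⟩

end HomExt

/-! ### Affine charts of the Weil restriction -/

section Chart

variable (A B C : CommRingCat.{u}) [Algebra A B] [Algebra A C]

/-- The tensor product as an object of the category of rings. -/
abbrev tensorRing : CommRingCat.{u} := .of (C ⊗[A] B)

theorem isPullback_specAlg : IsPullback (specAlg C (tensorRing A B C))
    (specAlg B (tensorRing A B C)) (specAlg A C) (specAlg A B) :=
  isPullback_SpecMap_of_isPushout _ _ _ _ (CommRingCat.isPushout_tensorProduct A C B)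

variable {A B C} {C' : CommRingCat.{u}} [Algebra A C']

/-- The base change of an algebra homomorphism, on spectra. -/
abbrev specBaseChange (B : CommRingCat.{u}) [Algebra A B] (α : C →ₐ[A] C') :
    Spec (tensorRing A B C') ⟶ Spec (tensorRing A B C) :=
  Spec.map (CommRingCat.ofHom
    (Algebra.TensorProduct.map α (AlgHom.id A B)).toRingHom)

/-- An algebra homomorphism, on spectra. -/
abbrev specAlgHom (α : C →ₐ[A] C') : Spec C' ⟶ Spec C := Spec.map (CommRingCat.ofHom α.toRingHom)

theorem specAlgHom_comp (α : C →ₐ[A] C') : specAlgHom α ≫ specAlg A C = specAlg A C' := by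
  rw [← Spec.map_comp, ← CommRingCat.ofHom_comp]
  exact congrArg (fun φ ↦ Spec.map (CommRingCat.ofHom φ)) α.comp_algebraMap

theorem specBaseChange_left (α : C →ₐ[A] C') : specBaseChange B α ≫ specAlg C (tensorRing A B C) =
    specAlg C' (tensorRing A B C') ≫ specAlgHom α := by
  rw [← Spec.map_comp, ← Spec.map_comp, ← CommRingCat.ofHom_comp, ← CommRingCat.ofHom_comp]
  congr 2

theorem specBaseChange_right (α : C →ₐ[A] C') :
    specBaseChange B α ≫ specAlg B (tensorRing A B C) = specAlg B (tensorRing A B C') := by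
  rw [← Spec.map_comp, ← CommRingCat.ofHom_comp]
  congr 2
  ext b
  exact (Algebra.TensorProduct.map_tmul α (AlgHom.id A B) 1 b).trans
    (congrArg (· ⊗ₜ[A] b) (map_one α))

variable {S' S X R : Scheme.{u}} (π : S' ⟶ S) (r : R ⟶ S) (i : Spec A ⟶ S) (i' : Spec B ⟶ S')
  (j : Spec C ⟶ R) (g : Spec (tensorRing A B C) ⟶ pullback r π)

/-- Compatible affine charts of `S`, `S'`, `R` and `R ×_S S'`. -/
structure IsWeilChart : Prop where
  w : j ≫ r = specAlg A C ≫ i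
  sq : IsPullback (specAlg A B) i' i π
  fst : g ≫ pullback.fst r π = specAlg C (tensorRing A B C) ≫ j
  snd : g ≫ pullback.snd r π = specAlg B (tensorRing A B C) ≫ i'

variable {π r i i' j g}

theorem IsWeilChart.isPullback (hc : IsWeilChart π r i i' j g)
    (C' : CommRingCat.{u}) [Algebra A C'] :
    IsPullback (specAlg C' (tensorRing A B C')) (specAlg B (tensorRing A B C') ≫ i')
      (specAlg A C' ≫ i) π :=
  (isPullback_specAlg A B C').paste_vert hc.sq

theorem IsWeilChart.comp_w (hc : IsWeilChart π r i i' j g) (α : C →ₐ[A] C') :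
    (specAlgHom α ≫ j) ≫ r = specAlg A C' ≫ i := by
  rw [Category.assoc, hc.w, ← Category.assoc, specAlgHom_comp]

theorem IsWeilChart.comp_fst (hc : IsWeilChart π r i i' j g)
    (α : C →ₐ[A] C') : (specBaseChange B α ≫ g) ≫ pullback.fst r π =
    specAlg C' (tensorRing A B C') ≫ specAlgHom α ≫ j := by
  rw [Category.assoc, hc.fst, ← Category.assoc, specBaseChange_left, Category.assoc]

theorem IsWeilChart.comp_snd (hc : IsWeilChart π r i i' j g)
    (α : C →ₐ[A] C') : (specBaseChange B α ≫ g) ≫ pullback.snd r π =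
    specAlg B (tensorRing A B C') ≫ i' := by
  rw [Category.assoc, hc.snd, ← Category.assoc, specBaseChange_right]

variable {x : X ⟶ S} {f : pullback r π ⟶ X}

/-- Uniqueness in the universal property: `α` is recovered from the morphism to `X` which it induces
after base change, because `j` is a monomorphism. -/
theorem IsWeilChart.algHom_ext (hc : IsWeilChart π r i i' j g)
    [Mono j] (h : IsWeilRestriction π x r f) {α α' : C →ₐ[A] C'}
    (e : specBaseChange B α ≫ g ≫ f = specBaseChange B α' ≫ g ≫ f) : α = α' := by
  have h₁ : specAlgHom α ≫ j = specAlgHom α' ≫ j :=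
    h.hom_ext (hc.isPullback C') (hc.comp_w α) (hc.comp_w α') (hc.comp_fst α) (hc.comp_snd α)
      (hc.comp_fst α') (hc.comp_snd α') (by rw [Category.assoc, e, Category.assoc])
  have h₂ := Spec.map_injective ((cancel_mono j).mp h₁)
  exact AlgHom.coe_ringHom_injective (congrArg CommRingCat.Hom.hom h₂)

theorem IsWeilChart.exists_hom (hc : IsWeilChart π r i i' j g) (h : IsWeilRestriction π x r f)
    (y : Spec (tensorRing A B C') ⟶ X)
    (hy : y ≫ x = specAlg C' (tensorRing A B C') ≫ specAlg A C' ≫ i) :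
    ∃ (t : Spec C' ⟶ R) (u : Spec (tensorRing A B C') ⟶ pullback r π),
      t ≫ r = specAlg A C' ≫ i ∧ u ≫ pullback.fst r π = specAlg C' (tensorRing A B C') ≫ t ∧
      u ≫ pullback.snd r π = specAlg B (tensorRing A B C') ≫ i' ∧ u ≫ f = y :=
  let ⟨t, ⟨ht, u, hu⟩, _⟩ := h.existsUnique _ _ _ (hc.isPullback C') y hy
  ⟨t, u, ht, hu⟩

/-- A morphism to the chart from an infinitesimal neighbourhood is given by a homomorphism of
algebras. -/
theorem IsWeilChart.exists_algHom (hc : IsWeilChart π r i i' j g)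
    [IsOpenImmersion j] [Mono i] (γ : C' →ₐ[A] C)
    (hγ : Function.Surjective (specAlgHom γ)) {t : Spec C' ⟶ R}
    (ht : t ≫ r = specAlg A C' ≫ i) (ht' : specAlgHom γ ≫ t = j) :
    ∃ α : C →ₐ[A] C', t = specAlgHom α ≫ j ∧ ∀ z, γ (α z) = z := by
  -- The thickening has no new points, so a morphism extending `j` still lands in the open chart.
  have hr : Set.range t ⊆ Set.range j := by
    rintro _ ⟨z, rfl⟩
    obtain ⟨y, rfl⟩ := hγ z
    exact ⟨y, by rw [← ht']; rfl⟩
  obtain ⟨s, hs⟩ : ∃ s : Spec C' ⟶ Spec C, s ≫ j = t := ⟨_, IsOpenImmersion.lift_fac j t hr⟩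
  have hs' : Spec.map (Spec.preimage s) = s := Spec.map_preimage s
  have h₁ : s ≫ specAlg A C = specAlg A C' := by
    rw [← cancel_mono i, Category.assoc, ← hc.w, ← Category.assoc, hs, ht]
  have h₂ : specAlgHom γ ≫ s = 𝟙 _ := by
    rw [← cancel_mono j, Category.assoc, hs, ht', Category.id_comp]
  rw [← hs', ← Spec.map_comp] at h₁
  rw [← hs', ← Spec.map_comp, ← Spec.map_id] at h₂
  have h₁' := congrArg CommRingCat.Hom.hom (Spec.map_injective h₁)
  have h₂' := congrArg CommRingCat.Hom.hom (Spec.map_injective h₂)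
  refine ⟨⟨(Spec.preimage s).hom, fun a ↦ congrArg (fun φ : A →+* C' ↦ φ a) h₁'⟩, ?_,
    fun z ↦ congrArg (fun φ : C →+* C ↦ φ z) h₂'⟩
  exact hs.symm.trans (congrArg (· ≫ j) hs'.symm)

end Chart

/-! ### Composition of deformations -/

theorem IsDeformation.hom_eq_comp {T X Y : Scheme.{u}} {h : T ⟶ X}
    {e : ∀ U : X.Opens, Γ(X, U) →+ Γ(T, h ⁻¹ᵁ U)} (he : IsDeformation h e) {k : X ⟶ Y}
    {e' : ∀ U : Y.Opens, Γ(Y, U) →+ Γ(T, (h ≫ k) ⁻¹ᵁ U)} (he' : IsDeformation (h ≫ k) e')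
    (H : ∀ U a, e' U a = e (k ⁻¹ᵁ U) (k.app U a)) : he'.hom = he.hom ≫ k := by
  refine schemeHom_ext_of_app rfl fun U _ a ↦ ?_
  refine (resO_self _ _).trans ?_
  have h₁ : (h ≫ k).app U a + e' U a = h.app (k ⁻¹ᵁ U) (k.app U a) + e (k ⁻¹ᵁ U) (k.app U a) :=
    congrArg ((h ≫ k).app U a + ·) (H U a)
  exact h₁

/-- A derivation with values in a composite of pushforwards, as a derivation with values in the
pushforward along the composite. -/
def SheafDerivation.ofPushforward {X Y Z S : Scheme.{u}} {x : X ⟶ S} {f : Y ⟶ X} {g : Z ⟶ Y}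
    {M : Z.Modules} (δ : SheafDerivation x
      ((Scheme.Modules.pushforward g ⋙ Scheme.Modules.pushforward f).obj M)) :
    SheafDerivation x ((Scheme.Modules.pushforward (g ≫ f)).obj M) where
  d U := δ.d U
  leibniz U a b := δ.leibniz U a b
  map h a := δ.map h a
  const V a := δ.const V a

theorem SheafDerivation.ofPushforward_injective {X Y Z S : Scheme.{u}} {x : X ⟶ S} {f : Y ⟶ X}
    {g : Z ⟶ Y} {M : Z.Modules} {δ δ' : SheafDerivation x
      ((Scheme.Modules.pushforward g ⋙ Scheme.Modules.pushforward f).obj M)}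
    (h : δ.ofPushforward = δ'.ofPushforward) : δ = δ' :=
  SheafDerivation.ext fun U a ↦ congrArg (fun ε ↦ SheafDerivation.d ε U a) h

section AffineDeformation

variable {B D E : CommRingCat.{u}} [Algebra B D] [Algebra D E] {p : E →ₐ[D] D}
  (δ : SheafDerivation (specAlg B D) (tilde (kerModule p)))

/-- The deformation of an affine scheme given by a derivation. -/
def SheafDerivation.affineKerSection (U : (Spec D).Opens) :
    Γ(Spec D, U) →+ Γ(Spec E, specAlg D E ⁻¹ᵁ U) :=
  (WeilDiff.kerSection p U).comp (δ.d U)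

theorem SheafDerivation.isDeformation_affine (hp : ∀ x y : E, p x = 0 → p y = 0 → x * y = 0) :
    IsDeformation (specAlg D E) δ.affineKerSection where
  leibniz U a b := by
    refine (congrArg (WeilDiff.kerSection p U) (δ.leibniz U a b)).trans ?_
    rw [map_add, WeilDiff.kerSection_smul, WeilDiff.kerSection_smul]
    rfl
  sq U a b := WeilDiff.kerSection_mul p hp U (δ.d U a) (δ.d U b)
  nat {U V} k a := (congrArg (WeilDiff.kerSection p V) (δ.map k a)).trans
    (kerSection_res p k (δ.d U a))

theorem SheafDerivation.affine_hom_eq (hp : ∀ x y : E, p x = 0 → p y = 0 → x * y = 0)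
    (φ : D →+* E) (l : D → RingHom.ker p)
    (hl : ∀ z, δ.d ⊤ (algebraMap D Γ(Spec D, ⊤) z) = tildeTop (kerModule p) (l z))
    (hφ : ∀ z, φ z = algebraMap D E z + (l z : E)) :
    (δ.isDeformation_affine hp).hom = Spec.map (CommRingCat.ofHom φ) := by
  refine ext_of_isAffine (CommRingCat.hom_ext (RingHom.ext fun a ↦ ?_))
  obtain ⟨z, rfl⟩ := (algebraMap_top_bijective D).2 a
  have h₁ : WeilDiff.kerSection p ⊤ (δ.d ⊤ (algebraMap D Γ(Spec D, ⊤) z)) =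
      algebraMap E Γ(Spec E, ⊤) (l z : E) :=
    (congrArg (WeilDiff.kerSection p ⊤) (hl z)).trans (kerHom_top p (l z))
  have h₂ : (specAlg D E).app ⊤ (algebraMap D Γ(Spec D, ⊤) z) =
      algebraMap E Γ(Spec E, ⊤) (algebraMap D E z) := specAlg_app_algebraMap ⊤ z
  have h₃ : (Spec.map (CommRingCat.ofHom φ)).app ⊤ (algebraMap D Γ(Spec D, ⊤) z) =
      algebraMap E Γ(Spec E, ⊤) (φ z) :=
    letI := φ.toAlgebra
    specAlg_app_algebraMap (A := D) (C := E) ⊤ z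
  exact (congrArg₂ (· + ·) h₂ h₁).trans (((map_add _ _ _).symm.trans
    (congrArg _ (hφ z).symm)).trans h₃.symm)

/-- The morphism between sheaves of modules given by a linear map on differentials. -/
def omegaKerHom (L : Ω[D⁄B] →ₗ[D] RingHom.ker p) : omegaTilde B D ⟶ tilde (kerModule p) :=
  tildeDesc (Q := ModuleCat.of D (Ω[D⁄B])) ((tildeTop (kerModule p)).comp L)

theorem omegaKerHom_top (L : Ω[D⁄B] →ₗ[D] RingHom.ker p) (ω : Ω[D⁄B]) :
    (omegaKerHom L).app ⊤ (omegaTop B D ω) = tildeTop (kerModule p) (L ω) :=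
  tildeDesc_top (Q := ModuleCat.of D (Ω[D⁄B])) ((tildeTop (kerModule p)).comp L) ω

/-- A linear map `L` on `Ω[D⁄B]` gives a ring homomorphism `φ`, the inclusion plus `L ∘ d`.
Deforming `g ≫ f` by the induced derivation on `X` is the same as precomposing it with the spectrum
of `φ`; this links derivations of `X` to homomorphisms of rings. -/
theorem deform_along_eq (hp : ∀ x y : E, p x = 0 → p y = 0 → x * y = 0)
    {δ : SheafDerivation (specAlg B D) (omegaTilde B D)}
    (hδ : ∀ z : D, δ.d ⊤ (algebraMap D Γ(Spec D, ⊤) z) =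
      omegaTop B D (KaehlerDifferential.D B D z))
    {L : Ω[D⁄B] →ₗ[D] RingHom.ker p} {φ : D →+* E}
    (hL : ∀ z, (L (KaehlerDifferential.D B D z) : E) = φ z - algebraMap D E z)
    {X U S S' : Scheme.{u}} {x : X ⟶ S} {f : U ⟶ X} {q : U ⟶ S'} {g : Spec D ⟶ U}
    {i' : Spec B ⟶ S'} {π : S' ⟶ S} (hg : g ≫ q = specAlg B D ≫ i') (hf : f ≫ x = q ≫ π) :
    ((((δ.comp (omegaKerHom L)).along g i' hg).along f π hf).ofPushforward (g := g)).deform hp =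
      Spec.map (CommRingCat.ofHom φ) ≫ g ≫ f := by
  have h₁ := (δ.comp (omegaKerHom L)).affine_hom_eq hp φ
    (fun z ↦ L (KaehlerDifferential.D B D z))
    (fun z ↦ (congrArg ((omegaKerHom L).app ⊤) (hδ z)).trans (omegaKerHom_top L _))
    (fun z ↦ by rw [hL]; exact (add_sub_cancel _ _).symm)
  exact (IsDeformation.hom_eq_comp ((δ.comp (omegaKerHom L)).isDeformation_affine hp) _
    fun U a ↦ rfl).trans (congrArg (· ≫ g ≫ f) h₁)

theorem omegaTop_bijective (B D : CommRingCat.{u}) [Algebra B D] :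
    Function.Bijective (omegaTop B D) :=
  tildeTop_bijective (ModuleCat.of D (Ω[D⁄B]))

section PullRes

theorem pullResDer_comp_eq {δ : SheafDerivation (specAlg B D) (omegaTilde B D)}
    {X U S S' : Scheme.{u}} {x : X ⟶ S} {f : U ⟶ X} {q : U ⟶ S'} {g : Spec D ⟶ U}
    [IsOpenImmersion g]
    {i' : Spec B ⟶ S'} {π : S' ⟶ S} {hg : g ≫ q = specAlg B D ≫ i'} {hf : f ≫ x = q ≫ π}
    {Θ : pullRes x f g ⟶ omegaTilde B D} (hΘ : pullResDer Θ = (δ.along g i' hg).along f π hf)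
    {M : (Spec D).Modules} (m : omegaTilde B D ⟶ M) :
    pullResDer (Θ ≫ m) = ((δ.comp m).along g i' hg).along f π hf :=
  (pullResDer_comp Θ m).trans
    (congrArg (SheafDerivation.comp ·
      ((Scheme.Modules.pushforward g ⋙ Scheme.Modules.pushforward f).map m)) hΘ)

/-- A linear form on sections of the pullback of differentials gives an infinitesimal
deformation. -/
theorem exists_deformation (hp : ∀ x y : E, p x = 0 → p y = 0 → x * y = 0)
    {δ : SheafDerivation (specAlg B D) (omegaTilde B D)}
    (hδ : ∀ z : D, δ.d ⊤ (algebraMap D Γ(Spec D, ⊤) z) =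
    omegaTop B D (KaehlerDifferential.D B D z))
    {X U S S' : Scheme.{u}} {x : X ⟶ S} {f : U ⟶ X} {q : U ⟶ S'} {g : Spec D ⟶ U}
    [IsOpenImmersion g]
    {i' : Spec B ⟶ S'} {π : S' ⟶ S} (hg : g ≫ q = specAlg B D ≫ i') (hf : f ≫ x = q ≫ π)
    {Θ : pullRes x f g ⟶ omegaTilde B D} (hΘ : pullResDer Θ = (δ.along g i' hg).along f π hf)
    (ψ : Γ(pullRes x f g, (⊤ : (Spec D).Opens)) →ₗ[D] RingHom.ker p) :
    ∃ y : Spec E ⟶ X, y ≫ x = specAlg D E ≫ (g ≫ f) ≫ x ∧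
      Spec.map (CommRingCat.ofHom p.toRingHom) ≫ y = g ≫ f ∧
      ∀ (φ : D →+* E) (L : Ω[D⁄B] →ₗ[D] RingHom.ker p),
        (∀ z, (L (KaehlerDifferential.D B D z) : E) = φ z - algebraMap D E z) →
        y = Spec.map (CommRingCat.ofHom φ) ≫ g ≫ f →
        ∀ n ω, Θ.app ⊤ n = omegaTop B D ω → ψ n = L ω := by
  -- Quasi-coherence extends `ψ` to a morphism of sheaves. By adjunction it becomes a derivation on
  -- `X`, which deforms `g ≫ f`.
  obtain ⟨m, hm, -⟩ := existsUnique_hom_of_isQuasicoherent (pullRes x f g)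
    (isQuasicoherent_pullRes x f g) (N := tilde (kerModule p)) ((tildeTop (kerModule p)).comp ψ)
  refine ⟨(pullResDer m).ofPushforward.deform hp, SheafDerivation.deform_comp _ hp,
    SheafDerivation.comp_deform _ hp, fun φ L hL hy n ω hn ↦ ?_⟩
  -- Equal deformations come from equal derivations, so the morphism extending `ψ` factors through
  -- `Θ`.
  have h₁ := SheafDerivation.ofPushforward_injective
    (SheafDerivation.eq_of_hom_eq hp (hy.trans (deform_along_eq hp hδ hL hg hf).symm))
  have h₂ : m = Θ ≫ omegaKerHom L :=
    pullResDer_injective (h₁.trans (pullResDer_comp_eq hΘ (omegaKerHom L)).symm)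
  have h₃ : m.app ⊤ n = (omegaKerHom L).app ⊤ (Θ.app ⊤ n) := by rw [h₂]; rfl
  rw [hm, hn, omegaKerHom_top] at h₃
  exact (tildeTop_bijective (kerModule p)).1 h₃

/-- A deformation of the map to `X` only sees `L` on differentials pulled back from `X`, that is, on
the image of `Θ`. As the source of `Θ` is quasi-coherent, global sections suffice. -/
theorem deformation_eq (hp : ∀ x y : E, p x = 0 → p y = 0 → x * y = 0)
    {δ : SheafDerivation (specAlg B D) (omegaTilde B D)}
    (hδ : ∀ z : D, δ.d ⊤ (algebraMap D Γ(Spec D, ⊤) z) =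
    omegaTop B D (KaehlerDifferential.D B D z))
    {X U S S' : Scheme.{u}} {x : X ⟶ S} {f : U ⟶ X} {q : U ⟶ S'} {g : Spec D ⟶ U}
    [IsOpenImmersion g]
    {i' : Spec B ⟶ S'} {π : S' ⟶ S} (hg : g ≫ q = specAlg B D ≫ i') (hf : f ≫ x = q ≫ π)
    {Θ : pullRes x f g ⟶ omegaTilde B D} (hΘ : pullResDer Θ = (δ.along g i' hg).along f π hf)
    {L L' : Ω[D⁄B] →ₗ[D] RingHom.ker p} {φ φ' : D →+* E}
    (hL : ∀ z, (L (KaehlerDifferential.D B D z) : E) = φ z - algebraMap D E z)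
    (hL' : ∀ z, (L' (KaehlerDifferential.D B D z) : E) = φ' z - algebraMap D E z)
    (h : ∀ n ω, Θ.app ⊤ n = omegaTop B D ω → L ω = L' ω) :
    Spec.map (CommRingCat.ofHom φ) ≫ g ≫ f = Spec.map (CommRingCat.ofHom φ') ≫ g ≫ f := by
  have h₁ : Θ ≫ omegaKerHom L = Θ ≫ omegaKerHom L' := by
    refine (existsUnique_hom_of_isQuasicoherent (pullRes x f g)
      (isQuasicoherent_pullRes x f g) (N := tilde (kerModule p))
      (topHom (Θ ≫ omegaKerHom L))).unique (fun n ↦ rfl) fun n ↦ ?_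
    obtain ⟨ω, hω⟩ := (omegaTop_bijective B D).2 (Θ.app ⊤ n)
    change (omegaKerHom L').app ⊤ (Θ.app ⊤ n) = (omegaKerHom L).app ⊤ (Θ.app ⊤ n)
    rw [← hω, omegaKerHom_top, omegaKerHom_top, h n ω hω.symm]
  have h₂ := congrArg pullResDer h₁
  rw [pullResDer_comp_eq hΘ, pullResDer_comp_eq hΘ] at h₂
  rw [← deform_along_eq hp hδ hL hg hf, ← deform_along_eq hp hδ hL' hg hf, h₂]

end PullRes

end AffineDeformation

/-! ### Differentials of the Weil restriction on affine charts -/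

theorem IsLift.ext {A B C D M Q : Type*} [CommRing A] [CommRing B] [CommRing C] [CommRing D]
    [Algebra A C] [Algebra B D] [Algebra C D] [AddCommGroup M] [Module C M] [AddCommGroup Q]
    [Module D Q] {inr : M →+ Q}
    (span : Submodule.span D
      (Set.range fun x : C ↦ KaehlerDifferential.D B D (algebraMap C D x)) = ⊤)
    {a : Ω[C⁄A] →ₗ[C] M} {l l' : Ω[D⁄B] →ₗ[D] Q} (h : IsLift inr a l) (h' : IsLift inr a l') :
    l = l' :=
  LinearMap.ext_on_range span fun x ↦ (h x).trans (h' x).symm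

section ChartDifferentials

variable {A B C : CommRingCat.{u}} [Algebra A B] [Algebra A C] {S' S X R : Scheme.{u}}
  {π : S' ⟶ S} {r : R ⟶ S} {i : Spec A ⟶ S} {i' : Spec B ⟶ S'}
  {j : Spec C ⟶ R} {g : Spec (tensorRing A B C) ⟶ pullback r π}
  {x : X ⟶ S} {f : pullback r π ⟶ X}

theorem IsWeilRestriction.comm (h : IsWeilRestriction π x r f) :
    f ≫ x = pullback.snd r π ≫ π :=
  h.w.trans pullback.condition

/-- The square-zero extension as an object of the category of rings. -/
abbrev sqZeroRing (C : CommRingCat.{u}) (M : Type u) [AddCommGroup M] [Module C M] :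
    CommRingCat.{u} := .of (SqZero C M)

instance sqZeroRing.algebra (A C : CommRingCat.{u}) [Algebra A C] (M : Type u) [AddCommGroup M]
    [Module C M] : Algebra A (sqZeroRing C M) :=
  inferInstanceAs (Algebra A (SqZero C M))

instance sqZeroRing.baseAlgebra (A B C : CommRingCat.{u}) [Algebra A B] [Algebra A C] (M : Type u)
    [AddCommGroup M] [Module C M] : Algebra (tensorRing A B C) (tensorRing A B (sqZeroRing C M)) :=
  inferInstanceAs (Algebra (C ⊗[A] B) (SqZero C M ⊗[A] B))

variable {M : Type u} [AddCommGroup M] [Module C M]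

/-- The projection from the base change of a square-zero extension. -/
abbrev sqZeroProj (A B C : CommRingCat.{u}) [Algebra A B] [Algebra A C] (M : Type u)
    [AddCommGroup M] [Module C M] :
    tensorRing A B (sqZeroRing C M) →ₐ[tensorRing A B C] tensorRing A B C :=
  SqZero.baseFst A B C M

theorem specAlg_sqZero :
    specAlg (tensorRing A B C) (tensorRing A B (sqZeroRing C M)) =
      specBaseChange (C' := sqZeroRing C M) B (SqZero.inlAlgHom A C M) := rfl

theorem specAlg_sqZero_comp : specAlg (tensorRing A B C) (tensorRing A B (sqZeroRing C M)) ≫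
      specAlg C (tensorRing A B C) ≫ specAlg A C =
    specAlg (sqZeroRing C M) (tensorRing A B (sqZeroRing C M)) ≫ specAlg A (sqZeroRing C M) := by
  rw [specAlg_sqZero, ← Category.assoc, specBaseChange_left, Category.assoc, specAlgHom_comp]

theorem specAlgHom_fst_surjective :
    Function.Surjective (specAlgHom (C := sqZeroRing C M) (C' := C) (SqZero.fstAlgHom A C M)) := by
  intro y
  have h₁ : Function.Surjective (SqZero.fstHom C M) := fun z ↦ ⟨SqZero.inl C M z, rfl⟩
  have h₂ := range_comap_of_surjective _ (SqZero.fstHom C M) h₁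
  have h₃ : (y : PrimeSpectrum (SqZero C M)) ∈
      PrimeSpectrum.zeroLocus (RingHom.ker (SqZero.fstHom C M) : Set (SqZero C M)) := by
    intro z (hz : z.fst = 0)
    refine y.2.mem_of_pow_mem 2 ?_
    have : z ^ 2 = 0 := by
      rw [pow_two]
      exact SqZero.ext (by simp [hz]) (by simp [hz])
    rw [this]
    exact zero_mem _
  rw [← h₂] at h₃
  exact h₃

/-- A deformation of a chart of the universal map comes from a homomorphism of algebras. -/
theorem IsWeilChart.exists_ofDifferential (hc : IsWeilChart π r i i' j g)
    (h : IsWeilRestriction π x r f) [IsOpenImmersion j] [Mono i]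
    {y : Spec (tensorRing A B (sqZeroRing C M)) ⟶ X}
    (hy : y ≫ x = specAlg (tensorRing A B C) (tensorRing A B (sqZeroRing C M)) ≫ (g ≫ f) ≫ x)
    (hy' : Spec.map (CommRingCat.ofHom (sqZeroProj A B C M).toRingHom) ≫ y = g ≫ f) :
    ∃ a : Ω[C⁄A] →ₗ[C] M,
      y = specBaseChange (C' := sqZeroRing C M) B (SqZero.ofDifferential a) ≫ g ≫ f := by
  have h₁ : (g ≫ f) ≫ x = specAlg C (tensorRing A B C) ≫ specAlg A C ≫ i := by
    rw [Category.assoc, h.w, ← Category.assoc, hc.fst, Category.assoc, hc.w]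
  have h₂ : y ≫ x = specAlg (sqZeroRing C M) (tensorRing A B (sqZeroRing C M)) ≫
      specAlg A (sqZeroRing C M) ≫ i := by
    rw [hy, h₁, ← Category.assoc (specAlg _ _) (specAlg A C) i, ← Category.assoc,
      specAlg_sqZero_comp, Category.assoc]
  obtain ⟨t, u, ht, hu₁, hu₂, hu₃⟩ := hc.exists_hom h y h₂
  let γ : sqZeroRing C M →ₐ[A] C := SqZero.fstAlgHom A C M
  have hy'' : specBaseChange B γ ≫ y = g ≫ f := hy'
  -- After base change to `S'` the restriction of `t` to `Spec C` and `j` both give the universal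
  -- map `g ≫ f`, so they agree. Hence `t` corresponds to a section of the projection from the
  -- square-zero extension, i.e. to a derivation.
  have hγt : specAlgHom γ ≫ t = j := by
    refine h.hom_ext (hc.isPullback C) ?_ hc.w (u := specBaseChange B γ ≫ u) (u' := g) ?_ ?_
      hc.fst hc.snd ?_
    · rw [Category.assoc, ht, ← Category.assoc, specAlgHom_comp]
    · rw [Category.assoc, hu₁, ← Category.assoc, specBaseChange_left, Category.assoc]
    · rw [Category.assoc, hu₂, ← Category.assoc, specBaseChange_right]
    · rw [Category.assoc, hu₃, hy'']
  obtain ⟨α, hα, hα'⟩ := hc.exists_algHom γ specAlgHom_fst_surjective ht hγt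
  obtain ⟨a, ha⟩ := SqZero.exists_ofDifferential_eq (M := M) α hα'
  refine ⟨a, ?_⟩
  have hu : u = specBaseChange B α ≫ g := by
    refine pullback.hom_ext ?_ ?_
    · rw [hu₁, hc.comp_fst, hα]
    · rw [hu₂, hc.comp_snd]
  rw [← hu₃, hu, Category.assoc, ha]

end ChartDifferentials

section Core

instance tensorRing.algebraSections (A B C : CommRingCat.{u}) [Algebra A B] [Algebra A C]
    (U : (Spec (tensorRing A B C)).Opens) :
    Algebra (tensorRing A B C) Γ(Spec (tensorRing A B C), U) :=
  IsAffineOpen.instAlgebraCarrierObjOppositeOpensCarrierCarrierCommRingCatSpecPresheafOpOpens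

instance tensorRing.moduleSections (A B C : CommRingCat.{u}) [Algebra A B] [Algebra A C]
    (M : (Spec (tensorRing A B C)).Modules) (U : (Spec (tensorRing A B C)).Opens) :
    Module (tensorRing A B C) Γ(M, U) :=
  Scheme.Modules.instModuleCarrierCarrierObjOppositeOpensCarrierCarrierCommRingCatSpecAbPresheafOp

variable {A B C : CommRingCat.{u}} [Algebra A B] [Algebra A C] {S' S X R : Scheme.{u}}
  {π : S' ⟶ S} {r : R ⟶ S} {i : Spec A ⟶ S} {i' : Spec B ⟶ S'}
  {j : Spec C ⟶ R} {g : Spec (tensorRing A B C) ⟶ pullback r π}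
  {x : X ⟶ S} {f : pullback r π ⟶ X}

/-- On an affine chart, the trace identifies the pullback of the differentials of `X` with the
differentials of the Weil restriction. -/
theorem IsWeilChart.bijective_trace {l : B →ₗ[A] A} {n : ℕ} {b c : Fin n → B}
    (hF : IsFrobeniusSystem l b c) (hc : IsWeilChart π r i i' j g)
    (h : IsWeilRestriction π x r f) [IsOpenImmersion j] [Mono i] [IsOpenImmersion g]
    {δ : SheafDerivation (specAlg B (tensorRing A B C)) (omegaTilde B (tensorRing A B C))}
    (hδ : ∀ z, δ.d ⊤ (algebraMap (tensorRing A B C) Γ(Spec (tensorRing A B C), ⊤) z) =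
      omegaTop B (tensorRing A B C) (KaehlerDifferential.D B (tensorRing A B C) z))
    {Θ : pullRes x f g ⟶ omegaTilde B (tensorRing A B C)}
    (hΘ : pullResDer Θ = (δ.along g i' hc.snd).along f π h.comm)
    {θ : Γ(pullRes x f g, (⊤ : (Spec (tensorRing A B C)).Opens)) →ₗ[tensorRing A B C]
      Ω[tensorRing A B C⁄B]}
    (hθ : ∀ n, Θ.app ⊤ n = omegaTop B (tensorRing A B C) (θ n))
    {t : Ω[C ⊗[A] B⁄B] →+ Ω[C⁄A]}
    (ht : ∀ y z, t (y • KaehlerDifferential.D B (C ⊗[A] B) (algebraMap C (C ⊗[A] B) z)) =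
        baseTrace l C y • KaehlerDifferential.D A C z)
    (ht' : ∀ (z : C) (ω : Ω[C ⊗[A] B⁄B]), t (algebraMap C (C ⊗[A] B) z • ω) = z • t ω) :
    Function.Bijective fun n ↦ t (θ n) := by
  let _ : Module C Γ(pullRes x f g, (⊤ : (Spec (tensorRing A B C)).Opens)) :=
    Module.compHom _ (algebraMap C (C ⊗[A] B))
  have : IsScalarTower C (tensorRing A B C)
      Γ(pullRes x f g, (⊤ : (Spec (tensorRing A B C)).Opens)) := by
    refine ⟨fun z d n ↦ ?_⟩
    rw [Algebra.smul_def, mul_smul]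
    rfl
  refine bijective_trace_comp (hF.baseChange C) (span_range_D_tensorProduct) ht ht' θ
    (SqZero.isTracePairing hF) ?_ (SqZero.isTracePairing hF) ?_ ?_
  -- Existence half of the universal property, tested on the extension by `N`.
  · intro ψ
    obtain ⟨y, hy, hy', H⟩ := exists_deformation (p := sqZeroProj A B C _)
      (fun _ _ ↦ SqZero.baseFst_mul_eq_zero hF) hδ hc.snd h.comm hΘ ψ
    obtain ⟨a, ha⟩ := hc.exists_ofDifferential h hy hy'
    obtain ⟨L, hL, hL'⟩ := SqZero.exists_lift hF a
    exact ⟨a, L, hL, LinearMap.ext fun n ↦ H _ L hL' ha n (θ n) (hθ n)⟩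
  · intro a
    obtain ⟨L, hL, -⟩ := SqZero.exists_lift hF a
    exact ⟨L, hL⟩
  -- Uniqueness half of the universal property, tested on the extension by `Ω[C⁄A]` itself.
  · intro a a' L L' hL hL' e
    obtain ⟨L₁, h₁, h₁'⟩ := SqZero.exists_lift hF a
    obtain ⟨L₂, h₂, h₂'⟩ := SqZero.exists_lift hF a'
    obtain rfl := hL.ext span_range_D_tensorProduct h₁
    obtain rfl := hL'.ext span_range_D_tensorProduct h₂
    refine SqZero.ofDifferential_injective (hc.algHom_ext h (C' := sqZeroRing C _) ?_)
    refine deformation_eq (p := sqZeroProj A B C _) (fun _ _ ↦ SqZero.baseFst_mul_eq_zero hF) hδ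
      hc.snd h.comm hΘ h₁' h₂' fun n ω hn ↦ ?_
    rw [hθ] at hn
    rw [← (omegaTop_bijective _ _).1 hn]
    exact congrArg (fun k : _ →ₗ[C ⊗[A] B] _ ↦ k n) e

end Core

/-! ### Part: local generators of the dualizing sheaf and tensor products with it. -/

/-! ### Trace charts -/

/-- A generator of the dualizing sheaf over an open subset of the base, with dual bases. -/
structure TraceChart {S' S : Scheme.{u}} (π : S' ⟶ S) (S₀ : S.Opens) where
  /-- The generator. -/
  trace : homSections π S₀
  /-- The degree. -/
  n : ℕ
  /-- A basis. -/
  b : Fin n → Γ(S', π ⁻¹ᵁ S₀)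
  /-- The dual basis. -/
  c : Fin n → Γ(S', π ⁻¹ᵁ S₀)
  -- This makes the family `c` linearly independent, which is what the uniqueness of coordinates of
  -- differentials rests on.
  dual (i j : Fin n) : trace.1 ⟨S₀, le_rfl⟩ (b i * c j) = if i = j then 1 else 0
  -- The expansion is required over every smaller open, so that nondegeneracy is available over
  -- intersections of domains, which need not be affine.
  eq_sum (W : {W : S.Opens // W ≤ S₀}) (x : Γ(S', π ⁻¹ᵁ W.1)) :
    x = ∑ i, π.app W.1 (trace.1 W (x * resPre π W.2 (b i))) * resPre π W.2 (c i)

theorem resPre_app {S' S : Scheme.{u}} (π : S' ⟶ S) {V W : S.Opens} (h : W ≤ V) (a : Γ(S, V)) :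
    resPre π h (π.app V a) = π.app W (resO S h a) :=
  (ConcreteCategory.congr_hom (π.c.naturality (homOfLE h).op) a).symm

theorem homSections_linear {S' S : Scheme.{u}} {π : S' ⟶ S} {V : S.Opens} (φ : homSections π V)
    (W : {W : S.Opens // W ≤ V}) (r : Γ(S, W.1)) (a : Γ(S', π ⁻¹ᵁ W.1)) :
    φ.1 W (π.app W.1 r * a) = r * φ.1 W a := φ.2.1 W r a

theorem homSections_res {S' S : Scheme.{u}} {π : S' ⟶ S} {V : S.Opens} (φ : homSections π V)
    (W W' : {W : S.Opens // W ≤ V}) (h : W'.1 ≤ W.1) (a : Γ(S', π ⁻¹ᵁ W.1)) :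
    resO S h (φ.1 W a) = φ.1 W' (resPre π h a) := φ.2.2 W W' h a

theorem homSections_sum {S' S : Scheme.{u}} {π : S' ⟶ S} {V : S.Opens} (φ : homSections π V)
    (W : {W : S.Opens // W ≤ V}) {ι : Type*} (s : Finset ι)
    (r : ι → Γ(S, W.1)) (a : ι → Γ(S', π ⁻¹ᵁ W.1)) :
    φ.1 W (∑ i ∈ s, π.app W.1 (r i) * a i) = ∑ i ∈ s, r i * φ.1 W (a i) := by
  rw [map_sum]
  exact Finset.sum_congr rfl fun i _ ↦ homSections_linear φ W _ _

namespace TraceChart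

variable {S' S : Scheme.{u}} {π : S' ⟶ S} {S₀ : S.Opens} (χ : TraceChart π S₀)

theorem eq_of_trace (W : {W : S.Opens // W ≤ S₀}) {x y : Γ(S', π ⁻¹ᵁ W.1)}
    (h : ∀ z, χ.trace.1 W (x * z) = χ.trace.1 W (y * z)) : x = y := by
  rw [χ.eq_sum W x, χ.eq_sum W y]
  exact Finset.sum_congr rfl fun i _ ↦ by rw [h]

theorem eq_sum' (W : {W : S.Opens // W ≤ S₀}) (x : Γ(S', π ⁻¹ᵁ W.1)) :
    x = ∑ i, π.app W.1 (χ.trace.1 W (x * resPre π W.2 (χ.c i))) * resPre π W.2 (χ.b i) := by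
  refine χ.eq_of_trace W fun z ↦ ?_
  rw [Finset.sum_mul, map_sum]
  have h₁ : ∀ i, χ.trace.1 W (π.app W.1 (χ.trace.1 W (x * resPre π W.2 (χ.c i))) *
      resPre π W.2 (χ.b i) * z) = χ.trace.1 W (z * resPre π W.2 (χ.b i)) *
        χ.trace.1 W (x * resPre π W.2 (χ.c i)) := fun i ↦ by
    rw [mul_assoc, homSections_linear, mul_comm, mul_comm z]
  simp only [h₁]
  conv_lhs => rw [χ.eq_sum W z, Finset.mul_sum, map_sum]
  refine Finset.sum_congr rfl fun i _ ↦ ?_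
  rw [mul_left_comm, homSections_linear]

/-- The coefficient of a section of the dualizing sheaf with respect to the generator. -/
def coef {W : S.Opens} (hW : W ≤ S₀) : homSections π W →+ Γ(S', π ⁻¹ᵁ W) where
  toFun φ := ∑ i, π.app W (φ.1 ⟨W, le_rfl⟩ (resPre π hW (χ.b i))) * resPre π hW (χ.c i)
  map_zero' := by
    refine Finset.sum_eq_zero fun i _ ↦ ?_
    change π.app W 0 * _ = 0
    rw [map_zero, zero_mul]
  map_add' φ ψ := by
    rw [← Finset.sum_add_distrib]
    refine Finset.sum_congr rfl fun i _ ↦ ?_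
    rw [← add_mul, ← map_add]
    rfl

theorem coef_apply {W : S.Opens} (hW : W ≤ S₀) (φ : homSections π W) : χ.coef hW φ =
    ∑ i, π.app W (φ.1 ⟨W, le_rfl⟩ (resPre π hW (χ.b i))) * resPre π hW (χ.c i) := rfl

theorem coef_res {V W : S.Opens} (hV : V ≤ S₀) (h : W ≤ V) (φ : homSections π V) :
    χ.coef (h.trans hV) (homSectionsRes h φ) = resPre π h (χ.coef hV φ) := by
  rw [coef_apply, coef_apply, map_sum]
  refine Finset.sum_congr rfl fun i _ ↦ ?_
  rw [map_mul, resPre_app, homSections_res φ ⟨V, le_rfl⟩ ⟨W, h⟩ h, resPre_resPre, resPre_resPre]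
  rfl

/-- Every form is the trace of a multiplication: with `u = ∑ φ(b_i) c_i`, expanding `x` in the `b_i`
gives `tr (x u) = φ x`. So the trace generates the module of forms. -/
theorem trace_mul_coef {W : S.Opens} (hW : W ≤ S₀) (φ : homSections π W)
    (x : Γ(S', π ⁻¹ᵁ W)) :
    χ.trace.1 ⟨W, hW⟩ (x * χ.coef hW φ) = φ.1 ⟨W, le_rfl⟩ x := by
  conv_rhs => rw [χ.eq_sum' ⟨W, hW⟩ x, homSections_sum φ ⟨W, le_rfl⟩]
  rw [coef_apply, Finset.mul_sum, map_sum]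
  refine Finset.sum_congr rfl fun i _ ↦ ?_
  rw [mul_left_comm]
  exact (homSections_linear χ.trace ⟨W, hW⟩ _ _).trans (mul_comm _ _)

theorem coef_smul_trace {W : S.Opens} (hW : W ≤ S₀) (φ : homSections π W) :
    χ.coef hW φ • homSectionsRes hW χ.trace = φ := by
  ext V a
  rw [smul_homSections_apply, ← χ.coef_res hW V.2, mul_comm]
  exact χ.trace_mul_coef (V.2.trans hW) (homSectionsRes V.2 φ) a

theorem coef_smul {W : S.Opens} (hW : W ≤ S₀) (u : Γ(S', π ⁻¹ᵁ W)) (φ : homSections π W) :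
    χ.coef hW (u • φ) = u * χ.coef hW φ := by
  refine χ.eq_of_trace ⟨W, hW⟩ fun z ↦ ?_
  rw [mul_comm, χ.trace_mul_coef, smul_homSections_apply, mul_comm u, mul_assoc, mul_comm _ (u * z),
    χ.trace_mul_coef]
  exact congrArg (fun y ↦ φ.1 ⟨W, le_rfl⟩ (y * z)) (resO_self (X := S') le_rfl u)

theorem coef_trace {W : S.Opens} (hW : W ≤ S₀) : χ.coef hW (homSectionsRes hW χ.trace) = 1 := by
  refine χ.eq_of_trace ⟨W, hW⟩ fun z ↦ ?_
  rw [mul_comm, χ.trace_mul_coef, one_mul]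
  rfl

end TraceChart

/-! ### Sections of the dualizing sheaf -/

section Dualizing

variable {S' S : Scheme.{u}} (π : S' ⟶ S)

/-- The presheaf underlying the dualizing sheaf. -/
abbrev dualizingPre : S'.PresheafOfModules :=
  (PresheafOfModules.pullback.{u} (F := Opens.map π.base) (𝟙 (pushforwardRing π))).obj (homModule π)

/-- The adjunction for presheaves of modules along `(S', 𝒪_{S'}) ⟶ (S, π_* 𝒪_{S'})`. -/
def dualizingAdjunction :
    PresheafOfModules.pullback.{u} (F := Opens.map π.base) (𝟙 (pushforwardRing π)) ⊣
      PresheafOfModules.pushforward.{u} (F := Opens.map π.base) (𝟙 (pushforwardRing π)) :=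
  PresheafOfModules.pullbackPushforwardAdjunction.{u} (F := Opens.map π.base)
    (𝟙 (pushforwardRing π))

/-- The pushforward of presheaves of modules along `(S', 𝒪_{S'}) ⟶ (S, π_* 𝒪_{S'})`. -/
abbrev pushPre (N : S'.PresheafOfModules) : PresheafOfModules.{u} (pushforwardRing π) :=
  (PresheafOfModules.pushforward.{u} (F := Opens.map π.base) (𝟙 (pushforwardRing π))).obj N

/-- The unit for the underlying presheaf of the dualizing sheaf. -/
def dualizingPreUnit : homModule π ⟶ pushPre π (dualizingPre π) :=
  (dualizingAdjunction π).unit.app (homModule π)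

/-- Sections of `ℋom(π_* 𝒪_{S'}, 𝒪_S)`, as sections of the dualizing sheaf. -/
def dualizingUnit (V : S.Opens) : homSections π V →+ Γ(dualizingSheaf π, π ⁻¹ᵁ V) :=
  (sheafifyUnit (dualizingPre π) (π ⁻¹ᵁ V)).comp
    ((dualizingPreUnit π).app (op V)).hom.toAddMonoidHom

theorem dualizingUnit_smul (V : S.Opens) (a : Γ(S', π ⁻¹ᵁ V)) (φ : homSections π V) :
    dualizingUnit π V (a • φ) = a • dualizingUnit π V φ :=
  (congrArg (sheafifyUnit (dualizingPre π) (π ⁻¹ᵁ V))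
    (((dualizingPreUnit π).app (op V)).hom.map_smul a φ)).trans
      (sheafifyUnit_smul (dualizingPre π) (π ⁻¹ᵁ V) a _)

theorem dualizingUnit_res {V W : S.Opens} (h : W ≤ V) (φ : homSections π V) :
    dualizingUnit π W (homSectionsRes h φ) =
      res (dualizingSheaf π) (preimage_le π h) (dualizingUnit π V φ) :=
  (congrArg (sheafifyUnit (dualizingPre π) (π ⁻¹ᵁ W))
    (PresheafOfModules.naturality_apply (dualizingPreUnit π) (homOfLE h).op φ)).trans
      (sheafifyUnit_map (dualizingPre π) (preimage_le π h) _)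

variable {π}

/-- The dualizing sheaf is obtained by a pullback followed by sheafification, both left adjoints.
Morphisms out of it are thus tested, and in `exists_dualizing_hom` constructed, on forms over opens
of `S`, with no description of its sections over other opens of `S'`. -/
theorem dualizing_hom_ext {N : S'.Modules} {m m' : dualizingSheaf π ⟶ N}
    (h : ∀ V φ, m.app (π ⁻¹ᵁ V) (dualizingUnit π V φ) = m'.app (π ⁻¹ᵁ V) (dualizingUnit π V φ)) :
    m = m' := by
  refine sheafify_hom_ext (P := dualizingPre π)
    (((dualizingAdjunction π).homEquiv _ _).injective ?_)
  refine ((dualizingAdjunction π).homEquiv_unit _ _ _).trans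
    (Eq.trans ?_ ((dualizingAdjunction π).homEquiv_unit _ _ _).symm)
  ext V φ
  exact h V.unop φ

/-- The morphism from the dualizing sheaf given by its action on homomorphisms. -/
theorem exists_dualizing_hom {N : S'.Modules} (β : ∀ V, homSections π V →+ Γ(N, π ⁻¹ᵁ V))
    (smul : ∀ V (a : Γ(S', π ⁻¹ᵁ V)) φ, β V (a • φ) = a • β V φ)
    (nat : ∀ {V W : S.Opens} (h : W ≤ V) φ,
      β W (homSectionsRes h φ) = res N (preimage_le π h) (β V φ)) :
    ∃ m : dualizingSheaf π ⟶ N, ∀ V φ, m.app (π ⁻¹ᵁ V) (dualizingUnit π V φ) = β V φ := by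
  let N' : S'.PresheafOfModules := (Scheme.Modules.toPresheafOfModules S').obj N
  let γ : homModule π ⟶ pushPre π N' :=
    PresheafOfModules.homMk (M₁ := homModule π) (M₂ := pushPre π N')
      { app V := AddCommGrpCat.ofHom (β V.unop)
        naturality V W i := by
          ext φ
          exact nat (leOfHom i.unop) φ }
      fun V a φ ↦ smul V.unop a φ
  refine ⟨sheafifyDesc (((dualizingAdjunction π).homEquiv _ N').symm γ), fun V φ ↦ ?_⟩
  refine (sheafifyDesc_app (P := dualizingPre π) _ (π ⁻¹ᵁ V) _).trans ?_
  have h₁ : dualizingPreUnit π ≫ (PresheafOfModules.pushforward.{u} (F := Opens.map π.base)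
      (𝟙 (pushforwardRing π))).map (((dualizingAdjunction π).homEquiv _ N').symm γ) = γ :=
    ((dualizingAdjunction π).homEquiv_unit _ _ _).symm.trans
      (((dualizingAdjunction π).homEquiv _ N').apply_symm_apply γ)
  exact congrArg (fun ψ : homModule π ⟶ pushPre π N' ↦ (ψ.app (op V)).hom φ) h₁

end Dualizing

/-! ### Sections of the pullback of the dualizing sheaf -/

section PullbackUnit

variable {U S' : Scheme.{u}} (q : U ⟶ S')

/-- Pullback of sections of a sheaf of modules. -/
def pullbackUnit (M : S'.Modules) (V : S'.Opens) :
    Γ(M, V) →+ Γ((Scheme.Modules.pullback q).obj M, q ⁻¹ᵁ V) :=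
  (((Scheme.Modules.pullbackPushforwardAdjunction q).unit.app M).app V).hom

theorem pullbackUnit_smul (M : S'.Modules) (V : S'.Opens) (a : Γ(S', V)) (x : Γ(M, V)) :
    pullbackUnit q M V (a • x) = q.app V a • pullbackUnit q M V x :=
  Scheme.Modules.Hom.app_smul ((Scheme.Modules.pullbackPushforwardAdjunction q).unit.app M) a x

theorem pullbackUnit_res (M : S'.Modules) {V W : S'.Opens} (h : W ≤ V) (x : Γ(M, V)) :
    pullbackUnit q M W (res M h x) = res _ (preimage_le q h) (pullbackUnit q M V x) :=
  app_res ((Scheme.Modules.pullbackPushforwardAdjunction q).unit.app M) h x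

variable {q} {M : S'.Modules} {N : U.Modules}

theorem pullback_homEquiv_app (m : (Scheme.Modules.pullback q).obj M ⟶ N) (V : S'.Opens)
    (x : Γ(M, V)) :
    ((Scheme.Modules.pullbackPushforwardAdjunction q).homEquiv M N m).app V x =
      m.app (q ⁻¹ᵁ V) (pullbackUnit q M V x) := by
  rw [Adjunction.homEquiv_unit]
  rfl

theorem pullback_hom_ext {m m' : (Scheme.Modules.pullback q).obj M ⟶ N}
    (h : (Scheme.Modules.pullbackPushforwardAdjunction q).homEquiv M N m =
      (Scheme.Modules.pullbackPushforwardAdjunction q).homEquiv M N m') : m = m' :=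
  ((Scheme.Modules.pullbackPushforwardAdjunction q).homEquiv M N).injective h

theorem pullback_homEquiv_symm_app (m : M ⟶ (Scheme.Modules.pushforward q).obj N) (V : S'.Opens)
    (x : Γ(M, V)) :
    (((Scheme.Modules.pullbackPushforwardAdjunction q).homEquiv M N).symm m).app (q ⁻¹ᵁ V)
      (pullbackUnit q M V x) = m.app V x := by
  rw [← pullback_homEquiv_app, Equiv.apply_symm_apply]

end PullbackUnit

section PullbackDualizing

variable {U S' S : Scheme.{u}} (q : U ⟶ S') (π : S' ⟶ S)

/-- The pullback of the dualizing sheaf. -/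
abbrev pullDualizing : U.Modules := (Scheme.Modules.pullback q).obj (dualizingSheaf π)

/-- Homomorphisms as sections of the pullback of the dualizing sheaf. -/
def dualUnit (V : S.Opens) : homSections π V →+ Γ(pullDualizing q π, q ⁻¹ᵁ π ⁻¹ᵁ V) :=
  (pullbackUnit q (dualizingSheaf π) (π ⁻¹ᵁ V)).comp (dualizingUnit π V)

theorem dualUnit_smul (V : S.Opens) (a : Γ(S', π ⁻¹ᵁ V)) (φ : homSections π V) :
    dualUnit q π V (a • φ) = q.app (π ⁻¹ᵁ V) a • dualUnit q π V φ :=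
  (congrArg (pullbackUnit q (dualizingSheaf π) (π ⁻¹ᵁ V)) (dualizingUnit_smul π V a φ)).trans
    (pullbackUnit_smul q (dualizingSheaf π) (π ⁻¹ᵁ V) a (dualizingUnit π V φ))

theorem dualUnit_res {V W : S.Opens} (h : W ≤ V) (φ : homSections π V) :
    dualUnit q π W (homSectionsRes h φ) =
      res (pullDualizing q π) (preimage_le q (preimage_le π h)) (dualUnit q π V φ) :=
  (congrArg (pullbackUnit q (dualizingSheaf π) (π ⁻¹ᵁ W)) (dualizingUnit_res π h φ)).trans
    (pullbackUnit_res q (dualizingSheaf π) (preimage_le π h) (dualizingUnit π V φ))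

variable {q π} {N : U.Modules}

theorem pullDualizing_hom_ext {m m' : pullDualizing q π ⟶ N}
    (h : ∀ V φ, m.app (q ⁻¹ᵁ π ⁻¹ᵁ V) (dualUnit q π V φ) =
      m'.app (q ⁻¹ᵁ π ⁻¹ᵁ V) (dualUnit q π V φ)) : m = m' :=
  pullback_hom_ext (dualizing_hom_ext fun V φ ↦
    (pullback_homEquiv_app m _ _).trans ((h V φ).trans (pullback_homEquiv_app m' _ _).symm))

theorem exists_pullDualizing_hom (β : ∀ V, homSections π V →+ Γ(N, q ⁻¹ᵁ π ⁻¹ᵁ V))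
    (smul : ∀ V (a : Γ(S', π ⁻¹ᵁ V)) φ, β V (a • φ) = q.app (π ⁻¹ᵁ V) a • β V φ)
    (nat : ∀ {V W : S.Opens} (h : W ≤ V) φ,
      β W (homSectionsRes h φ) = res N (preimage_le q (preimage_le π h)) (β V φ)) :
    ∃ m : pullDualizing q π ⟶ N, ∀ V φ, m.app (q ⁻¹ᵁ π ⁻¹ᵁ V) (dualUnit q π V φ) = β V φ := by
  obtain ⟨m, hm⟩ := exists_dualizing_hom (N := (Scheme.Modules.pushforward q).obj N) β smul nat
  exact ⟨((Scheme.Modules.pullbackPushforwardAdjunction q).homEquiv _ _).symm m, fun V φ ↦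
    (pullback_homEquiv_symm_app m (π ⁻¹ᵁ V) (dualizingUnit π V φ)).trans (hm V φ)⟩

end PullbackDualizing

/-! ### The pullback of the dualizing sheaf is locally free of rank one -/

section PushRestrict

variable {X : Scheme.{u}} (W₀ : X.Opens)

/-- The intersection with a given open subset, as an image. -/
abbrev meet (W : X.Opens) : X.Opens := W₀.ι ''ᵁ W₀.ι ⁻¹ᵁ W

theorem meet_le_right (W : X.Opens) : meet W₀ W ≤ W := W₀.ι.image_preimage_le W

theorem meet_le_left (W : X.Opens) : meet W₀ W ≤ W₀ := by
  rintro _ ⟨y, -, rfl⟩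
  exact y.2

variable {W₀} in
theorem le_meet {W : X.Opens} (h : W ≤ W₀) : W ≤ meet W₀ W := fun y hy ↦ ⟨⟨y, h hy⟩, hy, rfl⟩

theorem meet_mono {V W : X.Opens} (h : W ≤ V) : meet W₀ W ≤ meet W₀ V := by
  rintro _ ⟨y, hy, rfl⟩
  exact ⟨y, h hy, rfl⟩

/-- The pushforward of the restriction of a sheaf of modules to an open subset. -/
abbrev pushRestrict (M : X.Modules) : X.Modules :=
  (Scheme.Modules.pushforward W₀.ι).obj (M.restrict W₀.ι)

variable {M : X.Modules}

/-- Sections of the pushforward of the restriction to an open subset. -/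
def toPushRestrict (W : X.Opens) : Γ(M, meet W₀ W) →+ Γ(pushRestrict W₀ M, W) :=
  AddMonoidHom.id _

theorem toPushRestrict_bijective (W : X.Opens) :
    Function.Bijective (toPushRestrict W₀ (M := M) W) := Function.bijective_id

theorem toPushRestrict_smul (W : X.Opens) (a : Γ(X, W)) (y : Γ(M, meet W₀ W)) :
    toPushRestrict W₀ W (resO X (meet_le_right W₀ W) a • y) = a • toPushRestrict W₀ W y := by
  have h₁ : resO X (meet_le_right W₀ W) a =
      (W₀.ι.appIso (W₀.ι ⁻¹ᵁ W)).inv (W₀.ι.app W a) := by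
    have := ConcreteCategory.congr_hom (Scheme.Hom.app_appIso_inv W₀.ι W) a
    exact this.symm
  rw [h₁]
  rfl

theorem toPushRestrict_res {V W : X.Opens} (h : W ≤ V) (y : Γ(M, meet W₀ V)) :
    toPushRestrict W₀ W (res M (meet_mono W₀ h) y) =
      res (pushRestrict W₀ M) h (toPushRestrict W₀ V y) := rfl

variable (X) in
/-- Functions as sections of the structure sheaf, seen as a sheaf of modules. -/
def toStructure (W : X.Opens) : Γ(X, W) →+ Γ(structureModule X, W) := AddMonoidHom.id _

theorem toStructure_smul (W : X.Opens) (a x : Γ(X, W)) :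
    toStructure X W (a * x) = a • toStructure X W x := rfl

end PushRestrict

section Free

variable {U S' S : Scheme.{u}} (q : U ⟶ S') {π : S' ⟶ S} {S₀ : S.Opens} (χ : TraceChart π S₀)

theorem resO_app {X Y : Scheme.{u}} (f : X ⟶ Y) {V W : Y.Opens} (h : W ≤ V) (a : Γ(Y, V)) :
    resO X (preimage_le f h) (f.app V a) = f.app W (resO Y h a) :=
  resPre_app f h a

theorem homSectionsRes_smul {V W : S.Opens} (h : W ≤ V) (a : Γ(S', π ⁻¹ᵁ V))
    (φ : homSections π V) : homSectionsRes h (a • φ) = resPre π h a • homSectionsRes h φ := by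
  ext T z
  exact congrArg (fun y ↦ φ.1 ⟨T.1, T.2.trans h⟩ (y * z)) (resPre_resPre h T.2 a).symm

/-- The open subset of `U` over which a trace chart is defined. -/
abbrev TraceChart.domain (_ : TraceChart π S₀) : U.Opens := q ⁻¹ᵁ π ⁻¹ᵁ S₀

theorem meet_le_domain (V : S.Opens) :
    meet (χ.domain q) (q ⁻¹ᵁ π ⁻¹ᵁ V) ≤ q ⁻¹ᵁ π ⁻¹ᵁ (V ⊓ S₀) := fun _ hy ↦
  ⟨meet_le_right (χ.domain q) _ hy, meet_le_left (χ.domain q) _ hy⟩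

/-- The coefficient of a homomorphism as a function on `U`. -/
def TraceChart.coefApp (V : S.Opens) :
    homSections π V →+ Γ(U, meet (χ.domain q) (q ⁻¹ᵁ π ⁻¹ᵁ V)) :=
  (resO U (meet_le_domain q χ V)).toAddMonoidHom.comp
    ((q.app (π ⁻¹ᵁ (V ⊓ S₀))).hom.toAddMonoidHom.comp
      ((χ.coef (W := V ⊓ S₀) inf_le_right).comp (homSectionsRes inf_le_left)))

theorem TraceChart.coefApp_apply (V : S.Opens) (φ : homSections π V) :
    χ.coefApp q V φ = resO U (meet_le_domain q χ V)
      (q.app (π ⁻¹ᵁ (V ⊓ S₀)) (χ.coef inf_le_right (homSectionsRes inf_le_left φ))) := rfl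

theorem TraceChart.coefApp_smul (V : S.Opens) (a : Γ(S', π ⁻¹ᵁ V)) (φ : homSections π V) :
    χ.coefApp q V (a • φ) = resO U (meet_le_right (χ.domain q) _) (q.app (π ⁻¹ᵁ V) a) *
      χ.coefApp q V φ := by
  have h₁ : homSectionsRes (inf_le_left : V ⊓ S₀ ≤ V) (a • φ) =
      resPre π inf_le_left a • homSectionsRes inf_le_left φ :=
    homSectionsRes_smul inf_le_left a φ
  have h₂ : q.app (π ⁻¹ᵁ (V ⊓ S₀)) (resPre π inf_le_left a) =
      resO U (preimage_le q (preimage_le π inf_le_left)) (q.app (π ⁻¹ᵁ V) a) :=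
    (resO_app q (preimage_le π inf_le_left) a).symm
  rw [coefApp_apply, coefApp_apply, h₁, χ.coef_smul, map_mul, map_mul, h₂, resO_resO]

theorem TraceChart.coefApp_res {V W : S.Opens} (h : W ≤ V) (φ : homSections π V) :
    χ.coefApp q W (homSectionsRes h φ) =
      resO U (meet_mono (χ.domain q) (preimage_le q (preimage_le π h))) (χ.coefApp q V φ) := by
  have h₁ : χ.coef (W := W ⊓ S₀) inf_le_right (homSectionsRes inf_le_left (homSectionsRes h φ)) =
      resPre π (inf_le_inf_right S₀ h) (χ.coef inf_le_right (homSectionsRes inf_le_left φ)) :=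
    χ.coef_res inf_le_right (inf_le_inf_right S₀ h) (homSectionsRes inf_le_left φ)
  have h₂ : q.app (π ⁻¹ᵁ (W ⊓ S₀)) (resPre π (inf_le_inf_right S₀ h)
      (χ.coef inf_le_right (homSectionsRes inf_le_left φ))) =
      resO U (preimage_le q (preimage_le π (inf_le_inf_right S₀ h)))
        (q.app (π ⁻¹ᵁ (V ⊓ S₀)) (χ.coef inf_le_right (homSectionsRes inf_le_left φ))) :=
    (resO_app q (preimage_le π (inf_le_inf_right S₀ h)) _).symm
  rw [coefApp_apply, coefApp_apply, h₁, h₂, resO_resO, resO_resO]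

/-- The generator of the pullback of the dualizing sheaf. -/
def TraceChart.generator : Γ(pullDualizing q π, χ.domain q) := dualUnit q π S₀ χ.trace

theorem TraceChart.coefApp_trace : χ.coefApp q S₀ χ.trace = 1 := by
  rw [coefApp_apply, χ.coef_trace, map_one, map_one]

theorem TraceChart.coefApp_smul_generator (V : S.Opens) (φ : homSections π V) :
    χ.coefApp q V φ • res (pullDualizing q π) (meet_le_left (χ.domain q) _) (χ.generator q) =
      res (pullDualizing q π) (meet_le_right (χ.domain q) _) (dualUnit q π V φ) := by
  have h₁ := dualUnit_res q π (inf_le_left : V ⊓ S₀ ≤ V) φ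
  rw [← χ.coef_smul_trace inf_le_right (homSectionsRes inf_le_left φ), dualUnit_smul,
    dualUnit_res] at h₁
  have h₂ := congrArg (res (pullDualizing q π) (meet_le_domain q χ V)) h₁
  rw [res_smul, res_res, res_res] at h₂
  exact h₂

/-- The morphism which sends a section of the pullback of the dualizing sheaf to its coefficient. -/
theorem TraceChart.exists_coefficient :
    ∃ m : pullDualizing q π ⟶ pushRestrict (χ.domain q) (structureModule U), ∀ V φ,
      m.app (q ⁻¹ᵁ π ⁻¹ᵁ V) (dualUnit q π V φ) =
        toPushRestrict (χ.domain q) (q ⁻¹ᵁ π ⁻¹ᵁ V) (toStructure U _ (χ.coefApp q V φ)) :=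
  -- A morphism out of the pullback has to be given on all of `U`, while coefficients make sense
  -- only over the domain of the chart; hence the target is the pushforward of the restricted
  -- structure sheaf.
  exists_pullDualizing_hom
    (fun V ↦ (toPushRestrict (χ.domain q) (q ⁻¹ᵁ π ⁻¹ᵁ V)).comp
      ((toStructure U _).comp (χ.coefApp q V)))
    (fun V a φ ↦ by
      refine Eq.trans ?_ (toPushRestrict_smul (χ.domain q) _ _ _)
      exact congrArg (fun z ↦ toPushRestrict (χ.domain q) (q ⁻¹ᵁ π ⁻¹ᵁ V) (toStructure U _ z))
        (χ.coefApp_smul q V a φ))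
    (fun {V W} h φ ↦ congrArg
      (fun z ↦ toPushRestrict (χ.domain q) (q ⁻¹ᵁ π ⁻¹ᵁ W) (toStructure U _ z))
      (χ.coefApp_res q h φ))

/-- The section of the structure sheaf underlying a section of its restriction. -/
def ofPushRestrict (W₀ W : U.Opens) :
    Γ(pushRestrict W₀ (structureModule U), W) →+ Γ(U, meet W₀ W) := AddMonoidHom.id _

theorem toPushRestrict_ofPushRestrict (W₀ W : U.Opens)
    (z : Γ(pushRestrict W₀ (structureModule U), W)) :
    toPushRestrict W₀ W (toStructure U _ (ofPushRestrict W₀ W z)) = z := rfl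

theorem ofPushRestrict_smul (W₀ W : U.Opens) (a : Γ(U, W))
    (z : Γ(pushRestrict W₀ (structureModule U), W)) :
    ofPushRestrict W₀ W (a • z) = resO U (meet_le_right W₀ W) a * ofPushRestrict W₀ W z := by
  refine (congrArg (ofPushRestrict W₀ W) ?_ : _ = ofPushRestrict W₀ W (toPushRestrict W₀ W
    (toStructure U _ (resO U (meet_le_right W₀ W) a * ofPushRestrict W₀ W z))))
  rw [toStructure_smul, toPushRestrict_smul, toPushRestrict_ofPushRestrict]

theorem ofPushRestrict_res (W₀ : U.Opens) {V W : U.Opens} (h : W ≤ V)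
    (z : Γ(pushRestrict W₀ (structureModule U), V)) :
    ofPushRestrict W₀ W (res _ h z) = resO U (meet_mono W₀ h) (ofPushRestrict W₀ V z) := rfl

/-- Multiplication of a section with a function. -/
def mulSection (W₀ : U.Opens) (M : U.Modules) (y : Γ(M, W₀)) :
    pushRestrict W₀ (structureModule U) ⟶ pushRestrict W₀ M :=
  homOfSections
    (fun W ↦
      { toFun z := toPushRestrict W₀ W
          (ofPushRestrict W₀ W z • res M (meet_le_left W₀ W) y)
        map_zero' := by rw [map_zero, zero_smul, map_zero]
        map_add' z z' := by rw [map_add, add_smul, map_add] })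
    (fun {V W} h z ↦ by
      have h₁ : ofPushRestrict W₀ W (res _ h z) • res M (meet_le_left W₀ W) y =
          res M (meet_mono W₀ h) (ofPushRestrict W₀ V z • res M (meet_le_left W₀ V) y) := by
        rw [res_smul, res_res, ofPushRestrict_res]
      exact (congrArg (toPushRestrict W₀ W) h₁).trans (toPushRestrict_res W₀ h _))
    (fun W a z ↦ by
      have h₁ : ofPushRestrict W₀ W (a • z) • res M (meet_le_left W₀ W) y =
          resO U (meet_le_right W₀ W) a • ofPushRestrict W₀ W z • res M (meet_le_left W₀ W) y := by
        rw [ofPushRestrict_smul, mul_smul]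
      exact (congrArg (toPushRestrict W₀ W) h₁).trans (toPushRestrict_smul W₀ W a _))

theorem mulSection_app (W₀ : U.Opens) (M : U.Modules) (y : Γ(M, W₀)) (W : U.Opens)
    (z : Γ(pushRestrict W₀ (structureModule U), W)) : (mulSection W₀ M y).app W z =
      toPushRestrict W₀ W (ofPushRestrict W₀ W z • res M (meet_le_left W₀ W) y) := rfl

/-- The restriction morphism. -/
def toMeet (W₀ : U.Opens) (M : U.Modules) : M ⟶ pushRestrict W₀ M :=
  homOfSections (fun W ↦ (toPushRestrict W₀ W).comp (res M (meet_le_right W₀ W)))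
    (fun {V W} h z ↦ by
      have h₁ : res M (meet_le_right W₀ W) (res M h z) =
          res M (meet_mono W₀ h) (res M (meet_le_right W₀ V) z) := by
        rw [res_res, res_res]
      exact (congrArg (toPushRestrict W₀ W) h₁).trans (toPushRestrict_res W₀ h _))
    (fun W a z ↦ (congrArg (toPushRestrict W₀ W) (res_smul (M := M) (meet_le_right W₀ W) a z)).trans
      (toPushRestrict_smul W₀ W a _))

theorem toMeet_app (W₀ : U.Opens) (M : U.Modules) (W : U.Opens) (z : Γ(M, W)) :
    (toMeet W₀ M).app W z = toPushRestrict W₀ W (res M (meet_le_right W₀ W) z) := rfl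

/-- The pullback of the dualizing sheaf is free over a trace chart. -/
theorem TraceChart.generator_bijective {W : U.Opens} (hW : W ≤ χ.domain q) :
    Function.Bijective fun a : Γ(U, W) ↦ a • res (pullDualizing q π) hW (χ.generator q) := by
  obtain ⟨m, hm⟩ := χ.exists_coefficient q
  -- Taking coefficients and multiplying the generator are mutually inverse over the domain: `h₁`
  -- gives one composite, `h₂` the other, tested on forms.
  have h₁ : ofPushRestrict (χ.domain q) _ (m.app (χ.domain q) (χ.generator q)) = 1 :=
    (congrArg (ofPushRestrict (χ.domain q) _) (hm S₀ χ.trace)).trans (χ.coefApp_trace q)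
  have h₂ : m ≫ mulSection (χ.domain q) (pullDualizing q π) (χ.generator q) =
      toMeet (χ.domain q) (pullDualizing q π) := by
    refine pullDualizing_hom_ext fun V φ ↦ ?_
    refine (congrArg ((mulSection (χ.domain q) (pullDualizing q π) (χ.generator q)).app
      (q ⁻¹ᵁ π ⁻¹ᵁ V)) (hm V φ)).trans ?_
    refine (mulSection_app _ _ _ _ _).trans (Eq.trans ?_ (toMeet_app _ _ _ _).symm)
    exact congrArg (toPushRestrict (χ.domain q) _) (χ.coefApp_smul_generator q V φ)
  constructor
  · intro a a' (h : a • _ = a' • _)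
    have h₃ := congrArg (fun z ↦ ofPushRestrict (χ.domain q) W (m.app W z)) h
    have h₄ : ofPushRestrict (χ.domain q) W
        (m.app W (res (pullDualizing q π) hW (χ.generator q))) = 1 := by
      rw [app_res, ofPushRestrict_res, h₁, map_one]
    simp only [Scheme.Modules.Hom.app_smul, ofPushRestrict_smul, h₄, mul_one] at h₃
    have h₅ := congrArg (resO U (le_meet hW)) h₃
    rwa [resO_resO, resO_resO, resO_self, resO_self] at h₅
  · intro y
    refine ⟨resO U (le_meet hW) (ofPushRestrict (χ.domain q) W (m.app W y)), ?_⟩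
    have h₃ := congrArg (fun ψ : pullDualizing q π ⟶ pushRestrict (χ.domain q) (pullDualizing q π) ↦
      ψ.app W y) h₂
    have h₄ : ofPushRestrict (χ.domain q) W (m.app W y) •
        res (pullDualizing q π) (meet_le_left (χ.domain q) W) (χ.generator q) =
        res (pullDualizing q π) (meet_le_right (χ.domain q) W) y :=
      (toPushRestrict_bijective (χ.domain q) W).1 h₃
    have h₅ := congrArg (res (pullDualizing q π) (le_meet hW)) h₄
    rwa [res_smul, res_res, res_res, res_self] at h₅

end Free

/-! ### Tensor products with a locally free sheaf of rank one -/

section SheafifyLocal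

variable {X : Scheme.{u}} (P : X.PresheafOfModules)

theorem sheafifyUnit_locally_injective {U : X.Opens} {s t : P.obj (op U)}
    (h : sheafifyUnit P U s = sheafifyUnit P U t) (x : X) (hx : x ∈ U) :
    ∃ (V : X.Opens) (hV : V ≤ U), x ∈ V ∧ P.map (homOfLE hV).op s = P.map (homOfLE hV).op t := by
  obtain ⟨V, i, hi, hxV⟩ := Presheaf.equalizerSieve_mem (Opens.grothendieckTopology X)
    (CategoryTheory.toSheafify (Opens.grothendieckTopology X) P.presheaf) (X := op U) s t h x hx
  exact ⟨V, leOfHom i, hxV, hi⟩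

theorem sheafifyUnit_locally_surjective {U : X.Opens} (y : Γ(sheafify P, U)) (x : X) (hx : x ∈ U) :
    ∃ (V : X.Opens) (hV : V ≤ U), x ∈ V ∧ ∃ s : P.obj (op V),
      sheafifyUnit P V s = res (sheafify P) hV y := by
  obtain ⟨V, i, ⟨s, hs⟩, hxV⟩ := Presheaf.imageSieve_mem (Opens.grothendieckTopology X)
    (CategoryTheory.toSheafify (Opens.grothendieckTopology X) P.presheaf) (U := op U) y x hx
  exact ⟨V, leOfHom i, hxV, s, hs⟩

end SheafifyLocal

section Tensor

variable {X : Scheme.{u}} (M N : X.Modules)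

/-- The presheaf tensor product. -/
abbrev tensorPre : X.PresheafOfModules :=
  PresheafOfModules.Monoidal.tensorObj (toPresheaf M) (toPresheaf N)

/-- Sections of the presheaf tensor product. -/
def tensorPreEquiv (U : X.Opens) : Γ(M, U) ⊗[Γ(X, U)] Γ(N, U) ≃+ (tensorPre M N).obj (op U) :=
  AddEquiv.refl _

theorem tensorPreEquiv_smul (U : X.Opens) (a : Γ(X, U)) (x : Γ(M, U) ⊗[Γ(X, U)] Γ(N, U)) :
    tensorPreEquiv M N U (a • x) =
      (show X.ringCatSheaf.obj.obj (op U) from a) • tensorPreEquiv M N U x := rfl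

theorem tensorPreEquiv_map {U V : X.Opens} (h : V ≤ U) (m : Γ(M, U)) (n : Γ(N, U)) :
    (tensorPre M N).map (homOfLE h).op (tensorPreEquiv M N U (m ⊗ₜ n)) =
      tensorPreEquiv M N V (res M h m ⊗ₜ res N h n) := rfl

/-- The tensor product of two sections. -/
def tmulSection (U : X.Opens) (n : Γ(N, U)) : Γ(M, U) →+ Γ(tensor M N, U) :=
  (sheafifyUnit (tensorPre M N) U).comp ((tensorPreEquiv M N U).toAddMonoidHom.comp
    ((TensorProduct.mk Γ(X, U) Γ(M, U) Γ(N, U)).flip n).toAddMonoidHom)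

variable {M N}

theorem tmulSection_smul (U : X.Opens) (n : Γ(N, U)) (a : Γ(X, U)) (m : Γ(M, U)) :
    tmulSection M N U n (a • m) = a • tmulSection M N U n m :=
  (congrArg (fun z ↦ sheafifyUnit (tensorPre M N) U (tensorPreEquiv M N U z))
    (TensorProduct.smul_tmul' a m n).symm).trans
      ((congrArg (sheafifyUnit (tensorPre M N) U) (tensorPreEquiv_smul M N U a _)).trans
        (sheafifyUnit_smul (tensorPre M N) U _ _))

theorem tmulSection_smul_right (U : X.Opens) (n : Γ(N, U)) (a : Γ(X, U)) (m : Γ(M, U)) :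
    tmulSection M N U (a • n) m = tmulSection M N U n (a • m) :=
  congrArg (fun z ↦ sheafifyUnit (tensorPre M N) U (tensorPreEquiv M N U z))
    (TensorProduct.smul_tmul a m n).symm

theorem tmulSection_res {U V : X.Opens} (h : V ≤ U) (n : Γ(N, U)) (m : Γ(M, U)) :
    tmulSection M N V (res N h n) (res M h m) = res (tensor M N) h (tmulSection M N U n m) :=
  (congrArg (sheafifyUnit (tensorPre M N) V) (tensorPreEquiv_map M N h m n)).symm.trans
    (sheafifyUnit_map (tensorPre M N) h _)

theorem bijective_tmul_of_free {A P Q : Type*} [CommRing A] [AddCommGroup P] [Module A P]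
    [AddCommGroup Q] [Module A Q] (y : Q) (h : Function.Bijective fun a : A ↦ a • y) :
    Function.Bijective fun p : P ↦ (p ⊗ₜ[A] y : P ⊗[A] Q) := by
  let e : A ≃ₗ[A] Q := LinearEquiv.ofBijective (LinearMap.toSpanSingleton A Q y) h
  have h₁ : (fun p : P ↦ (p ⊗ₜ[A] y : P ⊗[A] Q)) =
      ((TensorProduct.rid A P).symm ≪≫ₗ TensorProduct.congr (LinearEquiv.refl A P) e) := by
    ext p
    simp only [LinearEquiv.trans_apply, TensorProduct.rid_symm_apply, TensorProduct.congr_tmul]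
    exact congrArg (p ⊗ₜ[A] ·) (one_smul A y).symm
  rw [h₁]
  exact LinearEquiv.bijective _

/-- Tensor products with a generator of a locally free sheaf of rank one. -/
theorem tmulSection_bijective {U₀ : X.Opens} (y : Γ(N, U₀))
    (hy : ∀ {U : X.Opens} (h : U ≤ U₀), Function.Bijective fun a : Γ(X, U) ↦ a • res N h y)
    {U : X.Opens} (hU : U ≤ U₀) : Function.Bijective (tmulSection M N U (res N hU y)) := by
  -- The map `m ↦ m ⊗ y` is already bijective into the presheaf tensor product, and a presheaf
  -- agrees locally with its sheafification.
  have pre : ∀ {V : X.Opens} (hV : V ≤ U₀), Function.Bijective fun m : Γ(M, V) ↦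
      tensorPreEquiv M N V (TensorProduct.tmul Γ(X, V) m (res N hV y)) := fun {V} hV ↦
    (tensorPreEquiv M N V).bijective.comp (bijective_tmul_of_free (res N hV y) (hy hV))
  refine bijective_of_local (F := fun V ↦ Γ(M, V)) (G := fun V ↦ Γ(tensor M N, V))
    (fun {_ _} h x ↦ res M h x) (fun {_ _} h x ↦ res (tensor M N) h x)
    (fun h k x ↦ res_res h k x) (fun V s t h ↦ section_ext h)
    (fun V W hW hV s hs ↦ section_glue V W hW hV s hs) (fun V s t h ↦ section_ext h) U₀
    (fun V hV x ↦ tmulSection M N V (res N hV y) x) ?_ ?_ ?_ U hU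
  · intro V W h k x
    rw [← tmulSection_res h, res_res]
  · intro V hV s t h x hx
    obtain ⟨W, hW, hxW, e⟩ := sheafifyUnit_locally_injective (tensorPre M N) h x hx
    refine ⟨W, hW, hxW, (pre (hW.trans hV)).1 ?_⟩
    have e' : tensorPreEquiv M N W (TensorProduct.tmul Γ(X, W) (res M hW s)
        (res N hW (res N hV y))) = tensorPreEquiv M N W (TensorProduct.tmul Γ(X, W) (res M hW t)
        (res N hW (res N hV y))) := e
    rwa [res_res] at e'
  · intro V hV s x hx
    obtain ⟨W, hW, hxW, z, hz⟩ := sheafifyUnit_locally_surjective (tensorPre M N) s x hx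
    obtain ⟨m, rfl⟩ := (pre (hW.trans hV)).2 z
    exact ⟨W, hW, hxW, m, hz⟩

end Tensor

/-! ### Part: the trace morphism, its independence of choices and its bijectivity. -/

/-! ### Construction of affine charts -/

theorem exists_affine_pullback {S' S : Scheme.{u}} (π : S' ⟶ S) [IsAffineHom π]
    {A : CommRingCat.{u}} (i : Spec A ⟶ S) [IsOpenImmersion i] :
    ∃ (B : CommRingCat.{u}) (_ : Algebra A B) (i' : Spec B ⟶ S') (_ : IsOpenImmersion i'),
      IsPullback (specAlg A B) i' i π := by
  have : IsAffine (pullback i π) := isAffine_of_isAffineHom (pullback.fst i π)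
  let e := (pullback i π).isoSpec
  let φ := Spec.preimage (e.inv ≫ pullback.fst i π)
  have hφ : Spec.map φ = e.inv ≫ pullback.fst i π := Spec.map_preimage _
  let _ : Algebra A Γ(pullback i π, ⊤) := φ.hom.toAlgebra
  refine ⟨Γ(pullback i π, ⊤), inferInstance, e.inv ≫ pullback.snd i π, inferInstance, ?_⟩
  refine IsPullback.of_iso (IsPullback.of_hasPullback i π) e (Iso.refl _) (Iso.refl _)
    (Iso.refl _) ?_ ?_ ?_ ?_
  · rw [Iso.refl_hom, Category.comp_id]
    exact ((Iso.eq_inv_comp e).mp hφ).symm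
  · rw [Iso.refl_hom, Category.comp_id, Iso.hom_inv_id_assoc]
  · rw [Iso.refl_hom, Iso.refl_hom, Category.comp_id, Category.id_comp]
  · rw [Iso.refl_hom, Iso.refl_hom, Category.comp_id, Category.id_comp]

/-- The final equality says that the chart of `R ×_S S'` is the full preimage of the chart of `R`,
so sections of a pushforward over the latter are sections over the former. -/
theorem exists_weilChart {S' S R : Scheme.{u}} {π : S' ⟶ S} {r : R ⟶ S} {A B C : CommRingCat.{u}}
    [Algebra A B] [Algebra A C] {i : Spec A ⟶ S} {i' : Spec B ⟶ S'} {j : Spec C ⟶ R}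
    [IsOpenImmersion j] (hw : j ≫ r = specAlg A C ≫ i) (sq : IsPullback (specAlg A B) i' i π) :
    ∃ (g : Spec (tensorRing A B C) ⟶ pullback r π) (_ : IsOpenImmersion g),
      IsWeilChart π r i i' j g ∧ pullback.fst r π ⁻¹ᵁ j ''ᵁ ⊤ = g ''ᵁ ⊤ := by
  have h₁ : IsPullback (specAlg C (tensorRing A B C)) (specAlg B (tensorRing A B C) ≫ i')
      (j ≫ r) π := by
    rw [hw]
    exact (isPullback_specAlg A B C).paste_vert sq
  let g : Spec (tensorRing A B C) ⟶ pullback r π :=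
    pullback.lift (specAlg C (tensorRing A B C) ≫ j) (specAlg B (tensorRing A B C) ≫ i')
      (by rw [Category.assoc, h₁.w])
  have hg₁ : g ≫ pullback.fst r π = specAlg C (tensorRing A B C) ≫ j := pullback.lift_fst _ _ _
  have hg₂ : g ≫ pullback.snd r π = specAlg B (tensorRing A B C) ≫ i' := pullback.lift_snd _ _ _
  have h₂ : IsPullback (specAlg C (tensorRing A B C)) g j (pullback.fst r π) := by
    refine IsPullback.of_bot (v₂₁ := pullback.snd r π) ?_ hg₁.symm (IsPullback.of_hasPullback r π)
    rwa [hg₂]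
  have h₃ : IsOpenImmersion g := MorphismProperty.of_isPullback (P := @IsOpenImmersion) h₂ ‹_›
  exact ⟨g, h₃, ⟨hw, sq, hg₁, hg₂⟩,
    (IsOpenImmersion.image_preimage_eq_preimage_image_of_isPullback h₂ ⊤).symm⟩

/-! ### Functions and differentials on affine charts -/

section ChartFun

variable {X S : Scheme.{u}} {A C : CommRingCat.{u}} [Algebra A C]

/-- The functions on an affine chart. -/
def chartFun (j : Spec C ⟶ X) [IsOpenImmersion j] : Γ(X, j ''ᵁ ⊤) ≃+* C :=
  (j.appIso ⊤).commRingCatIsoToRingEquiv.trans (Scheme.ΓSpecIso C).commRingCatIsoToRingEquiv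

theorem algebraMap_chartFun (j : Spec C ⟶ X) [IsOpenImmersion j] (a : Γ(X, j ''ᵁ ⊤)) :
    algebraMap C Γ(Spec C, ⊤) (chartFun j a) = (j.appIso ⊤).hom a :=
  ConcreteCategory.congr_hom (Scheme.ΓSpecIso C).hom_inv_id ((j.appIso ⊤).hom a)

variable {f : X ⟶ S} {j : Spec C ⟶ X} {i : Spec A ⟶ S} [IsOpenImmersion j] [IsOpenImmersion i]

theorem image_top_le (h : j ≫ f = specAlg A C ≫ i) : j ''ᵁ ⊤ ≤ f ⁻¹ᵁ i ''ᵁ ⊤ := by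
  rintro _ ⟨y, -, rfl⟩
  exact ⟨specAlg A C y, trivial, (congrArg (fun k : Spec C ⟶ S ↦ k y) h).symm⟩

theorem chartFun_app (h : j ≫ f = specAlg A C ≫ i) (a : Γ(S, i ''ᵁ ⊤)) :
    chartFun j (resO X (image_top_le h) (f.app _ a)) = algebraMap A C (chartFun i a) := by
  apply (algebraMap_top_bijective C).1
  have h₀ : (specAlg A C).app ⊤ (algebraMap A Γ(Spec A, ⊤) (chartFun i a)) =
      algebraMap C Γ(Spec C, ⊤) (algebraMap A C (chartFun i a)) := specAlg_app_algebraMap ⊤ _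
  rw [algebraMap_chartFun, ← h₀, algebraMap_chartFun]
  have h₁ := ConcreteCategory.congr_hom (app_comp_appIso_inv j i h ⊤) ((i.appIso ⊤).hom a)
  have h₂ : (i.appIso ⊤).inv ((i.appIso ⊤).hom a) = a :=
    ConcreteCategory.congr_hom (i.appIso ⊤).hom_inv_id a
  have h₃ : (j.appIso ⊤).inv ((specAlg A C).app ⊤ ((i.appIso ⊤).hom a)) =
      f.appLE (i ''ᵁ ⊤) (j ''ᵁ ⊤) (image_top_le h) a :=
    h₁.trans (congrArg (f.appLE (i ''ᵁ ⊤) (j ''ᵁ ⊤) (image_top_le h)) h₂)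
  exact (congrArg (j.appIso ⊤).hom h₃).symm.trans
    (ConcreteCategory.congr_hom (j.appIso ⊤).inv_hom_id _)

/-- The identification of the Kähler differentials of affine schemes. -/
def kaehlerSpecIso (A C : CommRingCat.{u}) [Algebra A C] :
    kaehler (specAlg A C) ≅ omegaTilde A C := (exists_kaehlerSpecIso A C).choose

theorem kaehlerSpecIso_d (c : C) :
    (kaehlerSpecIso A C).hom.app ⊤ ((kaehlerD (specAlg A C)).d ⊤ (algebraMap C _ c)) =
        omegaTop A C (KaehlerDifferential.D A C c) :=
  (exists_kaehlerSpecIso A C).choose_spec c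

/-- Differentials on an affine chart, as sections of the associated sheaf. -/
def chartOmegaHom (h : j ≫ f = specAlg A C ≫ i) : (kaehler f).restrict j ⟶ omegaTilde A C :=
  (kaehlerRestrictIso f (specAlg A C) j i h).hom ≫ (kaehlerSpecIso A C).hom

theorem chartOmegaHom_app_bijective (h : j ≫ f = specAlg A C ≫ i) :
    Function.Bijective ((chartOmegaHom h).app ⊤) := by
  have : IsIso (chartOmegaHom h) := by
    unfold chartOmegaHom
    infer_instance
  exact ConcreteCategory.bijective_of_isIso _

/-- The sections of the Kähler differentials on an affine chart. -/
def chartOmega (h : j ≫ f = specAlg A C ≫ i) : Γ(kaehler f, j ''ᵁ ⊤) ≃+ Ω[C⁄A] :=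
  (AddEquiv.ofBijective (((chartOmegaHom h).app ⊤).hom : Γ(kaehler f, j ''ᵁ ⊤) →+ _)
    (chartOmegaHom_app_bijective h)).trans
      (AddEquiv.ofBijective (omegaTop A C) (omegaTop_bijective A C)).symm

theorem omegaTop_chartOmega (h : j ≫ f = specAlg A C ≫ i) (m : Γ(kaehler f, j ''ᵁ ⊤)) :
    omegaTop A C (chartOmega h m) = (chartOmegaHom h).app ⊤ m :=
  (AddEquiv.ofBijective (omegaTop A C) (omegaTop_bijective A C)).apply_symm_apply _

theorem chartOmega_d (h : j ≫ f = specAlg A C ≫ i) (a : Γ(X, j ''ᵁ ⊤)) :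
    chartOmega h ((kaehlerD f).d _ a) = KaehlerDifferential.D A C (chartFun j a) := by
  apply (omegaTop_bijective A C).1
  rw [omegaTop_chartOmega, ← kaehlerSpecIso_d, algebraMap_chartFun]
  exact congrArg ((kaehlerSpecIso A C).hom.app ⊤)
    (restrict_homEquiv_symm_kaehlerMap_d f (specAlg A C) j i h ⊤ a)

theorem chartOmega_smul (h : j ≫ f = specAlg A C ≫ i) (a : Γ(X, j ''ᵁ ⊤))
    (m : Γ(kaehler f, j ''ᵁ ⊤)) : chartOmega h (a • m) = chartFun j a • chartOmega h m := by
  apply (omegaTop_bijective A C).1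
  rw [omegaTop_chartOmega, map_smul, omegaTop_chartOmega, ← algebraMap_smul_section,
    algebraMap_chartFun]
  refine Eq.trans ?_ ((chartOmegaHom h).app_smul ((j.appIso ⊤).hom a) m)
  have h₁ : (j.appIso ⊤).inv ((j.appIso ⊤).hom a) = a :=
    ConcreteCategory.congr_hom (j.appIso ⊤).hom_inv_id a
  exact congrArg (fun z : Γ(X, j ''ᵁ ⊤) ↦ (chartOmegaHom h).app ⊤ (z • m)) h₁.symm

/-- Over an affine chart the sections of the sheafified differentials are those of `Ω[C⁄A]`, hence
sums of terms `a • d b`. -/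
theorem chartOmega_hom_ext {M : Type*} [AddCommGroup M] (h : j ≫ f = specAlg A C ≫ i)
    {α β : Γ(kaehler f, j ''ᵁ ⊤) →+ M}
    (H : ∀ a b : Γ(X, j ''ᵁ ⊤), α (a • (kaehlerD f).d (j ''ᵁ ⊤) b) =
      β (a • (kaehlerD f).d (j ''ᵁ ⊤) b)) : α = β := by
  have key : ∀ (ω : Ω[C⁄A]) (c : C),
      α ((chartOmega h).symm (c • ω)) = β ((chartOmega h).symm (c • ω)) := by
    intro ω
    have hω : ω ∈ Submodule.span C (Set.range (KaehlerDifferential.D A C)) := by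
      rw [KaehlerDifferential.span_range_derivation]
      trivial
    induction hω using Submodule.span_induction with
    | mem ω hω =>
      obtain ⟨b, rfl⟩ := hω
      intro c
      obtain ⟨a, rfl⟩ := (chartFun j).surjective c
      obtain ⟨b, rfl⟩ := (chartFun j).surjective b
      rw [← chartOmega_d h, ← chartOmega_smul, AddEquiv.symm_apply_apply]
      exact H a b
    | zero => intro c; rw [smul_zero, map_zero, map_zero, map_zero]
    | add x y _ _ hx hy => intro c; rw [smul_add, map_add, map_add, map_add, hx, hy]
    | smul a x _ hx => intro c; rw [smul_smul]; exact hx _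
  ext m
  obtain ⟨ω, rfl⟩ := (chartOmega h).symm.surjective m
  rw [← one_smul C ω]
  exact key ω 1

end ChartFun

/-! ### Expansion of differentials along a dual basis -/

section DualBasis

variable {A B C D : Type*} [CommRing A] [CommRing B] [CommRing C] [CommRing D] [Algebra A B]
  [Algebra A C] [Algebra A D] [Algebra B D] [Algebra C D] [IsScalarTower A C D]
  [IsScalarTower A B D] {tr : D →ₗ[C] C}

theorem trace_smul_map {t : Ω[D⁄B] →+ Ω[C⁄A]}
    (ht : ∀ (y : D) (x : C), t (y • KaehlerDifferential.D B D (algebraMap C D x)) =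
      tr y • KaehlerDifferential.D A C x) (y : D) (x : Ω[C⁄A]) :
    t (y • KaehlerDifferential.map A B C D x) = tr y • x := by
  have hx : x ∈ Submodule.span C (Set.range (KaehlerDifferential.D A C)) := by
    rw [KaehlerDifferential.span_range_derivation]
    trivial
  induction hx using Submodule.span_induction generalizing y with
  | mem x hx =>
    obtain ⟨c, rfl⟩ := hx
    rw [KaehlerDifferential.map_D]
    exact ht y c
  | zero => rw [map_zero, smul_zero, map_zero, smul_zero]
  | add x x' _ _ hx hx' => rw [map_add, smul_add, map_add, hx, hx', smul_add]
  | smul a x _ hx =>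
    have h₁ : KaehlerDifferential.map A B C D (a • x) =
        algebraMap C D a • KaehlerDifferential.map A B C D x :=
      ((KaehlerDifferential.map A B C D).map_smul a x).trans (algebraMap_smul D a _).symm
    rw [h₁, smul_smul, hx, mul_comm, ← Algebra.smul_def, map_smul, smul_eq_mul, mul_comm, mul_smul]

/-- Base change makes `Ω[D⁄B]` equal to `D ⊗ Ω[C⁄A]`, and the `c_i` form a basis of `D`. Coordinates
are read off by the dual family: the inverse is `ω ↦ (t (b_i ω))_i`. -/
theorem bijective_sum_smul_map {n : ℕ} {b c : Fin n → D} (hF : IsFrobeniusSystem tr b c)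
    (dual : ∀ i j, tr (b i * c j) = if i = j then 1 else 0)
    (span : Submodule.span D
      (Set.range fun x : C ↦ KaehlerDifferential.D B D (algebraMap C D x)) = ⊤)
    {t : Ω[D⁄B] →+ Ω[C⁄A]}
    (ht : ∀ (y : D) (x : C), t (y • KaehlerDifferential.D B D (algebraMap C D x)) =
      tr y • KaehlerDifferential.D A C x) :
    Function.Bijective fun x : Fin n → Ω[C⁄A] ↦
      ∑ i, c i • KaehlerDifferential.map A B C D (x i) := by
  constructor
  · intro x x' (h : ∑ i, _ = ∑ i, _)
    have key : ∀ (x : Fin n → Ω[C⁄A]) j,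
        t (b j • ∑ i, c i • KaehlerDifferential.map A B C D (x i)) = x j := by
      intro x j
      rw [Finset.smul_sum, map_sum]
      simp only [smul_smul, trace_smul_map ht, dual, ite_smul, one_smul, zero_smul]
      simp
    funext j
    rw [← key x, ← key x', h]
  · intro ω
    refine ⟨fun i ↦ t (b i • ω), ?_⟩
    have hω : ω ∈ Submodule.span D
        (Set.range fun x : C ↦ KaehlerDifferential.D B D (algebraMap C D x)) := by
      rw [span]
      trivial
    change ∑ i, c i • KaehlerDifferential.map A B C D (t (b i • ω)) = ω
    -- The scalar step of the span induction multiplies `ω` by an element of `D`, which the general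
    -- factor `y` absorbs.
    suffices H : ∀ y : D, ∑ i, c i • KaehlerDifferential.map A B C D (t (b i • y • ω)) = y • ω by
      simpa using H 1
    induction hω using Submodule.span_induction with
    | mem ω hω =>
      obtain ⟨x, rfl⟩ := hω
      intro y
      have h₁ : ∀ i, c i • KaehlerDifferential.map A B C D
          (t (b i • y • KaehlerDifferential.D B D (algebraMap C D x))) =
          (tr (y * b i) • c i) • KaehlerDifferential.D B D (algebraMap C D x) := by
        intro i
        rw [smul_smul, ht, map_smul, KaehlerDifferential.map_D, mul_comm,
          ← algebraMap_smul D (tr (y * b i)), smul_smul, mul_comm, Algebra.smul_def]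
      simp only [h₁]
      rw [← Finset.sum_smul, ← hF.eq_sum]
    | zero => simp
    | add ω ω' _ _ h h' =>
      intro y
      simp only [smul_add, map_add, Finset.sum_add_distrib]
      rw [h, h']
    | smul a ω _ h =>
      intro y
      simpa only [mul_smul] using h (y * a)

end DualBasis

/-! ### The linear form on an affine chart given by a trace chart -/

section ChartTrace

variable {S' S : Scheme.{u}} {π : S' ⟶ S} {S₀ : S.Opens} (χ : TraceChart π S₀)
  {A B : CommRingCat.{u}} [Algebra A B] {i : Spec A ⟶ S} {i' : Spec B ⟶ S'} [IsOpenImmersion i]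
  [IsOpenImmersion i'] (sq : IsPullback (specAlg A B) i' i π)

theorem preimage_image_top (sq : IsPullback (specAlg A B) i' i π) :
    i' ''ᵁ ⊤ = π ⁻¹ᵁ i ''ᵁ ⊤ :=
  IsOpenImmersion.image_preimage_eq_preimage_image_of_isPullback sq ⊤

/-- The functions on the preimage of an affine chart. -/
def chartPre (sq : IsPullback (specAlg A B) i' i π) : Γ(S', π ⁻¹ᵁ i ''ᵁ ⊤) →+* B :=
  (chartFun i').toRingHom.comp (resO S' (preimage_image_top sq).le)

theorem resO_bijective_of_eq {X : Scheme.{u}} {V W : X.Opens} (h : V = W) :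
    Function.Bijective (resO X h.le) := by
  subst h
  exact ⟨fun a b h ↦ by simpa using h, fun a ↦ ⟨a, by simp⟩⟩

theorem chartPre_bijective : Function.Bijective (chartPre sq) :=
  (chartFun i').bijective.comp (resO_bijective_of_eq (preimage_image_top sq))

theorem chartPre_app (a : Γ(S, i ''ᵁ ⊤)) :
    chartPre sq (π.app _ a) = algebraMap A B (chartFun i a) :=
  chartFun_app sq.w.symm a

/-- Functions on the preimage of an affine chart, as a ring isomorphism. -/
def chartPreEquiv : Γ(S', π ⁻¹ᵁ i ''ᵁ ⊤) ≃+* B := RingEquiv.ofBijective _ (chartPre_bijective sq)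

variable (hi : i ''ᵁ ⊤ ≤ S₀)

/-- The linear form on an affine chart given by a trace chart. -/
def TraceChart.form : B →ₗ[A] A where
  toFun y := chartFun i (χ.trace.1 ⟨i ''ᵁ ⊤, hi⟩ ((chartPreEquiv sq).symm y))
  map_add' y z := by rw [map_add, map_add, map_add]
  map_smul' a y := by
    obtain ⟨a, rfl⟩ := (chartFun i).surjective a
    obtain ⟨y, rfl⟩ := (chartPreEquiv sq).surjective y
    have h₁ : chartFun i a • chartPreEquiv sq y = chartPreEquiv sq (π.app _ a * y) := by
      rw [Algebra.smul_def, map_mul]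
      exact congrArg (· * chartPreEquiv sq y) (chartPre_app sq a).symm
    rw [h₁, RingEquiv.symm_apply_apply, RingEquiv.symm_apply_apply,
      homSections_linear χ.trace ⟨i ''ᵁ ⊤, hi⟩, map_mul]
    rfl

theorem TraceChart.form_apply (y : Γ(S', π ⁻¹ᵁ i ''ᵁ ⊤)) :
    χ.form sq hi (chartPre sq y) = chartFun i (χ.trace.1 ⟨i ''ᵁ ⊤, hi⟩ y) :=
  congrArg (fun z ↦ chartFun i (χ.trace.1 ⟨i ''ᵁ ⊤, hi⟩ z))
    ((chartPreEquiv sq).symm_apply_apply y)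

/-- The restriction of a function to an affine chart. -/
def chartRes (sq : IsPullback (specAlg A B) i' i π) (hi : i ''ᵁ ⊤ ≤ S₀) :
    Γ(S', π ⁻¹ᵁ S₀) →+* B :=
  (chartPre sq).comp (resPre π hi)

theorem TraceChart.form_chartRes (s : Γ(S', π ⁻¹ᵁ S₀)) :
    χ.form sq hi (chartRes sq hi s) =
      chartFun i (resO S hi (χ.trace.1 ⟨S₀, le_rfl⟩ s)) := by
  rw [homSections_res χ.trace ⟨S₀, le_rfl⟩ ⟨i ''ᵁ ⊤, hi⟩ hi]
  exact χ.form_apply sq hi (resPre π hi s)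

theorem TraceChart.form_dual (k l : Fin χ.n) :
    χ.form sq hi (chartRes sq hi (χ.b k) * chartRes sq hi (χ.c l)) = if k = l then 1 else 0 := by
  rw [← map_mul, form_chartRes, χ.dual]
  split_ifs
  · rw [map_one, map_one]
  · rw [map_zero, map_zero]

theorem TraceChart.isFrobeniusSystem : IsFrobeniusSystem (χ.form sq hi)
    (fun k ↦ chartRes sq hi (χ.b k)) fun k ↦ chartRes sq hi (χ.c k) where
  eq_sum y := by
    obtain ⟨y, rfl⟩ := (chartPre_bijective sq).2 y
    have h₁ := congrArg (chartPre sq) (χ.eq_sum ⟨i ''ᵁ ⊤, hi⟩ y)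
    rw [map_sum] at h₁
    refine h₁.trans (Finset.sum_congr rfl fun k _ ↦ ?_)
    have h₂ : chartPre sq y * chartRes sq hi (χ.b k) = chartPre sq (y * resPre π hi (χ.b k)) :=
      (map_mul _ _ _).symm
    rw [h₂, form_apply, map_mul, chartPre_app, Algebra.smul_def]
    rfl

end ChartTrace

/-! ### Differentials of the Weil restriction and of the universal object -/

section Trace

variable {S' S X R : Scheme.{u}} {π : S' ⟶ S} {x : X ⟶ S} {r : R ⟶ S} {f : pullback r π ⟶ X}

variable (π r) in
/-- The pullback of differentials along the projection `R ×_S S' ⟶ R`. -/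
def projDiff : kaehler r ⟶ (Scheme.Modules.pushforward (pullback.fst r π)).obj
    (kaehler (pullback.snd r π)) :=
  kaehlerMap r (pullback.snd r π) (pullback.fst r π) π pullback.condition

theorem projDiff_d (V : R.Opens) (a : Γ(R, V)) : (projDiff π r).app V ((kaehlerD r).d V a) =
    (kaehlerD (pullback.snd r π)).d (pullback.fst r π ⁻¹ᵁ V) ((pullback.fst r π).app V a) :=
  kaehlerMap_d _ _ _ V a

/-- The pullback of differentials along the projection, on sections. -/
def projSection (π : S' ⟶ S) (r : R ⟶ S) (V : R.Opens) :
    Γ(kaehler r, V) →+ Γ(kaehler (pullback.snd r π), pullback.fst r π ⁻¹ᵁ V) :=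
  ((projDiff π r).app V).hom

theorem projSection_smul (V : R.Opens) (a : Γ(R, V)) (m : Γ(kaehler r, V)) :
    projSection π r V (a • m) = (pullback.fst r π).app V a • projSection π r V m :=
  (projDiff π r).app_smul a m

theorem projSection_res {V W : R.Opens} (k : W ≤ V) (m : Γ(kaehler r, V)) :
    projSection π r W (res _ k m) =
      res _ (preimage_le (pullback.fst r π) k) (projSection π r V m) :=
  app_res (projDiff π r) k m

theorem projSection_d (V : R.Opens) (a : Γ(R, V)) : projSection π r V ((kaehlerD r).d V a) =
    (kaehlerD (pullback.snd r π)).d (pullback.fst r π ⁻¹ᵁ V) ((pullback.fst r π).app V a) :=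
  projDiff_d V a

variable {S₀ : S.Opens}

theorem preimage_fst_le {V : R.Opens} (hV : V ≤ r ⁻¹ᵁ S₀) :
    pullback.fst r π ⁻¹ᵁ V ≤ pullback.snd r π ⁻¹ᵁ π ⁻¹ᵁ S₀ := fun y hy ↦ by
  have h₁ : (pullback.fst r π ≫ r) y ∈ S₀ := hV hy
  rw [pullback.condition] at h₁
  exact h₁

/-- Functions on `S'`, as functions on `R ×_S S'`. -/
def funU (π : S' ⟶ S) {r : R ⟶ S} {V : R.Opens} (hV : V ≤ r ⁻¹ᵁ S₀) :
    Γ(S', π ⁻¹ᵁ S₀) →+* Γ(pullback r π, pullback.fst r π ⁻¹ᵁ V) :=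
  (resO _ (preimage_fst_le hV)).comp ((pullback.snd r π).app (π ⁻¹ᵁ S₀)).hom

/-- Functions on `S`, as functions on `R`. -/
def funR {r : R ⟶ S} {V : R.Opens} (hV : V ≤ r ⁻¹ᵁ S₀) : Γ(S, S₀) →+* Γ(R, V) :=
  (resO _ hV).comp (r.app S₀).hom

theorem funU_res {V W : R.Opens} (hV : V ≤ r ⁻¹ᵁ S₀) (k : W ≤ V) (s : Γ(S', π ⁻¹ᵁ S₀)) :
    resO _ (preimage_le (pullback.fst r π) k) (funU π hV s) = funU π (k.trans hV) s :=
  resO_resO _ _ _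

theorem funR_res {V W : R.Opens} (hV : V ≤ r ⁻¹ᵁ S₀) (k : W ≤ V) (s : Γ(S, S₀)) :
    resO _ k (funR hV s) = funR (k.trans hV) s :=
  resO_resO _ _ _

theorem funU_app {V : R.Opens} (hV : V ≤ r ⁻¹ᵁ S₀) (a : Γ(S, S₀)) :
    funU π hV (π.app S₀ a) = (pullback.fst r π).app V (funR hV a) := by
  rw [funR, RingHom.comp_apply, ← resO_app (pullback.fst r π) hV]
  exact resO_app_congr (pullback.condition (f := r) (g := π)).symm (preimage_fst_le hV)
    (preimage_le _ hV) a

variable (χ : TraceChart π S₀)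

/-- Sums of differentials of `R` with coefficients in the dual basis. -/
def TraceChart.expand {V : R.Opens} (hV : V ≤ r ⁻¹ᵁ S₀) :
    (Fin χ.n → Γ(kaehler r, V)) →+ Γ(kaehler (pullback.snd r π), pullback.fst r π ⁻¹ᵁ V) where
  toFun m := ∑ k, funU π hV (χ.c k) • projSection π r V (m k)
  map_zero' := Finset.sum_eq_zero fun k _ ↦ by rw [Pi.zero_apply, map_zero, smul_zero]
  map_add' m m' := by
    rw [← Finset.sum_add_distrib]
    exact Finset.sum_congr rfl fun k _ ↦ by rw [Pi.add_apply, map_add, smul_add]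

theorem TraceChart.expand_apply {V : R.Opens} (hV : V ≤ r ⁻¹ᵁ S₀)
    (m : Fin χ.n → Γ(kaehler r, V)) :
    χ.expand hV m = ∑ k, funU π hV (χ.c k) • projSection π r V (m k) := rfl

theorem TraceChart.expand_res {V W : R.Opens} (hV : V ≤ r ⁻¹ᵁ S₀) (k : W ≤ V)
    (m : Fin χ.n → Γ(kaehler r, V)) :
    χ.expand (k.trans hV) (fun l ↦ res _ k (m l)) =
      res _ (preimage_le (pullback.fst r π) k) (χ.expand hV m) := by
  rw [expand_apply, expand_apply, map_sum]
  refine Finset.sum_congr rfl fun l _ ↦ ?_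
  rw [res_smul, funU_res hV k]
  exact congrArg (funU π (k.trans hV) (χ.c l) • ·) (projSection_res k (m l))

theorem TraceChart.expand_smul {V : R.Opens} (hV : V ≤ r ⁻¹ᵁ S₀) (a : Γ(R, V))
    (m : Fin χ.n → Γ(kaehler r, V)) :
    χ.expand hV (fun l ↦ a • m l) = (pullback.fst r π).app V a • χ.expand hV m := by
  rw [expand_apply, expand_apply, Finset.smul_sum]
  refine Finset.sum_congr rfl fun l _ ↦ ?_
  rw [projSection_smul, smul_smul, smul_smul, mul_comm]

/-- The trace of a sum of differentials of `R` with coefficients in the dual basis. -/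
def TraceChart.contract {V : R.Opens} (hV : V ≤ r ⁻¹ᵁ S₀) :
    (Fin χ.n → Γ(kaehler r, V)) →+ Γ(kaehler r, V) where
  toFun m := ∑ k, funR hV (χ.trace.1 ⟨S₀, le_rfl⟩ (χ.c k)) • m k
  map_zero' := Finset.sum_eq_zero fun k _ ↦ by rw [Pi.zero_apply, smul_zero]
  map_add' m m' := by
    rw [← Finset.sum_add_distrib]
    exact Finset.sum_congr rfl fun k _ ↦ by rw [Pi.add_apply, smul_add]

theorem TraceChart.contract_apply {V : R.Opens} (hV : V ≤ r ⁻¹ᵁ S₀)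
    (m : Fin χ.n → Γ(kaehler r, V)) :
    χ.contract hV m = ∑ k, funR hV (χ.trace.1 ⟨S₀, le_rfl⟩ (χ.c k)) • m k := rfl

theorem TraceChart.contract_res {V W : R.Opens} (hV : V ≤ r ⁻¹ᵁ S₀) (k : W ≤ V)
    (m : Fin χ.n → Γ(kaehler r, V)) :
    χ.contract (k.trans hV) (fun l ↦ res _ k (m l)) = res _ k (χ.contract hV m) := by
  rw [contract_apply, contract_apply, map_sum]
  refine Finset.sum_congr rfl fun l _ ↦ ?_
  rw [res_smul, funR_res]

theorem TraceChart.contract_smul {V : R.Opens} (hV : V ≤ r ⁻¹ᵁ S₀) (a : Γ(R, V))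
    (m : Fin χ.n → Γ(kaehler r, V)) :
    χ.contract hV (fun l ↦ a • m l) = a • χ.contract hV m := by
  rw [contract_apply, contract_apply, Finset.smul_sum]
  exact Finset.sum_congr rfl fun l _ ↦ smul_comm _ _ _

end Trace

section ChartExpansion

variable {A B C : CommRingCat.{u}} [Algebra A B] [Algebra A C] {S' S R : Scheme.{u}}
  {π : S' ⟶ S} {r : R ⟶ S} {i : Spec A ⟶ S} {i' : Spec B ⟶ S'}
  {j : Spec C ⟶ R} {g : Spec (tensorRing A B C) ⟶ pullback r π}

theorem TraceChart.baseTrace_dual [IsOpenImmersion i] [IsOpenImmersion i']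
    (hc : IsWeilChart π r i i' j g) {S₀ : S.Opens} (χ : TraceChart π S₀) (hi : i ''ᵁ ⊤ ≤ S₀)
    (k l : Fin χ.n) : baseTrace (χ.form hc.sq hi) C
      ((1 : C) ⊗ₜ[A] chartRes hc.sq hi (χ.b k) * (1 : C) ⊗ₜ[A] chartRes hc.sq hi (χ.c l)) =
        if k = l then 1 else 0 := by
  rw [Algebra.TensorProduct.tmul_mul_tmul, baseTrace_tmul, χ.form_dual hc.sq hi]
  split_ifs
  · rw [one_smul, one_mul]
  · rw [zero_smul]

variable [IsOpenImmersion j] [IsOpenImmersion g]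

/-- The functions on a chart of `R ×_S S'`. -/
def chartU (eV : pullback.fst r π ⁻¹ᵁ j ''ᵁ ⊤ = g ''ᵁ ⊤) :
    Γ(pullback r π, pullback.fst r π ⁻¹ᵁ j ''ᵁ ⊤) →+* C ⊗[A] B :=
  (chartFun g).toRingHom.comp (resO _ eV.ge)

theorem chartU_fst (hc : IsWeilChart π r i i' j g)
    (eV : pullback.fst r π ⁻¹ᵁ j ''ᵁ ⊤ = g ''ᵁ ⊤) (a : Γ(R, j ''ᵁ ⊤)) :
    chartU eV ((pullback.fst r π).app _ a) = algebraMap C (C ⊗[A] B) (chartFun j a) :=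
  chartFun_app hc.fst a

variable [IsOpenImmersion i']

/-- The differentials on a chart of `R ×_S S'`. -/
def chartOmegaU (hc : IsWeilChart π r i i' j g)
    (eV : pullback.fst r π ⁻¹ᵁ j ''ᵁ ⊤ = g ''ᵁ ⊤) :
    Γ(kaehler (pullback.snd r π), pullback.fst r π ⁻¹ᵁ j ''ᵁ ⊤) →+ Ω[C ⊗[A] B⁄B] :=
  (chartOmega hc.snd).toAddMonoidHom.comp (res _ eV.ge)

variable (hc : IsWeilChart π r i i' j g) (eV : pullback.fst r π ⁻¹ᵁ j ''ᵁ ⊤ = g ''ᵁ ⊤)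

theorem res_bijective_of_eq {X : Scheme.{u}} (M : X.Modules) {V W : X.Opens} (h : W = V) :
    Function.Bijective (res M h.le) := by
  subst h
  exact ⟨fun a b h ↦ by simpa using h, fun a ↦ ⟨a, by simp⟩⟩

theorem chartOmegaU_bijective : Function.Bijective (chartOmegaU hc eV) :=
  (chartOmega hc.snd).bijective.comp (res_bijective_of_eq _ eV.symm)

theorem chartOmegaU_smul (a : Γ(pullback r π, pullback.fst r π ⁻¹ᵁ j ''ᵁ ⊤))
    (m : Γ(kaehler (pullback.snd r π), pullback.fst r π ⁻¹ᵁ j ''ᵁ ⊤)) :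
    chartOmegaU hc eV (a • m) = chartU eV a • chartOmegaU hc eV m :=
  (congrArg (chartOmega hc.snd) (res_smul eV.ge a m)).trans
    (chartOmega_smul hc.snd (resO _ eV.ge a) (res _ eV.ge m))

theorem chartOmegaU_d (a : Γ(pullback r π, pullback.fst r π ⁻¹ᵁ j ''ᵁ ⊤)) :
    chartOmegaU hc eV ((kaehlerD (pullback.snd r π)).d _ a) =
      KaehlerDifferential.D B (C ⊗[A] B) (chartU eV a) :=
  (congrArg (chartOmega hc.snd) ((kaehlerD (pullback.snd r π)).map eV.ge a).symm).trans
    (chartOmega_d hc.snd (resO _ eV.ge a))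

variable [IsOpenImmersion i]

theorem chartU_funU {S₀ : S.Opens} (hi : i ''ᵁ ⊤ ≤ S₀) (hV : j ''ᵁ ⊤ ≤ r ⁻¹ᵁ S₀)
    (s : Γ(S', π ⁻¹ᵁ S₀)) : chartU eV (funU π hV s) = 1 ⊗ₜ chartRes hc.sq hi s := by
  have h₁ := chartFun_app hc.snd
    (resO S' ((preimage_image_top hc.sq).le.trans (preimage_le π hi)) s)
  refine Eq.trans (congrArg (chartFun g) ?_) (h₁.trans ?_)
  · rw [← resO_app (pullback.snd r π)]
    exact (resO_resO _ _ _).trans (resO_resO _ _ _).symm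
  · refine congrArg (fun z ↦ (1 : C) ⊗ₜ[A] chartFun i' z) ?_
    exact (resO_resO _ _ s).symm

theorem chartOmegaU_projSection (m : Γ(kaehler r, j ''ᵁ ⊤)) :
    chartOmegaU hc eV (projSection π r _ m) =
      KaehlerDifferential.map A B C (C ⊗[A] B) (chartOmega hc.w m) := by
  have h₁ : (chartOmegaU hc eV).comp (projSection π r _) =
      (KaehlerDifferential.map A B C (C ⊗[A] B)).toAddMonoidHom.comp
        (chartOmega hc.w).toAddMonoidHom := by
    refine chartOmega_hom_ext hc.w fun a b ↦ ?_
    have h₂ := (congrArg (chartOmegaU hc eV) (projSection_smul (π := π) (j ''ᵁ ⊤) a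
      ((kaehlerD r).d _ b))).trans (chartOmegaU_smul hc eV _ _)
    rw [projSection_d, chartU_fst hc eV, chartOmegaU_d, chartU_fst hc eV] at h₂
    refine h₂.trans ?_
    have h₃ : chartOmega hc.w (a • (kaehlerD r).d (j ''ᵁ ⊤) b) =
        chartFun j a • KaehlerDifferential.D A C (chartFun j b) := by
      rw [chartOmega_smul, chartOmega_d]
    refine Eq.trans ?_ (congrArg (KaehlerDifferential.map A B C (C ⊗[A] B)) h₃).symm
    rw [map_smul, KaehlerDifferential.map_D]
    exact algebraMap_smul (C ⊗[A] B) (chartFun j a) _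
  exact congrArg (fun k : _ →+ _ ↦ k m) h₁

variable {S₀ : S.Opens} (χ : TraceChart π S₀) (hi : i ''ᵁ ⊤ ≤ S₀) (hV : j ''ᵁ ⊤ ≤ r ⁻¹ᵁ S₀)

theorem TraceChart.chartOmegaU_expand (m : Fin χ.n → Γ(kaehler r, j ''ᵁ ⊤)) :
    chartOmegaU hc eV (χ.expand hV m) = ∑ k, ((1 : C) ⊗ₜ[A] chartRes hc.sq hi (χ.c k)) •
      KaehlerDifferential.map A B C (C ⊗[A] B) (chartOmega hc.w (m k)) := by
  rw [expand_apply, map_sum]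
  refine Finset.sum_congr rfl fun k _ ↦ ?_
  rw [chartOmegaU_smul, chartOmegaU_projSection, chartU_funU hc eV hi hV]

theorem TraceChart.expand_bijective_chart (hc : IsWeilChart π r i i' j g)
    (eV : pullback.fst r π ⁻¹ᵁ j ''ᵁ ⊤ = g ''ᵁ ⊤) (χ : TraceChart π S₀) (hi : i ''ᵁ ⊤ ≤ S₀)
    (hV : j ''ᵁ ⊤ ≤ r ⁻¹ᵁ S₀) : Function.Bijective (χ.expand (π := π) hV) := by
  obtain ⟨t, ht, -⟩ := exists_trace_differentials (A := A) (B := B) (C := C)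
    (baseTrace (χ.form hc.sq hi) C)
  have h₁ := bijective_sum_smul_map (A := A) ((χ.isFrobeniusSystem hc.sq hi).baseChange C)
    (χ.baseTrace_dual hc hi) span_range_D_tensorProduct ht
  have h₂ : ⇑(chartOmegaU hc eV) ∘ χ.expand hV =
      (fun z : Fin χ.n → Ω[C⁄A] ↦ ∑ k, ((1 : C) ⊗ₜ[A] chartRes hc.sq hi (χ.c k)) •
        KaehlerDifferential.map A B C (C ⊗[A] B) (z k)) ∘
          fun m k ↦ chartOmega hc.w (m k) :=
    funext fun m ↦ χ.chartOmegaU_expand hc eV hi hV m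
  have h₃ : Function.Bijective fun (m : Fin χ.n → Γ(kaehler r, j ''ᵁ ⊤)) k ↦
      chartOmega hc.w (m k) := (Equiv.piCongrRight fun _ ↦ (chartOmega hc.w).toEquiv).bijective
  have h₄ := h₁.comp h₃
  rw [← h₂] at h₄
  exact (Function.Bijective.of_comp_iff' (chartOmegaU_bijective hc eV) _).mp h₄

/-- On an affine chart the trace of `∑ c_k m_k` is `∑ tr(c_k) m_k`. This identifies the global
recipe, expansion followed by contraction, with the algebraic trace `t`. -/
theorem TraceChart.chartOmega_contract {t : Ω[C ⊗[A] B⁄B] →+ Ω[C⁄A]}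
    (ht : ∀ y z, t (y • KaehlerDifferential.D B (C ⊗[A] B) (algebraMap C (C ⊗[A] B) z)) =
        baseTrace (χ.form hc.sq hi) C y • KaehlerDifferential.D A C z)
    (m : Fin χ.n → Γ(kaehler r, j ''ᵁ ⊤)) :
    chartOmega hc.w (χ.contract hV m) = t (chartOmegaU hc eV (χ.expand hV m)) := by
  rw [χ.chartOmegaU_expand hc eV hi hV, map_sum, contract_apply, map_sum]
  refine Finset.sum_congr rfl fun k _ ↦ ?_
  have h₁ : chartFun j (funR hV (χ.trace.1 ⟨S₀, le_rfl⟩ (χ.c k))) =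
      algebraMap A C (χ.form hc.sq hi (chartRes hc.sq hi (χ.c k))) := by
    rw [χ.form_chartRes hc.sq hi, ← chartFun_app hc.w, ← resO_app r hi]
    exact congrArg (chartFun j) (resO_resO _ _ _).symm
  rw [chartOmega_smul, trace_smul_map ht, baseTrace_tmul, h₁, Algebra.smul_def, mul_one]

end ChartExpansion

/-! ### The trace morphism over a trace chart -/

theorem exists_weilChart_mem {S' S R : Scheme.{u}} (π : S' ⟶ S) [IsAffineHom π] (r : R ⟶ S)
    {S₀ : S.Opens} {V : R.Opens} (hV : V ≤ r ⁻¹ᵁ S₀) (y : R) (hy : y ∈ V) :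
    ∃ (A B C : CommRingCat.{u}) (_ : Algebra A B) (_ : Algebra A C) (i : Spec A ⟶ S)
      (i' : Spec B ⟶ S') (j : Spec C ⟶ R) (g : Spec (tensorRing A B C) ⟶ pullback r π)
      (_ : IsOpenImmersion i) (_ : IsOpenImmersion i') (_ : IsOpenImmersion j)
      (_ : IsOpenImmersion g), IsWeilChart π r i i' j g ∧
        pullback.fst r π ⁻¹ᵁ j ''ᵁ ⊤ = g ''ᵁ ⊤ ∧ i ''ᵁ ⊤ ≤ S₀ ∧ y ∈ j ''ᵁ ⊤ ∧ j ''ᵁ ⊤ ≤ V := by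
  obtain ⟨A, C, hAC, j, i, hj, hi, hy, hjV, hiS, hw⟩ := exists_affine_chart r y V hy S₀ (hV hy)
  obtain ⟨B, hAB, i', hi', sq⟩ := exists_affine_pullback π i
  obtain ⟨g, hg, hc, eV⟩ := exists_weilChart hw sq
  rw [← Scheme.Hom.image_top_eq_opensRange] at hy hjV hiS
  exact ⟨A, B, C, hAB, hAC, i, i', j, g, hi, hi', hj, hg, hc, eV, hiS, hy, hjV⟩

section Psi

variable {S' S X R : Scheme.{u}} {π : S' ⟶ S} {x : X ⟶ S} {r : R ⟶ S} {f : pullback r π ⟶ X}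
  {S₀ : S.Opens} (χ : TraceChart π S₀)

/-- The differentials of `R ×_S S'` are freely generated by the dual basis over the differentials
of `R`. -/
theorem TraceChart.expand_bijective [IsAffineHom π] {V : R.Opens} (hV : V ≤ r ⁻¹ᵁ S₀) :
    Function.Bijective (χ.expand (π := π) hV) := by
  refine bijective_of_local (F := fun V ↦ Fin χ.n → Γ(kaehler r, V))
    (G := fun V ↦ Γ((Scheme.Modules.pushforward (pullback.fst r π)).obj
      (kaehler (pullback.snd r π)), V))
    (fun {_ _} k m l ↦ res _ k (m l)) (fun {_ _} k m ↦ res _ k m)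
    (fun k k' m ↦ res_res k k' m) ?_ ?_ (fun V s t h ↦ section_ext h) (r ⁻¹ᵁ S₀)
    (fun V hV m ↦ χ.expand hV m) (fun k k' m ↦ χ.expand_res k' k m) ?_ ?_ V hV
  · intro V s t h
    funext l
    refine section_ext fun y hy ↦ ?_
    obtain ⟨W, hW, hyW, e⟩ := h y hy
    exact ⟨W, hW, hyW, congrFun e l⟩
  · intro ι V W hW hcov s hs
    have h₁ := fun l ↦ section_glue (M := kaehler r) V W hW hcov (fun i ↦ s i l)
      fun i j ↦ congrFun (hs i j) l
    choose t ht using h₁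
    exact ⟨t, fun i ↦ funext fun l ↦ ht l i⟩
  · intro V hV s t h y hy
    obtain ⟨A, B, C, _, _, i, i', j, g, _, _, _, _, hc, eV, hi, hyj, hjV⟩ :=
      exists_weilChart_mem π r hV y hy
    refine ⟨j ''ᵁ ⊤, hjV, hyj, (χ.expand_bijective_chart hc eV hi (hjV.trans hV)).1 ?_⟩
    exact (χ.expand_res hV hjV s).trans ((congrArg _ h).trans (χ.expand_res hV hjV t).symm)
  · intro V hV s y hy
    obtain ⟨A, B, C, _, _, i, i', j, g, _, _, _, _, hc, eV, hi, hyj, hjV⟩ :=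
      exists_weilChart_mem π r hV y hy
    exact ⟨j ''ᵁ ⊤, hjV, hyj, (χ.expand_bijective_chart hc eV hi (hjV.trans hV)).2 _⟩

/-- The pullback of differentials along the universal map. -/
def univDiff (h : IsWeilRestriction π x r f) :
    (Scheme.Modules.pullback f).obj (kaehler x) ⟶ kaehler (pullback.snd r π) :=
  ((Scheme.Modules.pullbackPushforwardAdjunction f).homEquiv _ _).symm
    (kaehlerMap x (pullback.snd r π) f π h.comm)

variable (π r f x) in
/-- The sheaf `f^* Ω_X ⊗ q^* ω`. -/
abbrev twistedDiff : (pullback r π).Modules :=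
  tensor ((Scheme.Modules.pullback f).obj (kaehler x)) (pullDualizing (pullback.snd r π) π)

/-- Multiplication with the generator of the dualizing sheaf. -/
def TraceChart.twist {V : R.Opens} (hV : V ≤ r ⁻¹ᵁ S₀) :
    Γ((Scheme.Modules.pullback f).obj (kaehler x), pullback.fst r π ⁻¹ᵁ V) →+
      Γ(twistedDiff π x r f, pullback.fst r π ⁻¹ᵁ V) :=
  tmulSection _ _ _ (res _ (preimage_fst_le hV) (χ.generator (pullback.snd r π)))

theorem TraceChart.twist_bijective {V : R.Opens} (hV : V ≤ r ⁻¹ᵁ S₀) :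
    Function.Bijective (χ.twist (x := x) (f := f) hV) :=
  tmulSection_bijective (χ.generator (pullback.snd r π))
    (fun h ↦ χ.generator_bijective (pullback.snd r π) h) (preimage_fst_le hV)

theorem TraceChart.twist_smul {V : R.Opens} (hV : V ≤ r ⁻¹ᵁ S₀)
    (a : Γ(pullback r π, pullback.fst r π ⁻¹ᵁ V))
    (n : Γ((Scheme.Modules.pullback f).obj (kaehler x), pullback.fst r π ⁻¹ᵁ V)) :
    χ.twist hV (a • n) = a • χ.twist hV n :=
  tmulSection_smul _ _ a n

theorem TraceChart.twist_res {V W : R.Opens} (hV : V ≤ r ⁻¹ᵁ S₀) (k : W ≤ V)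
    (n : Γ((Scheme.Modules.pullback f).obj (kaehler x), pullback.fst r π ⁻¹ᵁ V)) :
    χ.twist (k.trans hV) (res _ (preimage_le (pullback.fst r π) k) n) =
      res _ (preimage_le (pullback.fst r π) k) (χ.twist hV n) := by
  refine Eq.trans ?_ (tmulSection_res (preimage_le (pullback.fst r π) k) _ n)
  exact congrArg (fun y ↦ tmulSection ((Scheme.Modules.pullback f).obj (kaehler x))
    (pullDualizing (pullback.snd r π) π) _ y (res _ (preimage_le (pullback.fst r π) k) n))
    (res_res _ _ _).symm

/-- The relation between a section of the twisted sheaf and its trace. -/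
def TraceChart.IsTrace (h : IsWeilRestriction π x r f) {V : R.Opens} (hV : V ≤ r ⁻¹ᵁ S₀)
    (z : Γ(twistedDiff π x r f, pullback.fst r π ⁻¹ᵁ V)) (y : Γ(kaehler r, V)) : Prop :=
  ∃ n m, χ.twist hV n = z ∧ χ.expand hV m = (univDiff h).app _ n ∧ y = χ.contract hV m

variable {χ}

/-- Since `twist` and `expand` are bijective, the relation is the graph of `n ⊗ tr ↦ t (θ n)`.
Working with the graph, additivity, linearity, restriction and change of chart are shown by
exhibiting witnesses and then follow for the function by uniqueness. -/
theorem TraceChart.existsUnique_isTrace [IsAffineHom π] (h : IsWeilRestriction π x r f)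
    {V : R.Opens} (hV : V ≤ r ⁻¹ᵁ S₀) (z : Γ(twistedDiff π x r f, pullback.fst r π ⁻¹ᵁ V)) :
    ∃! y, χ.IsTrace h hV z y := by
  obtain ⟨n, hn⟩ := (χ.twist_bijective hV).2 z
  obtain ⟨m, hm⟩ := (χ.expand_bijective hV).2 ((univDiff h).app _ n)
  refine ⟨_, ⟨n, m, hn, hm, rfl⟩, ?_⟩
  rintro _ ⟨n', m', hn', hm', rfl⟩
  obtain rfl := (χ.twist_bijective hV).1 (hn.trans hn'.symm)
  obtain rfl := (χ.expand_bijective hV).1 (hm.trans hm'.symm)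
  rfl

theorem TraceChart.IsTrace.add {h : IsWeilRestriction π x r f} {V : R.Opens} {hV : V ≤ r ⁻¹ᵁ S₀}
    {z z' : Γ(twistedDiff π x r f, pullback.fst r π ⁻¹ᵁ V)} {y y' : Γ(kaehler r, V)}
    (hz : χ.IsTrace h hV z y) (hz' : χ.IsTrace h hV z' y') :
    χ.IsTrace h hV (z + z') (y + y') := by
  obtain ⟨n, m, rfl, hm, rfl⟩ := hz
  obtain ⟨n', m', rfl, hm', rfl⟩ := hz'
  exact ⟨n + n', m + m', map_add _ _ _, by rw [map_add, hm, hm', map_add], (map_add _ _ _).symm⟩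

theorem TraceChart.IsTrace.smul {h : IsWeilRestriction π x r f} {V : R.Opens} {hV : V ≤ r ⁻¹ᵁ S₀}
    {z : Γ(twistedDiff π x r f, pullback.fst r π ⁻¹ᵁ V)} {y : Γ(kaehler r, V)}
    (hz : χ.IsTrace h hV z y) (a : Γ(R, V)) :
    χ.IsTrace h hV ((pullback.fst r π).app V a • z) (a • y) := by
  obtain ⟨n, m, rfl, hm, rfl⟩ := hz
  refine ⟨(pullback.fst r π).app V a • n, fun l ↦ a • m l, χ.twist_smul hV _ n, ?_,
    (χ.contract_smul hV a m).symm⟩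
  rw [χ.expand_smul, hm, Scheme.Modules.Hom.app_smul]

theorem TraceChart.IsTrace.res {h : IsWeilRestriction π x r f} {V W : R.Opens}
    {hV : V ≤ r ⁻¹ᵁ S₀} (k : W ≤ V)
    {z : Γ(twistedDiff π x r f, pullback.fst r π ⁻¹ᵁ V)} {y : Γ(kaehler r, V)}
    (hz : χ.IsTrace h hV z y) :
    χ.IsTrace h (k.trans hV) (res _ (preimage_le (pullback.fst r π) k) z)
      (WeilDiff.res _ k y) := by
  obtain ⟨n, m, rfl, hm, rfl⟩ := hz
  refine ⟨WeilDiff.res _ (preimage_le (pullback.fst r π) k) n, fun l ↦ WeilDiff.res _ k (m l),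
    χ.twist_res hV k n, ?_, (χ.contract_res hV k m).symm⟩
  rw [χ.expand_res hV k, hm, app_res]

end Psi

/-! ### Independence of the trace chart -/

section Independence

variable {S' S X R : Scheme.{u}} {π : S' ⟶ S} {x : X ⟶ S} {r : R ⟶ S} {f : pullback r π ⟶ X}
  {S₀ : S.Opens} (χ : TraceChart π S₀)

theorem funU_resPre {W : S.Opens} (hW : W ≤ S₀) {V : R.Opens} (hV : V ≤ r ⁻¹ᵁ W)
    (s : Γ(S', π ⁻¹ᵁ S₀)) :
    funU π hV (resPre π hW s) = funU π (hV.trans (preimage_le r hW)) s := by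
  have h₁ : (pullback.snd r π).app (π ⁻¹ᵁ W) (resPre π hW s) = resO _
      (preimage_le (pullback.snd r π) (preimage_le π hW)) ((pullback.snd r π).app _ s) :=
    (resO_app (pullback.snd r π) (preimage_le π hW) s).symm
  exact (congrArg _ h₁).trans (resO_resO _ _ _)

theorem funR_resO {W : S.Opens} (hW : W ≤ S₀) {V : R.Opens} (hV : V ≤ r ⁻¹ᵁ W)
    (s : Γ(S, S₀)) : funR hV (resO S hW s) = funR (hV.trans (preimage_le r hW)) s :=
  (congrArg _ (resO_app r hW s).symm).trans (resO_resO _ _ _)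

variable {W : S.Opens} (hW : W ≤ S₀) {V : R.Opens} (hV : V ≤ r ⁻¹ᵁ W)

/-- The coefficients of a multiple of a differential of `R`. -/
def TraceChart.coords (s : Γ(S', π ⁻¹ᵁ W)) (m : Γ(kaehler r, V)) (l : Fin χ.n) :
    Γ(kaehler r, V) :=
  funR hV (χ.trace.1 ⟨W, hW⟩ (s * resPre π hW (χ.b l))) • m

/-- The coordinates of `s • m` in the family `c` are `tr(s b_l) m`. With `contract_coords` this says
that expansion followed by contraction takes `s • m` to `tr(s) m`. The section `s` is given only
over `W`, to allow for overlaps of charts. -/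
theorem TraceChart.expand_coords (s : Γ(S', π ⁻¹ᵁ W)) (m : Γ(kaehler r, V)) :
    χ.expand (hV.trans (preimage_le r hW)) (χ.coords hW hV s m) =
      funU π hV s • projSection π r V m := by
  conv_rhs => rw [χ.eq_sum ⟨W, hW⟩ s, map_sum, Finset.sum_smul]
  rw [expand_apply]
  refine Finset.sum_congr rfl fun l _ ↦ ?_
  have h₁ : funU π hV (π.app W (χ.trace.1 ⟨W, hW⟩ (s * resPre π hW (χ.b l))) *
      resPre π hW (χ.c l)) = funU π (hV.trans (preimage_le r hW)) (χ.c l) *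
        (pullback.fst r π).app V (funR hV (χ.trace.1 ⟨W, hW⟩ (s * resPre π hW (χ.b l)))) := by
    rw [map_mul (funU π hV), funU_app hV, funU_resPre hW hV, mul_comm]
  rw [coords, projSection_smul, smul_smul]
  exact congrArg (· • projSection π r V m) h₁.symm

theorem TraceChart.contract_coords (s : Γ(S', π ⁻¹ᵁ W)) (m : Γ(kaehler r, V)) :
    χ.contract (hV.trans (preimage_le r hW)) (χ.coords hW hV s m) =
      funR hV (χ.trace.1 ⟨W, hW⟩ s) • m := by
  conv_rhs => rw [χ.eq_sum ⟨W, hW⟩ s, homSections_sum, map_sum, Finset.sum_smul]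
  rw [contract_apply]
  refine Finset.sum_congr rfl fun l _ ↦ ?_
  rw [coords, smul_smul]
  refine congrArg (· • m) ?_
  rw [map_mul (funR hV), ← homSections_res χ.trace ⟨S₀, le_rfl⟩ ⟨W, hW⟩ hW, funR_resO hW hV,
    mul_comm]

/-- On the overlap the second trace is `tr (u · -)`, where `u` is its coefficient. Then `n ⊗ tr' = u
n ⊗ tr`, and the trace of `u θ(n)` for the first form is the trace of `θ(n)` for the second: the two
changes cancel. -/
theorem TraceChart.IsTrace.of_chart [IsAffineHom π] {h : IsWeilRestriction π x r f} {S₁ : S.Opens}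
    {χ : TraceChart π S₀} {χ' : TraceChart π S₁} (hV : V ≤ r ⁻¹ᵁ S₀) (hV' : V ≤ r ⁻¹ᵁ S₁)
    {z : Γ(twistedDiff π x r f, pullback.fst r π ⁻¹ᵁ V)} {y : Γ(kaehler r, V)}
    (hz : χ'.IsTrace h hV' z y) : χ.IsTrace h hV z y := by
  obtain ⟨n, m, rfl, hm, rfl⟩ := hz
  let u := χ.coef (W := S₀ ⊓ S₁) inf_le_left (homSectionsRes inf_le_right χ'.trace)
  have hu : u • homSectionsRes inf_le_left χ.trace = homSectionsRes inf_le_right χ'.trace :=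
    χ.coef_smul_trace inf_le_left (homSectionsRes inf_le_right χ'.trace)
  have hVI : V ≤ r ⁻¹ᵁ (S₀ ⊓ S₁) := le_inf hV hV'
  have h₁ := congrArg (dualUnit (pullback.snd r π) π (S₀ ⊓ S₁)) hu
  rw [dualUnit_smul, dualUnit_res, dualUnit_res] at h₁
  have h₂ := congrArg (WeilDiff.res _ (preimage_fst_le (π := π) hVI)) h₁
  rw [res_smul, res_res, res_res] at h₂
  have h₃ : χ.twist hV (funU π hVI u • n) = χ'.twist hV' n :=
    (tmulSection_smul_right _ _ _ n).symm.trans (congrArg (fun y ↦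
      tmulSection ((Scheme.Modules.pullback f).obj (kaehler x))
        (pullDualizing (pullback.snd r π) π) _ y n) h₂)
  -- The coordinates of `u θ(n) = ∑ (u c'_k) m_k` in the first chart are obtained term by term from
  -- `coords`.
  refine ⟨funU π hVI u • n,
    ∑ k, χ.coords inf_le_left hVI (u * resPre π inf_le_right (χ'.c k)) (m k), h₃, ?_, ?_⟩
  · rw [map_sum, Scheme.Modules.Hom.app_smul, ← hm, χ'.expand_apply, Finset.smul_sum]
    refine Finset.sum_congr rfl fun k _ ↦ ?_
    rw [smul_smul, ← funU_resPre (inf_le_right : S₀ ⊓ S₁ ≤ S₁) hVI, ← map_mul]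
    exact χ.expand_coords inf_le_left hVI _ _
  · rw [map_sum, χ'.contract_apply]
    refine Finset.sum_congr rfl fun k _ ↦ ?_
    refine Eq.trans ?_ (χ.contract_coords inf_le_left hVI _ _).symm
    rw [← funR_resO (inf_le_right : S₀ ⊓ S₁ ≤ S₁) hVI,
      homSections_res χ'.trace ⟨S₁, le_rfl⟩ ⟨S₀ ⊓ S₁, inf_le_right⟩ inf_le_right, mul_comm]
    have h₄ := χ.trace_mul_coef inf_le_left (homSectionsRes inf_le_right χ'.trace)
      (resPre π inf_le_right (χ'.c k))
    exact congrArg (fun z ↦ funR hVI z • m k) h₄.symm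

end Independence

/-! ### Bijectivity of the trace -/

section TraceBijective

variable {A B C : CommRingCat.{u}} [Algebra A B] [Algebra A C] {S' S X R : Scheme.{u}}
  {π : S' ⟶ S} {x : X ⟶ S} {r : R ⟶ S} {f : pullback r π ⟶ X}

theorem restrict_homEquiv_chartOmegaHom_d {U T : Scheme.{u}} {D : CommRingCat.{u}} [Algebra B D]
    {q : U ⟶ T} {g : Spec D ⟶ U} {i' : Spec B ⟶ T} [IsOpenImmersion g] [IsOpenImmersion i']
    (hg : g ≫ q = specAlg B D ≫ i') (W : U.Opens) (b : Γ(U, W)) :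
    ((Scheme.Modules.restrictAdjunction g).homEquiv _ _ (chartOmegaHom hg)).app W
      ((kaehlerD q).d W b) = (kaehlerSpecIso B D).hom.app (g ⁻¹ᵁ W)
        ((kaehlerD (specAlg B D)).d (g ⁻¹ᵁ W) (g.app W b)) := by
  have h₁ : (Scheme.Modules.restrictAdjunction g).homEquiv _ _ (chartOmegaHom hg) =
      kaehlerMap q (specAlg B D) g i' hg ≫
        (Scheme.Modules.pushforward g).map (kaehlerSpecIso B D).hom := by
    rw [chartOmegaHom, Adjunction.homEquiv_naturality_right]
    exact congrArg (· ≫ (Scheme.Modules.pushforward g).map (kaehlerSpecIso B D).hom)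
      (((Scheme.Modules.restrictAdjunction g).homEquiv _ _).apply_symm_apply _)
  rw [h₁]
  exact congrArg ((kaehlerSpecIso B D).hom.app (g ⁻¹ᵁ W)) (kaehlerMap_d _ _ hg W b)

variable {i : Spec A ⟶ S} {i' : Spec B ⟶ S'} {j : Spec C ⟶ R}
  {g : Spec (tensorRing A B C) ⟶ pullback r π}
  [IsOpenImmersion i'] [IsOpenImmersion g]

/-- The pullback of differentials along a chart of the universal map. -/
def chartUnivDiff (hc : IsWeilChart π r i i' j g) (h : IsWeilRestriction π x r f) :
    pullRes x f g ⟶ omegaTilde B (tensorRing A B C) :=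
  (Scheme.Modules.restrictFunctor g).map (univDiff h) ≫ chartOmegaHom hc.snd

/-- Unwinding the two adjunctions, the map `θ` of the chart corresponds to the derivation which
pulls a function on `X` back along `g ≫ f` and then differentiates. This is the form in which
deformation theory uses it. -/
theorem pullResDer_chartUnivDiff (hc : IsWeilChart π r i i' j g) (h : IsWeilRestriction π x r f) :
    pullResDer (chartUnivDiff hc h) = (((kaehlerD (specAlg B (tensorRing A B C))).comp
      (kaehlerSpecIso B (tensorRing A B C)).hom).along g i' hc.snd).along f π h.comm := by
  have h₁ : pullResEquiv x f g _ (chartUnivDiff hc h) =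
      kaehlerMap x (pullback.snd r π) f π h.comm ≫ (Scheme.Modules.pushforward f).map
        ((Scheme.Modules.restrictAdjunction g).homEquiv _ _ (chartOmegaHom hc.snd)) := by
    rw [pullResEquiv, Adjunction.comp_homEquiv]
    refine (congrArg ((Scheme.Modules.pullbackPushforwardAdjunction f).homEquiv _ _)
      ((Scheme.Modules.restrictAdjunction g).homEquiv_naturality_left (univDiff h)
        (chartOmegaHom hc.snd))).trans ?_
    refine ((Scheme.Modules.pullbackPushforwardAdjunction f).homEquiv_naturality_right
      (univDiff h) _).trans ?_
    exact congrArg (· ≫ _) (Equiv.apply_symm_apply _ _)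
  refine SheafDerivation.ext fun U a ↦ ?_
  refine (congrArg (fun k ↦ Scheme.Modules.Hom.app k U ((kaehlerD x).d U a)) h₁).trans ?_
  refine (congrArg (((Scheme.Modules.restrictAdjunction g).homEquiv _ _
    (chartOmegaHom hc.snd)).app (f ⁻¹ᵁ U))
      (kaehlerMap_d _ _ h.comm U a)).trans ?_
  exact restrict_homEquiv_chartOmegaHom_d hc.snd (f ⁻¹ᵁ U) (f.app U a)

variable [IsOpenImmersion i] [IsOpenImmersion j]

variable {S₀ : S.Opens} {χ : TraceChart π S₀}

/-- Up to the bijections `chartOmega`, `twist` and an equality of opens, `Ψ` is the map `t ∘ θ` of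
`IsWeilChart.bijective_trace`. -/
theorem TraceChart.bijective_of_isTrace (hc : IsWeilChart π r i i' j g)
    (eV : pullback.fst r π ⁻¹ᵁ j ''ᵁ ⊤ = g ''ᵁ ⊤) (hi : i ''ᵁ ⊤ ≤ S₀)
    (hV : j ''ᵁ ⊤ ≤ r ⁻¹ᵁ S₀) (h : IsWeilRestriction π x r f)
    {Ψ : Γ(twistedDiff π x r f, pullback.fst r π ⁻¹ᵁ j ''ᵁ ⊤) → Γ(kaehler r, j ''ᵁ ⊤)}
    (hΨ : ∀ z, χ.IsTrace h hV z (Ψ z)) : Function.Bijective Ψ := by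
  obtain ⟨t, ht, ht'⟩ := exists_trace_differentials (A := A) (B := B) (C := C)
    (baseTrace (χ.form hc.sq hi) C)
  let θ : Γ(pullRes x f g, (⊤ : (Spec (tensorRing A B C)).Opens)) →ₗ[tensorRing A B C]
      Ω[tensorRing A B C⁄B] :=
    (LinearEquiv.ofBijective (omegaTop B (tensorRing A B C))
      (omegaTop_bijective _ _)).symm.toLinearMap.comp (topHom (chartUnivDiff hc h))
  have hθ : ∀ n, (chartUnivDiff hc h).app ⊤ n = omegaTop B (tensorRing A B C) (θ n) := fun n ↦
    ((LinearEquiv.ofBijective (omegaTop B (tensorRing A B C))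
      (omegaTop_bijective _ _)).apply_symm_apply _).symm
  have h₁ := hc.bijective_trace (χ.isFrobeniusSystem hc.sq hi) h (fun z ↦ kaehlerSpecIso_d z)
    (pullResDer_chartUnivDiff hc h) hθ ht ht'
  have h₂ : ∀ n, chartOmega hc.w (Ψ (χ.twist hV n)) = t (θ (res _ eV.ge n)) := by
    intro n
    obtain ⟨n', m, hn, hm, hy⟩ := hΨ (χ.twist hV n)
    obtain rfl := (χ.twist_bijective hV).1 hn
    rw [hy, χ.chartOmega_contract hc eV hi hV ht, hm]
    refine congrArg t ((omegaTop_bijective B (tensorRing A B C)).1 ?_)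
    refine Eq.trans ?_ (hθ _)
    refine (omegaTop_chartOmega hc.snd _).trans ?_
    exact congrArg ((chartOmegaHom hc.snd).app ⊤) (app_res (univDiff h) eV.ge n').symm
  have h₃ : ⇑(chartOmega hc.w) ∘ Ψ ∘ χ.twist hV =
      (fun n ↦ t (θ n)) ∘ res ((Scheme.Modules.pullback f).obj (kaehler x)) eV.ge := funext h₂
  have h₄ : Function.Bijective (⇑(chartOmega hc.w) ∘ Ψ ∘ χ.twist hV) := by
    rw [h₃]
    exact h₁.comp (res_bijective_of_eq _ eV.symm)
  exact (Function.Bijective.of_comp_iff _ (χ.twist_bijective hV)).mp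
    ((Function.Bijective.of_comp_iff' (chartOmega hc.w).bijective _).mp h₄)

end TraceBijective

/-! ### The differentials of the Weil restriction -/

theorem nonempty_iso_of_bijective {X : Scheme.{u}} {M N : X.Modules} (φ : M ⟶ N)
    (h : ∀ U, Function.Bijective (φ.app U)) : Nonempty (M ≅ N) := by
  let e : ∀ U, Γ(M, U) ≃+ Γ(N, U) := fun U ↦
    AddEquiv.ofBijective ((φ.app U).hom : Γ(M, U) →+ Γ(N, U)) (h U)
  have he : ∀ U y, φ.app U ((e U).symm y) = y := fun U y ↦ (e U).apply_symm_apply y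
  have nat : ∀ {U V : X.Opens} (k : V ≤ U) (y : Γ(N, U)),
      (e V).symm (res N k y) = res M k ((e U).symm y) := fun {U V} k y ↦ by
    apply (h V).1
    rw [he, app_res, he]
  have smul : ∀ U (a : Γ(X, U)) (y : Γ(N, U)), (e U).symm (a • y) = a • (e U).symm y :=
    fun U a y ↦ by
    apply (h U).1
    rw [he, Scheme.Modules.Hom.app_smul, he]
  refine ⟨⟨φ, homOfSections (fun U ↦ (e U).symm.toAddMonoidHom) nat smul, ?_, ?_⟩⟩
  · ext U y
    exact (e U).symm_apply_apply y
  · ext U y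
    exact he U y

/-- The differentials of a Weil restriction along an affine morphism whose dualizing sheaf is
locally generated by a trace. -/
theorem IsWeilRestriction.nonempty_iso {S' S X R : Scheme.{u}} {π : S' ⟶ S} [IsAffineHom π]
    {x : X ⟶ S} {r : R ⟶ S} {f : pullback r π ⟶ X} (h : IsWeilRestriction π x r f)
    (hπ : ∀ s : S, ∃ S₀ : S.Opens, s ∈ S₀ ∧ Nonempty (TraceChart π S₀)) :
    Nonempty (kaehler r ≅ (Scheme.Modules.pushforward (pullback.fst r π)).obj
      (twistedDiff π x r f)) := by
  -- Opens lying over the domain of some trace chart form a basis. The trace is defined on them with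
  -- an arbitrarily chosen chart, and independence of the chart gives compatibility with
  -- restriction.
  let ι : Type u := {V : R.Opens // ∃ S₀ : S.Opens, V ≤ r ⁻¹ᵁ S₀ ∧ Nonempty (TraceChart π S₀)}
  choose S₀ hV hχ using fun V : ι ↦ V.2
  let χ : ∀ V : ι, TraceChart π (S₀ V) := fun V ↦ (hχ V).some
  have hB : ∀ y (V : R.Opens), y ∈ V → ∃ W : ι, y ∈ W.1 ∧ W.1 ≤ V := by
    intro y V hy
    obtain ⟨T, hT, hT'⟩ := hπ (r y)
    exact ⟨⟨V ⊓ r ⁻¹ᵁ T, T, inf_le_right, hT'⟩, ⟨hy, hT⟩, inf_le_left⟩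
  choose Ψ hΨ hΨ' using fun (V : ι) (z : Γ(twistedDiff π x r f, pullback.fst r π ⁻¹ᵁ V.1)) ↦
    (χ V).existsUnique_isTrace h (hV V) z
  let α : ∀ V : ι, Γ(twistedDiff π x r f, pullback.fst r π ⁻¹ᵁ V.1) →+ Γ(kaehler r, V.1) :=
    fun V ↦ AddMonoidHom.mk' (Ψ V) fun z z' ↦ (hΨ' V _ _ ((hΨ V z).add (hΨ V z'))).symm
  have nat : ∀ (V W : ι) (k : W.1 ≤ V.1) z,
      α W (res _ (preimage_le (pullback.fst r π) k) z) = res _ k (α V z) := fun V W k z ↦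
    (hΨ' W _ _ (((hΨ V z).res k).of_chart (hV W) (k.trans (hV V)))).symm
  obtain ⟨β, hβ⟩ := exists_extension ((Scheme.Modules.pushforward (pullback.fst r π)).obj
    (twistedDiff π x r f)).presheaf (kaehler r).presheaf (kaehler r).isSheaf
    (fun V : ι ↦ V.1) (Opens.isBasis_iff_nbhd.mpr fun {V y} hy ↦
      let ⟨W, hW, hW'⟩ := hB y V hy
      ⟨W.1, ⟨W, rfl⟩, hW, hW'⟩) α nat
  let γ : ∀ V, Γ((Scheme.Modules.pushforward (pullback.fst r π)).obj (twistedDiff π x r f), V) →+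
    Γ(kaehler r, V) := fun V ↦ (β.app (op V)).hom
  have γ_res : ∀ {U V : R.Opens} (k : V ≤ U) z, γ V (res _ k z) = res _ k (γ U z) :=
    fun k z ↦ ConcreteCategory.congr_hom (β.naturality (homOfLE k).op) z
  have γ_trace : ∀ (V : ι) z, (χ V).IsTrace h (hV V) z (γ V.1 z) := fun V z ↦ by
    have h₁ : γ V.1 z = Ψ V z := hβ V z
    rw [h₁]
    exact hΨ V z
  have γ_smul : ∀ U (a : Γ(R, U)) z, γ U (a • z) = a • γ U z := fun U a z ↦ by
    refine section_ext fun y hy ↦ ?_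
    obtain ⟨W, hyW, hW⟩ := hB y U hy
    refine ⟨W.1, hW, hyW, ?_⟩
    rw [← γ_res, res_smul, res_smul, ← γ_res]
    exact ((χ W).existsUnique_isTrace h (hV W) _).unique (γ_trace W _) ((γ_trace W _).smul _)
  have key : ∀ V : R.Opens, ∀ y ∈ V, ∃ (W : R.Opens) (_ : W ≤ V), y ∈ W ∧
      Function.Bijective (γ W) := by
    intro V y hy
    obtain ⟨U, hyU, hU⟩ := hB y V hy
    obtain ⟨A, B, C, _, _, i, i', j, g, _, _, _, _, hc, eV, hi, hyj, hjV⟩ :=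
      exists_weilChart_mem π r (hV U) y hyU
    refine ⟨j ''ᵁ ⊤, hjV.trans hU, hyj, ?_⟩
    -- The affine open belongs to the basis with a chosen chart that may differ from that of `U`;
    -- `of_chart` passes from one to the other.
    let W : ι := ⟨j ''ᵁ ⊤, S₀ U, hjV.trans (hV U), hχ U⟩
    exact TraceChart.bijective_of_isTrace hc eV hi (hjV.trans (hV U)) h (χ := χ U)
      fun z ↦ (γ_trace W z).of_chart (hjV.trans (hV U)) (hV W)
  obtain ⟨e⟩ := nonempty_iso_of_bijective (homOfSections γ γ_res γ_smul) fun U ↦ by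
    refine bijective_of_local (F := fun V ↦ Γ((Scheme.Modules.pushforward
      (pullback.fst r π)).obj (twistedDiff π x r f), V)) (G := fun V ↦ Γ(kaehler r, V))
      (fun {_ _} k ↦ res _ k) (fun {_ _} k ↦ res _ k) (fun k k' m ↦ res_res k k' m)
      (fun V s t h ↦ section_ext h) (fun V W hW hcov s hs ↦ section_glue V W hW hcov s hs)
      (fun V s t h ↦ section_ext h) ⊤ (fun V _ ↦ γ V) (fun k _ z ↦ γ_res k z) ?_ ?_ U le_top
    · intro V _ s t e y hy
      obtain ⟨W, hW, hyW, hb⟩ := key V y hy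
      refine ⟨W, hW, hyW, hb.1 ?_⟩
      rw [γ_res, e, γ_res]
    · intro V _ s y hy
      obtain ⟨W, hW, hyW, hb⟩ := key V y hy
      exact ⟨W, hW, hyW, hb.2 _⟩
  exact ⟨e.symm⟩

/-! ### Part: Gorenstein morphisms have local trace forms with dual bases. -/

/-! ### Existence of trace charts -/

section SpecTrace

variable {A B : CommRingCat.{u}} [Algebra A B]

theorem algSheafTop_bijective : Function.Bijective (algSheafTop A B) := algebraMap_top_bijective B

theorem algSheaf_hom_ext {M : (Spec A).Modules} {φ ψ : algSheaf A B ⟶ M}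
    (h : ∀ y : B, φ.app ⊤ (algebraMap B Γ(Spec B, ⊤) y) = ψ.app ⊤ (algebraMap B Γ(Spec B, ⊤) y)) :
    φ = ψ := by
  refine (existsUnique_hom_of_isQuasicoherent (algSheaf A B) isQuasicoherent_algSheaf
    (topHom φ)).unique (fun n ↦ rfl) fun n ↦ ?_
  obtain ⟨y, rfl⟩ := algSheafTop_bijective.2 n
  exact (h y).symm

theorem exists_algSheaf_hom (l : B →ₗ[A] A) : ∃ φ : algSheaf A B ⟶ structureModule (Spec A),
    ∀ y : B, φ.app ⊤ (algebraMap B Γ(Spec B, ⊤) y) = algebraMap A Γ(Spec A, ⊤) (l y) := by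
  let k : A →ₗ[A] Γ(structureModule (Spec A), (⊤ : (Spec A).Opens)) :=
    { toFun a := algebraMap A Γ(Spec A, ⊤) a
      map_add' := map_add _
      map_smul' a y := map_mul (algebraMap A Γ(Spec A, ⊤)) a y }
  obtain ⟨φ, hφ, -⟩ := existsUnique_hom_of_isQuasicoherent (algSheaf A B) isQuasicoherent_algSheaf
    ((k.comp l).comp (LinearEquiv.ofBijective _ algSheafTop_bijective).symm.toLinearMap)
  refine ⟨φ, fun y ↦ (hφ _).trans ?_⟩
  exact congrArg (fun z ↦ algebraMap A Γ(Spec A, ⊤) (l z))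
    ((LinearEquiv.ofBijective _ algSheafTop_bijective).symm_apply_apply y)

/-- A linear form on an algebra gives a section of the dualizing sheaf. -/
theorem exists_homSections (l : B →ₗ[A] A) : ∃ φ : homSections (specAlg A B) ⊤, ∀ y : B,
    φ.1 ⟨⊤, le_rfl⟩ (algebraMap B Γ(Spec B, ⊤) y) = algebraMap A Γ(Spec A, ⊤) (l y) := by
  obtain ⟨φ, hφ⟩ := exists_algSheaf_hom l
  exact ⟨⟨fun W ↦ (φ.app W.1).hom, fun W r a ↦ φ.app_smul r a,
    fun W W' h a ↦ (app_res φ h a).symm⟩, hφ⟩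

/-- The right-hand side defines an endomorphism of the quasi-coherent sheaf `algSheaf A B`. It is
the identity on global sections by the Frobenius system, hence on every open. -/
theorem eq_sum_of_isFrobeniusSystem {l : B →ₗ[A] A} {n : ℕ} {b c : Fin n → B}
    (hF : IsFrobeniusSystem l b c) {φ : homSections (specAlg A B) ⊤}
    (hφ : ∀ y : B, φ.1 ⟨⊤, le_rfl⟩ (algebraMap B Γ(Spec B, ⊤) y) =
      algebraMap A Γ(Spec A, ⊤) (l y)) (W : (Spec A).Opens) (y : Γ(Spec B, specAlg A B ⁻¹ᵁ W)) :
    y = ∑ k, (specAlg A B).app W (φ.1 ⟨W, le_top⟩ (y * resPre (specAlg A B) le_top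
      (algebraMap B Γ(Spec B, ⊤) (b k)))) * resPre (specAlg A B) le_top
        (algebraMap B Γ(Spec B, ⊤) (c k)) := by
  let b' := fun (k : Fin n) (W : (Spec A).Opens) ↦
    resPre (specAlg A B) (le_top : W ≤ ⊤) (algebraMap B Γ(Spec B, ⊤) (b k))
  let c' := fun (k : Fin n) (W : (Spec A).Opens) ↦
    resPre (specAlg A B) (le_top : W ≤ ⊤) (algebraMap B Γ(Spec B, ⊤) (c k))
  let β : ∀ W : (Spec A).Opens, Γ(Spec B, specAlg A B ⁻¹ᵁ W) →+ Γ(Spec B, specAlg A B ⁻¹ᵁ W) :=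
    fun W ↦ ∑ k, (AddMonoidHom.mulRight (c' k W)).comp ((((specAlg A B).app W).hom :
      Γ(Spec A, W) →+ Γ(Spec B, specAlg A B ⁻¹ᵁ W)).comp ((φ.1 ⟨W, le_top⟩).comp
        (AddMonoidHom.mulRight (b' k W))))
  have hβ : ∀ W y, β W y =
      ∑ k, (specAlg A B).app W (φ.1 ⟨W, le_top⟩ (y * b' k W)) * c' k W := fun W y ↦
    AddMonoidHom.finsetSum_apply _ _ _
  have nat : ∀ {U V : (Spec A).Opens} (h : V ≤ U) (y : Γ(Spec B, specAlg A B ⁻¹ᵁ U)),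
      β V (resPre (specAlg A B) h y) = resPre (specAlg A B) h (β U y) := by
    intro U V h y
    rw [hβ, hβ, map_sum]
    refine Finset.sum_congr rfl fun k _ ↦ ?_
    rw [map_mul (resPre (specAlg A B) h), resPre_app,
      homSections_res φ ⟨U, le_top⟩ ⟨V, le_top⟩ h, map_mul (resPre (specAlg A B) h)]
    have h₁ : resPre (specAlg A B) h (b' k U) = b' k V := resPre_resPre _ _ _
    have h₂ : resPre (specAlg A B) h (c' k U) = c' k V := resPre_resPre _ _ _
    rw [h₁, h₂]
  have smul : ∀ (U : (Spec A).Opens) (a : Γ(Spec A, U)) (y : Γ(Spec B, specAlg A B ⁻¹ᵁ U)),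
      β U ((specAlg A B).app U a * y) = (specAlg A B).app U a * β U y := by
    intro U a y
    rw [hβ, hβ, Finset.mul_sum]
    refine Finset.sum_congr rfl fun k _ ↦ ?_
    rw [mul_assoc, homSections_linear φ ⟨U, le_top⟩, map_mul, mul_assoc]
  have h₁ : homOfSections (M := algSheaf A B) (N := algSheaf A B) β nat smul = 𝟙 _ := by
    refine algSheaf_hom_ext fun y ↦ ?_
    refine (hβ ⊤ _).trans ?_
    change _ = algebraMap B Γ(Spec B, ⊤) y
    conv_rhs => rw [hF.eq_sum y, map_sum]
    refine Finset.sum_congr rfl fun k _ ↦ ?_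
    have h₂ : b' k ⊤ = algebraMap B Γ(Spec B, ⊤) (b k) := resO_self _ _
    have h₃ : c' k ⊤ = algebraMap B Γ(Spec B, ⊤) (c k) := resO_self _ _
    have h₄ : φ.1 ⟨⊤, le_top⟩
        ((show Γ(Spec B, specAlg A B ⁻¹ᵁ ⊤) from algebraMap B Γ(Spec B, ⊤) y) * b' k ⊤) =
        algebraMap A Γ(Spec A, ⊤) (l (y * b k)) := by
      rw [h₂]
      exact (congrArg (φ.1 ⟨⊤, le_rfl⟩) (map_mul (algebraMap B Γ(Spec B, ⊤)) y (b k)).symm).trans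
        (hφ (y * b k))
    refine (congrArg₂ (fun u v ↦ (specAlg A B).app ⊤ u * v) h₄ h₃).trans ?_
    rw [Algebra.smul_def, map_mul (algebraMap B Γ(Spec B, ⊤))]
    exact congrArg (· * algebraMap B Γ(Spec B, ⊤) (c k)) (specAlg_app_algebraMap ⊤ _)
  have h₂ := congrArg (fun ψ : algSheaf A B ⟶ algSheaf A B ↦ ψ.app W y) h₁
  exact h₂.symm.trans (hβ W y)

theorem nonempty_traceChart_spec {l : B →ₗ[A] A} {n : ℕ} {b c : Fin n → B}
    (hF : IsFrobeniusSystem l b c) (hd : ∀ i j, l (b i * c j) = if i = j then 1 else 0) :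
    Nonempty (TraceChart (specAlg A B) ⊤) := by
  obtain ⟨φ, hφ⟩ := exists_homSections l
  refine ⟨⟨φ, n, fun k ↦ algebraMap B Γ(Spec B, ⊤) (b k),
    fun k ↦ algebraMap B Γ(Spec B, ⊤) (c k), fun i j ↦ ?_,
    fun W y ↦ eq_sum_of_isFrobeniusSystem hF hφ W.1 y⟩⟩
  refine (congrArg (φ.1 ⟨⊤, le_rfl⟩) (map_mul (algebraMap B Γ(Spec B, ⊤)) (b i) (c j)).symm).trans
    ((hφ _).trans ?_)
  rw [hd]
  split_ifs
  · exact map_one _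
  · exact map_zero _

end SpecTrace

/-! ### Transport of trace charts -/

section Transport

variable {S' S T' T : Scheme.{u}} {π : S' ⟶ S} {π₀ : T' ⟶ T} {i' : T' ⟶ S'} {i : T ⟶ S}

theorem preimage_preimage_eq (sq : IsPullback π₀ i' i π) (W : S.Opens) :
    π₀ ⁻¹ᵁ i ⁻¹ᵁ W = i' ⁻¹ᵁ π ⁻¹ᵁ W :=
  congrArg (fun k : T' ⟶ S ↦ k ⁻¹ᵁ W) sq.w

/-- Pullback of functions along the top side of a cartesian square. -/
def funTop (sq : IsPullback π₀ i' i π) (W : S.Opens) :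
    Γ(S', π ⁻¹ᵁ W) →+* Γ(T', π₀ ⁻¹ᵁ i ⁻¹ᵁ W) :=
  (resO T' (preimage_preimage_eq sq W).le).comp (i'.app (π ⁻¹ᵁ W)).hom

theorem funTop_app (sq : IsPullback π₀ i' i π) (W : S.Opens) (a : Γ(S, W)) :
    funTop sq W (π.app W a) = π₀.app (i ⁻¹ᵁ W) (i.app W a) :=
  (resO_app_congr sq.w.symm (preimage_preimage_eq sq W).le le_rfl a).trans (resO_self _ _)

theorem funTop_resPre (sq : IsPullback π₀ i' i π) {V W : S.Opens} (h : W ≤ V)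
    (y : Γ(S', π ⁻¹ᵁ V)) :
    funTop sq W (resPre π h y) = resPre π₀ (preimage_le i h) (funTop sq V y) := by
  have h₁ : i'.app (π ⁻¹ᵁ W) (resPre π h y) =
      resO T' (preimage_le i' (preimage_le π h)) (i'.app _ y) :=
    (resO_app i' (preimage_le π h) y).symm
  exact (congrArg _ h₁).trans ((resO_resO _ _ _).trans (resO_resO _ _ _).symm)

variable [IsOpenImmersion i]

theorem app_bijective_of_le {W : S.Opens} (hW : W ≤ i.opensRange) :
    Function.Bijective (i.app W) :=
  have := i.isIso_app W hW
  ConcreteCategory.bijective_of_isIso _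

theorem funTop_bijective (sq : IsPullback π₀ i' i π) {W : S.Opens} (hW : W ≤ i.opensRange) :
    Function.Bijective (funTop sq W) := by
  have : IsOpenImmersion i' := MorphismProperty.of_isPullback (P := @IsOpenImmersion) sq ‹_›
  refine (resO_bijective_of_eq (preimage_preimage_eq sq W)).comp (app_bijective_of_le ?_)
  have h₁ := IsOpenImmersion.image_preimage_eq_preimage_image_of_isPullback sq ⊤
  rw [← Scheme.Hom.image_top_eq_opensRange] at hW ⊢
  exact (preimage_le π hW).trans h₁.ge

/-- Trace charts can be transported along cartesian squares of open immersions. -/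
theorem TraceChart.nonempty_of_isPullback (χ : TraceChart π₀ ⊤) (sq : IsPullback π₀ i' i π) :
    Nonempty (TraceChart π i.opensRange) := by
  let e : ∀ W : {W : S.Opens // W ≤ i.opensRange}, Γ(S, W.1) ≃+* Γ(T, i ⁻¹ᵁ W.1) := fun W ↦
    RingEquiv.ofBijective (i.app W.1).hom (app_bijective_of_le W.2)
  let p : ∀ W : {W : S.Opens // W ≤ i.opensRange}, Γ(S', π ⁻¹ᵁ W.1) ≃+* Γ(T', π₀ ⁻¹ᵁ i ⁻¹ᵁ W.1) :=
    fun W ↦ RingEquiv.ofBijective _ (funTop_bijective sq W.2)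
  let τ : ∀ W : {W : S.Opens // W ≤ i.opensRange}, Γ(S', π ⁻¹ᵁ W.1) →+ Γ(S, W.1) := fun W ↦
    ((e W).symm : Γ(T, i ⁻¹ᵁ W.1) →+ Γ(S, W.1)).comp ((χ.trace.1 ⟨i ⁻¹ᵁ W.1, le_top⟩).comp
      (funTop sq W.1 : Γ(S', π ⁻¹ᵁ W.1) →+ Γ(T', π₀ ⁻¹ᵁ i ⁻¹ᵁ W.1)))
  have hτ : ∀ W y, i.app W.1 (τ W y) = χ.trace.1 ⟨i ⁻¹ᵁ W.1, le_top⟩ (funTop sq W.1 y) :=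
    fun W y ↦ (e W).apply_symm_apply _
  have hτ₁ : ∀ W (a : Γ(S, W.1)) (y : Γ(S', π ⁻¹ᵁ W.1)), τ W (π.app W.1 a * y) = a * τ W y := by
    intro W a y
    apply (e W).injective
    refine (hτ W _).trans ?_
    rw [map_mul (funTop sq W.1), funTop_app, homSections_linear χ.trace ⟨i ⁻¹ᵁ W.1, le_top⟩, ← hτ]
    exact (map_mul (e W) a (τ W y)).symm
  have hτ₂ : ∀ (W W' : {W : S.Opens // W ≤ i.opensRange}) (h : W'.1 ≤ W.1)
      (y : Γ(S', π ⁻¹ᵁ W.1)), resO S h (τ W y) = τ W' (resPre π h y) := by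
    intro W W' h y
    apply (e W').injective
    refine Eq.trans ?_ (hτ W' _).symm
    rw [funTop_resPre, ← homSections_res χ.trace ⟨i ⁻¹ᵁ W.1, le_top⟩ ⟨i ⁻¹ᵁ W'.1, le_top⟩
      (preimage_le i h), ← hτ]
    exact (resO_app i h _).symm
  let S₀ : {W : S.Opens // W ≤ i.opensRange} := ⟨i.opensRange, le_rfl⟩
  let b : Fin χ.n → Γ(S', π ⁻¹ᵁ i.opensRange) := fun k ↦ (p S₀).symm (resPre π₀ le_top (χ.b k))
  let c : Fin χ.n → Γ(S', π ⁻¹ᵁ i.opensRange) := fun k ↦ (p S₀).symm (resPre π₀ le_top (χ.c k))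
  have hb : ∀ (W : {W : S.Opens // W ≤ i.opensRange}) k,
      funTop sq W.1 (resPre π W.2 (b k)) = resPre π₀ le_top (χ.b k) := fun W k ↦ by
    rw [funTop_resPre]
    exact (congrArg _ ((p S₀).apply_symm_apply _)).trans (resPre_resPre _ _ _)
  have hc : ∀ (W : {W : S.Opens // W ≤ i.opensRange}) k,
      funTop sq W.1 (resPre π W.2 (c k)) = resPre π₀ le_top (χ.c k) := fun W k ↦ by
    rw [funTop_resPre]
    exact (congrArg _ ((p S₀).apply_symm_apply _)).trans (resPre_resPre _ _ _)
  refine ⟨⟨⟨τ, hτ₁, hτ₂⟩, χ.n, b, c, fun k l ↦ ?_, fun W y ↦ ?_⟩⟩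
  · apply (e S₀).injective
    refine (hτ S₀ _).trans ?_
    have h₁ : funTop sq i.opensRange (b k * c l) = resPre π₀ le_top (χ.b k * χ.c l) :=
      ((map_mul _ _ _).trans (congrArg₂ (· * ·) ((p S₀).apply_symm_apply _)
        ((p S₀).apply_symm_apply _))).trans (map_mul _ _ _).symm
    refine (congrArg (χ.trace.1 ⟨i ⁻¹ᵁ i.opensRange, le_top⟩) h₁).trans ?_
    refine (homSections_res χ.trace ⟨⊤, le_rfl⟩ ⟨i ⁻¹ᵁ i.opensRange, le_top⟩ le_top _).symm.trans ?_
    rw [χ.dual]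
    split_ifs
    · rw [map_one, map_one]
    · rw [map_zero, map_zero]
  · apply (p W).injective
    refine (χ.eq_sum ⟨i ⁻¹ᵁ W.1, le_top⟩ (funTop sq W.1 y)).trans ?_
    refine Eq.trans ?_ (map_sum (funTop sq W.1) _ _).symm
    refine Finset.sum_congr rfl fun k _ ↦ ?_
    rw [map_mul (funTop sq W.1), funTop_app, hc]
    refine congrArg (fun z ↦ π₀.app _ z * _) ?_
    refine Eq.trans ?_ (hτ W _).symm
    rw [map_mul (funTop sq W.1), hb]

end Transport

/-! ### Zero-dimensional Gorenstein local rings -/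

section SelfInjective

open CategoryTheory.Abelian IsLocalRing

variable {L : Type u} [CommRing L]

/-- In the long exact sequence of `Y ⟶ P ⟶ P/Y`, the group `Ext^(n+1)(Y, M)` lies between
`Ext^(n+1)(P, M)`, zero as `P` is projective, and `Ext^(n+2)(P/Y, M)`, zero by the bound on the
injective dimension. -/
theorem ext_subsingleton_of_mono {M Y P : ModuleCat.{u} L} (i : Y ⟶ P) [Mono i] [Projective P]
    {n : ℕ} (h : HasInjectiveDimensionLT M (n + 2)) : Subsingleton (Ext Y M (n + 1)) := by
  have hS : (ShortComplex.mk i (cokernel.π i) (cokernel.condition i)).ShortExact :=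
    { exact := ShortComplex.exact_cokernel i }
  refine subsingleton_of_forall_eq 0 fun e ↦ ?_
  obtain ⟨y, rfl⟩ := Ext.contravariant_sequence_exact₁ hS M e (add_comm 1 (n + 1))
    (Ext.eq_zero_of_hasInjectiveDimensionLT _ (n + 2) le_rfl)
  rw [Ext.eq_zero_of_projective y, Ext.comp_zero]

/-- A nonzero element has a nonzero multiple in the socle: take the least power of the nilpotent
maximal ideal killing `a`, and an element of the preceding power which does not. -/
theorem exists_smul_ne_zero [IsLocalRing L] [IsArtinianRing L] {a : L} (ha : a ≠ 0) :
    ∃ y, y * a ≠ 0 ∧ ∀ z ∈ maximalIdeal L, z * (y * a) = 0 := by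
  obtain ⟨n, hn⟩ := IsArtinianRing.isNilpotent_jacobson_bot (R := L)
  rw [jacobson_eq_maximalIdeal _ bot_ne_top] at hn
  have h₁ : ∃ n, ∀ y ∈ maximalIdeal L ^ n, y * a = 0 := ⟨n, fun y hy ↦ by
    rw [hn] at hy
    rw [show y = 0 from hy, zero_mul]⟩
  classical
  have h₂ : Nat.find h₁ ≠ 0 := fun h ↦ ha (by
    have := Nat.find_spec h₁
    rw [h] at this
    simpa using this 1 (by simp))
  obtain ⟨m, hm⟩ := Nat.exists_eq_succ_of_ne_zero h₂
  have h₃ := Nat.find_min h₁ (m := m) (by omega)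
  push Not at h₃
  obtain ⟨y, hy, hya⟩ := h₃
  refine ⟨y, hya, fun z hz ↦ ?_⟩
  rw [← mul_assoc]
  refine Nat.find_spec h₁ _ ?_
  rw [hm, pow_succ']
  exact Ideal.mul_mem_mul hz hy

/-- The multiples of an element killed by the maximal ideal. -/
theorem exists_residue_hom [IsLocalRing L] {x : L} (hx : x ≠ 0)
    (hx' : ∀ z ∈ maximalIdeal L, z * x = 0) : ∃ φ : (L ⧸ maximalIdeal L) →ₗ[L] L,
      φ 1 = x ∧ Function.Injective φ := by
  let φ : (L ⧸ maximalIdeal L) →ₗ[L] L :=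
    Submodule.liftQ (maximalIdeal L) (LinearMap.toSpanSingleton L L x) fun z hz ↦ hx' z hz
  refine ⟨φ, one_smul L x, (injective_iff_map_eq_zero φ).mpr fun z hz ↦ ?_⟩
  obtain ⟨z, rfl⟩ := Ideal.Quotient.mk_surjective z
  have h₁ : z * x = 0 := hz
  rw [Ideal.Quotient.eq_zero_iff_mem]
  by_contra hz'
  have h₂ : IsUnit z := by simpa using hz'
  exact hx (h₂.mul_right_eq_zero.mp h₁)

/-- Such a module is a vector space over the residue field, which itself embeds into `L` through a
socle element; applied to each coordinate, this embeds `Y` into a free module. -/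
theorem exists_mono_projective [IsLocalRing L] [IsArtinianRing L] (Y : ModuleCat.{u} L)
    (hY : ∀ z ∈ maximalIdeal L, ∀ y : Y, z • y = 0) :
    ∃ (P : ModuleCat.{u} L) (i : Y ⟶ P), Mono i ∧ Projective P := by
  obtain ⟨t, ht, ht'⟩ := exists_smul_ne_zero (one_ne_zero (α := L))
  obtain ⟨φ, -, hφ⟩ := exists_residue_hom ht ht'
  have hT : Module.IsTorsionBySet L Y (maximalIdeal L : Set L) := fun y z ↦ hY z.1 z.2 y
  let _ : Module (L ⧸ maximalIdeal L) Y := hT.module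
  have : IsScalarTower L (L ⧸ maximalIdeal L) Y := hT.isScalarTower
  let _ : Field (L ⧸ maximalIdeal L) := Ideal.Quotient.field _
  let b := Module.Free.chooseBasis (L ⧸ maximalIdeal L) Y
  let ψ : Y →ₗ[L] (Module.Free.ChooseBasisIndex (L ⧸ maximalIdeal L) Y →₀ L) :=
    (Finsupp.mapRange.linearMap φ).comp (b.repr.toLinearMap.restrictScalars L)
  refine ⟨ModuleCat.of L _, ModuleCat.ofHom ψ, ?_, inferInstance⟩
  rw [ModuleCat.mono_iff_injective]
  exact (Finsupp.mapRange_injective φ (map_zero φ) hφ).comp b.repr.injective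

/-- Induction on the power: with `𝔪` the maximal ideal, `𝔪 Y` is killed by a smaller power and `Y /
𝔪 Y` by `𝔪`, to which the embedding into a free module applies. -/
theorem ext_subsingleton_of_pow [IsLocalRing L] [IsArtinianRing L] {M : ModuleCat.{u} L}
    {n : ℕ} (h : HasInjectiveDimensionLT M (n + 2)) (k : ℕ) (Y : ModuleCat.{u} L)
    (hY : ∀ z ∈ maximalIdeal L ^ k, ∀ y : Y, z • y = 0) : Subsingleton (Ext Y M (n + 1)) := by
  induction k generalizing Y with
  | zero =>
    have : Subsingleton Y := subsingleton_of_forall_eq 0 fun y ↦ by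
      simpa using hY 1 (by simp) y
    have : Projective Y := (ModuleCat.isZero_of_subsingleton Y).projective
    exact ext_subsingleton_of_mono (𝟙 Y) h
  | succ k ih =>
    let N : Submodule L Y := maximalIdeal L • ⊤
    have hS : (N.mkQ.shortComplexKer).ShortExact :=
      LinearMap.shortExact_shortComplexKer N.mkQ_surjective
    have h₁ : Subsingleton (Ext (N.mkQ.shortComplexKer).X₁ M (n + 1)) := by
      refine ih _ fun z hz ⟨y, hy⟩ ↦ Subtype.ext ?_
      have hy : y ∈ N := by simpa using hy
      change z • y = 0
      refine Submodule.smul_induction_on (p := fun y ↦ z • y = 0) hy (fun r hr y _ ↦ ?_)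
        fun x y hx hy ↦ by rw [smul_add, hx, hy, add_zero]
      rw [smul_smul]
      exact hY _ (by rw [pow_succ]; exact Ideal.mul_mem_mul hz hr) y
    have h₂ : Subsingleton (Ext (N.mkQ.shortComplexKer).X₃ M (n + 1)) := by
      obtain ⟨P, i, _, _⟩ := exists_mono_projective (N.mkQ.shortComplexKer).X₃ fun z hz y ↦ by
        obtain ⟨y, rfl⟩ := N.mkQ_surjective y
        exact (map_smul N.mkQ z y).symm.trans ((Submodule.Quotient.mk_eq_zero N).mpr
          (Submodule.smul_mem_smul hz trivial))
      exact ext_subsingleton_of_mono i h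
    refine subsingleton_of_forall_eq 0 fun e ↦ ?_
    obtain ⟨y, rfl⟩ := Ext.contravariant_sequence_exact₂ hS M e (Subsingleton.elim _ _)
    rw [Subsingleton.elim y 0, Ext.comp_zero]

/-- A local Artinian ring of finite self-injective dimension is self-injective. -/
theorem injective_of_hasInjectiveDimensionLE [IsLocalRing L] [IsArtinianRing L] {n : ℕ}
    (h : HasInjectiveDimensionLE (ModuleCat.of L L) n) : Module.Injective L L := by
  rw [Module.injective_iff_injective_object]
  induction n with
  | zero => 
    have : HasInjectiveDimensionLT (ModuleCat.of L L) 1 := h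
    infer_instance
  | succ n ih =>
    -- The bound drops by one because the maximal ideal is nilpotent, so that every module is killed
    -- by one of its powers. Dimension at most `n + 1` is dimension less than `n + 2`, which fixes
    -- the degree `n + 1` of the vanishing groups.
    refine ih (hasInjectiveDimensionLT_of_enoughProjectives _ _ fun Y ↦ ?_)
    obtain ⟨k, hk⟩ := IsArtinianRing.isNilpotent_jacobson_bot (R := L)
    rw [jacobson_eq_maximalIdeal _ bot_ne_top] at hk
    refine ext_subsingleton_of_pow h k Y fun z hz y ↦ ?_
    rw [hk] at hz
    rw [show z = 0 from hz, zero_smul]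

/-- A ring with a nonzero element which is a multiple of every nonzero element. -/
def HasSimpleSocle (L : Type*) [CommRing L] : Prop :=
  ∃ x : L, x ≠ 0 ∧ ∀ a ≠ 0, ∃ y, y * a = x

theorem HasSimpleSocle.of_ringEquiv {L L' : Type*} [CommRing L] [CommRing L']
    (h : HasSimpleSocle L) (e : L ≃+* L') : HasSimpleSocle L' := by
  obtain ⟨x, hx, H⟩ := h
  refine ⟨e x, by simpa using hx, fun a ha ↦ ?_⟩
  obtain ⟨y, hy⟩ := H (e.symm a) (by simpa using ha)
  exact ⟨e y, by rw [← hy, map_mul, e.apply_symm_apply]⟩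

/-- Let `t` be a nonzero socle element and `y a` a nonzero socle multiple of `a`. Both receive an
embedding of the residue field; self-injectivity extends one along the other to an endomorphism of
`L`, which is a multiplication and takes `y a` to `t`. -/
theorem IsGorensteinLocalRing.hasSimpleSocle [IsArtinianRing L] (h : IsGorensteinLocalRing L) :
    HasSimpleSocle L := by
  obtain ⟨_, _, n, hn⟩ := h
  have := injective_of_hasInjectiveDimensionLE hn
  obtain ⟨t, ht, ht'⟩ := exists_smul_ne_zero (one_ne_zero (α := L))
  obtain ⟨φ, hφ, -⟩ := exists_residue_hom ht ht'
  refine ⟨_, ht, fun a ha ↦ ?_⟩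
  obtain ⟨y, hy, hy'⟩ := exists_smul_ne_zero ha
  obtain ⟨ψ, hψ, hψ'⟩ := exists_residue_hom hy hy'
  obtain ⟨η, hη⟩ := Module.Injective.out ψ hψ' φ
  refine ⟨η 1 * y, ?_⟩
  rw [← hφ, ← hη, hψ, mul_assoc, mul_comm, ← smul_eq_mul, ← map_smul, smul_eq_mul, mul_one]

end SelfInjective

/-! ### Nondegenerate forms on finite-dimensional algebras -/

/-- An Artinian ring is the product of its localizations. Choose on each a linear form with value
one on the distinguished socle element and add them up. A nonzero `a` is nonzero in some factor,
where it can be multiplied into that element, with zero in all other factors. -/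
theorem exists_form_of_hasSimpleSocle {K E : Type*} [Field K] [CommRing E] [Algebra K E]
    [IsArtinianRing E]
    (h : ∀ p : PrimeSpectrum E, HasSimpleSocle (Localization.AtPrime p.asIdeal)) :
    ∃ l : E →ₗ[K] K, ∀ a ≠ 0, ∃ y, l (y * a) ≠ 0 := by
  choose x hx H using h
  have h₁ : ∀ p : PrimeSpectrum E, ∃ l : Localization.AtPrime p.asIdeal →ₗ[K] K, l (x p) = 1 :=
    fun p ↦ Module.Projective.exists_dual_eq_one K (hx p)
  choose l hl using h₁
  have := Fintype.ofFinite (PrimeSpectrum E)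
  let φ := fun p : PrimeSpectrum E ↦
    IsScalarTower.toAlgHom K E (Localization.AtPrime p.asIdeal)
  refine ⟨∑ p, (l p).comp (φ p).toLinearMap, fun a ha ↦ ?_⟩
  have h₂ : PrimeSpectrum.toPiLocalization E a ≠ 0 := fun h ↦
    ha (PrimeSpectrum.toPiLocalization_bijective.1 (h.trans (map_zero _).symm))
  obtain ⟨p, hp⟩ := Function.ne_iff.mp h₂
  obtain ⟨y, hy⟩ := H p _ hp
  classical
  obtain ⟨e, he⟩ := PrimeSpectrum.toPiLocalization_bijective.2 (Pi.single p y)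
  refine ⟨e, ?_⟩
  have h₃ : ∀ q, φ q (e * a) =
      (Pi.single p (x p) : ∀ q : PrimeSpectrum E, Localization.AtPrime q.asIdeal) q := fun q ↦ by
    rw [map_mul]
    have h₄ : φ q e =
        (Pi.single p y : ∀ q : PrimeSpectrum E, Localization.AtPrime q.asIdeal) q := congrFun he q
    rw [h₄]
    by_cases hq : q = p
    · subst hq
      rw [Pi.single_eq_same, Pi.single_eq_same]
      exact hy
    · simp [hq]
  simp only [LinearMap.sum_apply, LinearMap.comp_apply, AlgHom.toLinearMap_apply, h₃]
  rw [Finset.sum_eq_single p]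
  · simp [hl]
  · intro q _ hq
    simp [hq]
  · simp

/-! ### Extension of a nondegenerate form from a fibre -/

theorem exists_common_denominator {A : Type*} [CommRing A] (p : Ideal A) [p.IsPrime] {n : ℕ}
    (f : Fin n → p.ResidueField) : ∃ d : A, algebraMap A p.ResidueField d ≠ 0 ∧
      ∃ a : Fin n → A, ∀ i, algebraMap A p.ResidueField d * f i =
        algebraMap A p.ResidueField (a i) := by
  obtain ⟨⟨d, hd⟩, h⟩ := IsLocalization.exist_integer_multiples_of_finite
    (nonZeroDivisors (A ⧸ p)) f
  choose a ha using h
  obtain ⟨d, rfl⟩ := Ideal.Quotient.mk_surjective d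
  choose b hb using fun i ↦ Ideal.Quotient.mk_surjective (a i)
  refine ⟨d, ?_, b, fun i ↦ ?_⟩
  · rw [Ne, Ideal.algebraMap_residueField_eq_zero, ← Ideal.Quotient.eq_zero_iff_mem]
    exact nonZeroDivisors.ne_zero hd
  · have h₁ := ha i
    rw [← hb i, Ideal.algebraMap_quotient_residueField_mk] at h₁
    rw [h₁, Algebra.smul_def]
    rfl

theorem isFrobeniusSystem_of_basis {A B : Type*} [CommRing A] [CommRing B] [Algebra A B] {n : ℕ}
    (e : Module.Basis (Fin n) A B) {l : B →ₗ[A] A} {b : Fin n → B}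
    (h : ∀ i j, l (b i * e j) = if i = j then 1 else 0) : IsFrobeniusSystem l b e where
  eq_sum x := by
    conv_lhs => rw [← e.sum_repr x]
    refine Finset.sum_congr rfl fun i _ ↦ congrArg (· • e i) ?_
    conv_rhs => rw [← e.sum_repr x, Finset.sum_mul, map_sum]
    have h₁ : ∀ j, l ((e.repr x j • e j) * b i) = if i = j then e.repr x j else 0 := fun j ↦ by
      rw [smul_mul_assoc, map_smul, mul_comm, h, smul_eq_mul, mul_ite, mul_one, mul_zero]
    simp only [h₁, Finset.sum_ite_eq, Finset.mem_univ, if_true]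

/-- Clearing denominators, `l` lifts a nonzero multiple of `l'`. Take for `g` the Gram determinant
of the basis `e`; a vector in the kernel of the Gram matrix over the residue field would contradict
nondegeneracy, so `g` is not in `p`. The rows of the adjugate matrix give the dual family up to the
factor `g`. -/
theorem exists_form_of_residueField {A B : Type*} [CommRing A] [CommRing B] [Algebra A B] {n : ℕ}
    (e : Module.Basis (Fin n) A B) (p : Ideal A) [p.IsPrime]
    {l' : p.ResidueField ⊗[A] B →ₗ[p.ResidueField] p.ResidueField}
    (hl : ∀ a ≠ 0, ∃ y, l' (y * a) ≠ 0) :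
    ∃ g ∉ p, ∃ (l : B →ₗ[A] A) (b : Fin n → B), ∀ i j, l (b i * e j) = if i = j then g else 0 := by
  obtain ⟨d, hd, a, ha⟩ := exists_common_denominator p fun i ↦ l' (1 ⊗ₜ e i)
  let l : B →ₗ[A] A := e.constr A a
  have h₁ : ∀ y, algebraMap A p.ResidueField (l y) =
      algebraMap A p.ResidueField d * l' (1 ⊗ₜ y) := by
    have h₂ : (Algebra.linearMap A p.ResidueField).comp l =
        (algebraMap A p.ResidueField d • l'.restrictScalars A).comp
          (TensorProduct.mk A p.ResidueField B 1) := by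
      refine e.ext fun i ↦ ?_
      have h₃ : l (e i) = a i := e.constr_basis A a i
      exact (congrArg (algebraMap A p.ResidueField) h₃).trans (ha i).symm
    exact fun y ↦ congrArg (fun k : B →ₗ[A] p.ResidueField ↦ k y) h₂
  let G : Matrix (Fin n) (Fin n) A := Matrix.of fun i j ↦ l (e i * e j)
  let e' := Algebra.TensorProduct.basis p.ResidueField e
  have he' : ∀ i, e' i = 1 ⊗ₜ e i := fun i ↦ Algebra.TensorProduct.basis_apply e i
  refine ⟨G.det, fun hG ↦ ?_, l, fun i ↦ ∑ k, G.adjugate i k • e k, fun i j ↦ ?_⟩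
  · have h₂ : (G.map (algebraMap A p.ResidueField)).det = 0 := by
      rw [← RingHom.mapMatrix_apply, ← RingHom.map_det]
      exact Ideal.algebraMap_residueField_eq_zero.mpr hG
    obtain ⟨v, hv, hv'⟩ := Matrix.exists_mulVec_eq_zero_iff.mpr h₂
    have h₃ : ∑ j, v j • e' j ≠ 0 := fun h ↦ hv (funext fun j ↦
      Fintype.linearIndependent_iff.mp e'.linearIndependent v h j)
    obtain ⟨y, hy⟩ := hl _ h₃
    refine hy ?_
    have h₄ : ∀ i, l' (e' i * ∑ j, v j • e' j) = 0 := fun i ↦ by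
      have h₅ := congrFun hv' i
      refine (mul_eq_zero.mp ?_).resolve_left hd
      refine Eq.trans ?_ h₅
      rw [Finset.mul_sum, map_sum, Finset.mul_sum]
      refine Finset.sum_congr rfl fun j _ ↦ ?_
      change _ = algebraMap A p.ResidueField (l (e i * e j)) * v j
      rw [h₁, mul_smul_comm, map_smul, he', he', Algebra.TensorProduct.tmul_mul_tmul, mul_one,
        smul_eq_mul]
      ring
    rw [← e'.sum_repr y, Finset.sum_mul, map_sum]
    exact Finset.sum_eq_zero fun i _ ↦ by rw [smul_mul_assoc, map_smul, h₄, smul_zero]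
  · have h₂ := congrFun (congrFun G.adjugate_mul i) j
    rw [Matrix.mul_apply, Matrix.smul_apply, Matrix.one_apply, smul_eq_mul, mul_ite, mul_one,
      mul_zero] at h₂
    rw [← h₂, Finset.sum_mul, map_sum]
    exact Finset.sum_congr rfl fun k _ ↦ by rw [smul_mul_assoc, map_smul]; rfl

/-- Once `g` is invertible, `g⁻¹ ⊗ b_i` is genuinely dual to the basis. -/
theorem exists_isFrobeniusSystem_baseChange {A B : Type*} [CommRing A] [CommRing B] [Algebra A B]
    {n : ℕ} (e : Module.Basis (Fin n) A B) {g : A} {l : B →ₗ[A] A} {b : Fin n → B}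
    (h : ∀ i j, l (b i * e j) = if i = j then g else 0) (C : Type*) [CommRing C] [Algebra A C]
    (hg : IsUnit (algebraMap A C g)) : ∃ (t : C ⊗[A] B →ₗ[C] C) (b' c' : Fin n → C ⊗[A] B),
      IsFrobeniusSystem t b' c' ∧ ∀ i j, t (b' i * c' j) = if i = j then 1 else 0 := by
  obtain ⟨u, hu⟩ := hg
  have h₁ : ∀ i j, baseTrace l C (((u⁻¹ : Cˣ) : C) ⊗ₜ[A] b i *
      Algebra.TensorProduct.basis C e j) = if i = j then 1 else 0 := fun i j ↦ by
    rw [Algebra.TensorProduct.basis_apply, Algebra.TensorProduct.tmul_mul_tmul, baseTrace_tmul, h,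
      mul_one]
    split_ifs
    · rw [Algebra.smul_def, ← hu, Units.mul_inv]
    · rw [zero_smul]
  exact ⟨baseTrace l C, _, _, isFrobeniusSystem_of_basis _ h₁, h₁⟩

/-! ### Gorenstein morphisms have trace charts -/

/-- Flat and finitely presented implies free at every prime, and a basis at a prime spreads out to a
basic open neighbourhood. -/
theorem exists_free_away {A B : Type*} [CommRing A] [CommRing B] [Algebra A B] [Module.Finite A B]
    [Module.Flat A B] [Module.FinitePresentation A B] (p : PrimeSpectrum A) :
    ∃ r ∉ p.asIdeal, Module.Free (Localization.Away r) (Localization.Away r ⊗[A] B) := by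
  have : Module.Free (Localization.AtPrime p.asIdeal) (LocalizedModule p.asIdeal.primeCompl B) := by
    have h := Module.freeLocus_eq_univ (R := A) (M := B)
    exact Module.mem_freeLocus.mp (h ▸ Set.mem_univ p)
  obtain ⟨r, hr, hr', -⟩ := Module.FinitePresentation.exists_free_localizedModule_powers
    p.asIdeal.primeCompl (LocalizedModule.mkLinearMap p.asIdeal.primeCompl B)
    (Localization.AtPrime p.asIdeal)
  exact ⟨r, hr, .of_equiv (IsLocalizedModule.isBaseChange (Submonoid.powers r)
    (Localization.Away r) (LocalizedModule.mkLinearMap (Submonoid.powers r) B)).equiv.symm⟩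

section Chart

variable {S' S : Scheme.{u}} {π : S' ⟶ S}

theorem exists_chart (s : S) : ∃ (A : CommRingCat.{u}) (i : Spec A ⟶ S) (_ : IsOpenImmersion i)
    (p : PrimeSpectrum A), i p = s := by
  obtain ⟨p, hp⟩ := S.affineCover.covers s
  exact ⟨_, S.affineCover.f (S.affineCover.idx s), S.affineCover.map_prop _, p, hp⟩

theorem IsFiniteLocallyFree.exists_free_chart (h : IsFiniteLocallyFree π) (s : S) :
    ∃ (A B : CommRingCat.{u}) (_ : Algebra A B) (i : Spec A ⟶ S) (i' : Spec B ⟶ S')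
      (_ : IsOpenImmersion i) (p : PrimeSpectrum A), IsPullback (specAlg A B) i' i π ∧ i p = s ∧
        Module.Finite A B ∧ Module.Free A B := by
  have := h.finite
  have := h.flat
  have := h.locallyOfFinitePresentation
  obtain ⟨A, i, _, p, hp⟩ := exists_chart s
  obtain ⟨B, _, i', _, sq⟩ := exists_affine_pullback π i
  have h₁ : IsFinite (specAlg A B) := MorphismProperty.of_isPullback sq.flip ‹_›
  have h₂ : Flat (specAlg A B) := MorphismProperty.of_isPullback sq.flip ‹_›
  have h₃ : LocallyOfFinitePresentation (specAlg A B) :=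
    MorphismProperty.of_isPullback sq.flip ‹_›
  have : Module.Finite A B := RingHom.finite_algebraMap.mp ((IsFinite.SpecMap_iff _).mp h₁)
  have : Module.Flat A B := RingHom.flat_algebraMap_iff.mp (Flat.SpecMap_iff.mp h₂)
  have : Algebra.FinitePresentation A B :=
    RingHom.finitePresentation_algebraMap.mp (HasRingHomProperty.Spec_iff.mp h₃)
  have : Module.FinitePresentation A B :=
    Module.FinitePresentation.of_finite_of_finitePresentation A B
  obtain ⟨r, hr, hr'⟩ := exists_free_away (B := B) p
  let A' : CommRingCat.{u} := .of (Localization.Away (r : A))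
  have h₄ : IsOpenImmersion (specAlg A A') := inferInstance
  obtain ⟨p', hp'⟩ : ∃ p' : Spec A', specAlg A A' p' = p := by
    have := PrimeSpectrum.localization_away_comap_range (Localization.Away (r : A)) (r : A)
    have h₅ : p ∈ (PrimeSpectrum.basicOpen (r : A) : Set (PrimeSpectrum A)) := hr
    rw [← this] at h₅
    exact h₅
  refine ⟨A', tensorRing A B A', inferInstance, specAlg A A' ≫ i, _, inferInstance, p',
    (isPullback_specAlg A B A').paste_vert sq, ?_, ?_, ?_⟩
  · rw [← hp, ← hp']
    rfl
  · exact inferInstanceAs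
      (Module.Finite (Localization.Away (r : A)) (Localization.Away (r : A) ⊗[A] B))
  · exact hr'

theorem exists_residueField_iso {A : CommRingCat.{u}} (i : Spec A ⟶ S) [IsOpenImmersion i]
    (p : PrimeSpectrum A) : ∃ e : Spec (.of p.asIdeal.ResidueField) ≅ Spec (S.residueField (i p)),
      specAlg A (.of p.asIdeal.ResidueField) ≫ i = e.hom ≫ S.fromSpecResidueField (i p) := by
  let x : Spec A := p
  have : IsIso (i.residueFieldMap x) := inferInstance
  have h₁ := Scheme.Spec.map_residueFieldIso_inv_eq_fromSpecResidueField A x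
  have h₂ : Spec.map (Scheme.Spec.residueFieldIso A x).hom ≫
      Spec.map (Scheme.Spec.residueFieldIso A x).inv = 𝟙 _ := by
    rw [← Spec.map_comp, Iso.inv_hom_id, Spec.map_id]
  refine ⟨asIso (Spec.map (Scheme.Spec.residueFieldIso A x).hom) ≪≫
    asIso (Spec.map (i.residueFieldMap x)), ?_⟩
  have h₃ : specAlg A (.of p.asIdeal.ResidueField) =
      Spec.map (Scheme.Spec.residueFieldIso A x).hom ≫ (Spec A).fromSpecResidueField x := by
    rw [← h₁, ← Category.assoc, h₂, Category.id_comp]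
  rw [h₃, Category.assoc, ← Scheme.Hom.SpecMap_residueFieldMap_fromSpecResidueField,
    ← Category.assoc]
  rfl

theorem exists_stalk_equiv {E : CommRingCat.{u}} {F : Scheme.{u}} (ε : Spec E ≅ F)
    (q : PrimeSpectrum E) :
    ∃ x : F, Nonempty (F.presheaf.stalk x ≃+* Localization.AtPrime q.asIdeal) := by
  let x : Spec E := q
  have : IsIso (ε.hom.stalkMap x) := inferInstance
  exact ⟨ε.hom x, ⟨(asIso (ε.hom.stalkMap x) ≪≫
    Spec.stalkIso E x).commRingCatIsoToRingEquiv⟩⟩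

/-- The scheme-theoretic fibre is the spectrum of the finite algebra `κ(p) ⊗ B` over the residue
field, so its local rings are Artinian, besides being Gorenstein, and have simple socles. -/
theorem IsGorensteinMorphism.exists_form (h : IsGorensteinMorphism π) {A B : CommRingCat.{u}}
    [Algebra A B] [Module.Finite A B] {i : Spec A ⟶ S} {i' : Spec B ⟶ S'} [IsOpenImmersion i]
    (sq : IsPullback (specAlg A B) i' i π) (p : PrimeSpectrum A) :
    ∃ l : p.asIdeal.ResidueField ⊗[A] B →ₗ[p.asIdeal.ResidueField] p.asIdeal.ResidueField,
      ∀ a ≠ 0, ∃ y, l (y * a) ≠ 0 := by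
  let K : CommRingCat.{u} := .of p.asIdeal.ResidueField
  let E : CommRingCat.{u} := tensorRing A B K
  have : IsArtinianRing (p.asIdeal.ResidueField ⊗[A] B) :=
    IsArtinianRing.of_finite p.asIdeal.ResidueField _
  refine exists_form_of_hasSimpleSocle fun q ↦ ?_
  obtain ⟨e, he⟩ := exists_residueField_iso i p
  have sq₁ : IsPullback (specAlg K E ≫ e.hom) (specAlg B E ≫ i')
      (S.fromSpecResidueField (i p)) π := by
    have h₁ := (isPullback_specAlg A B K).paste_vert sq
    refine IsPullback.of_iso h₁ (Iso.refl _) e (Iso.refl _) (Iso.refl _) ?_ ?_ ?_ ?_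
    · simp
    · simp
    · simpa using he
    · simp
  let ε : Spec E ≅ π.fiber (i p) := sq₁.flip.isoPullback
  obtain ⟨x, ⟨ε'⟩⟩ := exists_stalk_equiv ε q
  have : IsArtinianRing ((π.fiber (i p)).presheaf.stalk x) := ε'.symm.isArtinianRing
  exact ((h.fiber (i p)).stalk x).hasSimpleSocle.of_ringEquiv ε'

theorem IsGorensteinMorphism.exists_traceChart (h : IsGorensteinMorphism π)
    (h' : IsFiniteLocallyFree π) (s : S) :
    ∃ S₀ : S.Opens, s ∈ S₀ ∧ Nonempty (TraceChart π S₀) := by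
  obtain ⟨A, B, _, i, i', _, p, sq, hp, _, _⟩ := h'.exists_free_chart s
  obtain ⟨l', hl'⟩ := h.exists_form sq p
  let e := (Module.Free.chooseBasis A B).reindex (Fintype.equivFin _)
  obtain ⟨g, hg, l, b, hb⟩ := exists_form_of_residueField e p.asIdeal hl'
  let C : CommRingCat.{u} := .of (Localization.Away (g : A))
  obtain ⟨t, b', c', hF, hd⟩ := exists_isFrobeniusSystem_baseChange e hb C
    (IsLocalization.Away.algebraMap_isUnit (g : A))
  obtain ⟨χ⟩ := nonempty_traceChart_spec (A := C) (B := tensorRing A B C) hF hd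
  have h₄ : IsOpenImmersion (specAlg A C) := inferInstance
  obtain ⟨p', hp'⟩ : ∃ p' : Spec C, specAlg A C p' = p := by
    have := PrimeSpectrum.localization_away_comap_range (Localization.Away (g : A)) (g : A)
    have h₅ : p ∈ (PrimeSpectrum.basicOpen (g : A) : Set (PrimeSpectrum A)) := hg
    rw [← this] at h₅
    exact h₅
  refine ⟨(specAlg A C ≫ i).opensRange, ⟨p', ?_⟩,
    χ.nonempty_of_isPullback ((isPullback_specAlg A B C).paste_vert sq)⟩
  rw [← hp, ← hp']
  rfl

end Chart

/-! ### Part: the two representable functors, truncated polynomials and the conclusion. -/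

/-! ### Representability of Weil restrictions and of jet functors -/

section Representable

variable {S' S : Scheme.{u}} {π : S' ⟶ S}

theorem pullback_map_left_fst {T R : Over S} (t : T ⟶ R) :
    ((Over.pullback π).map t).left ≫ pullback.fst R.hom π = pullback.fst T.hom π ≫ t.left :=
  pullback.lift_fst _ _ _

theorem pullback_map_left_snd {T R : Over S} (t : T ⟶ R) :
    ((Over.pullback π).map t).left ≫ pullback.snd R.hom π = pullback.snd T.hom π :=
  pullback.lift_snd _ _ _

/-- Every cartesian square over `π` is isomorphic to the chosen fibre product, so testing on chosen
fibre products suffices. Weil restrictions and jet spaces are both brought to this form. -/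
theorem isWeilRestriction_of_existsUnique {X R : Over S} {f : pullback R.hom π ⟶ X.left}
    (w : f ≫ X.hom = pullback.fst R.hom π ≫ R.hom)
    (H : ∀ (T : Over S) (y : pullback T.hom π ⟶ X.left),
      y ≫ X.hom = pullback.fst T.hom π ≫ T.hom →
        ∃! t : T ⟶ R, ((Over.pullback π).map t).left ≫ f = y) :
    IsWeilRestriction π X.hom R.hom f where
  w := w
  existsUnique {T T'} τ ρ q sq y hy := by
    let e : T' ≅ pullback τ π := sq.isoPullback
    have he₁ : e.hom ≫ pullback.fst τ π = ρ := sq.isoPullback_hom_fst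
    have he₂ : e.hom ≫ pullback.snd τ π = q := sq.isoPullback_hom_snd
    obtain ⟨t, ht, ht'⟩ := H (Over.mk τ) (e.inv ≫ y) (by
      rw [Category.assoc, hy, ← he₁, Category.assoc, Iso.inv_hom_id_assoc]
      rfl)
    refine ⟨t.left, ⟨Over.w t, e.hom ≫ ((Over.pullback π).map t).left, ?_, ?_, ?_⟩, ?_⟩
    · rw [Category.assoc, pullback_map_left_fst, ← he₁, Category.assoc]
      rfl
    · rw [Category.assoc, pullback_map_left_snd]
      exact he₂
    · rw [Category.assoc, ht, Iso.hom_inv_id_assoc]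
    · rintro t' ⟨h₁, u, hu₁, hu₂, hu₃⟩
      refine congrArg (fun k : Over.mk τ ⟶ R ↦ k.left) (ht' (Over.homMk t' h₁) ?_)
      refine (Iso.eq_inv_comp e).mpr ?_
      rw [← hu₃, ← Category.assoc]
      refine congrArg (· ≫ f) (pullback.hom_ext ?_ ?_)
      · rw [Category.assoc, pullback_map_left_fst, hu₁, ← he₁, Category.assoc]
        rfl
      · rw [Category.assoc, pullback_map_left_snd, hu₂]
        exact he₂

theorem isWeilRestriction_univMap {X R : Over S}
    (h : (weilRestriction π ((Over.pullback π).obj X)).RepresentableBy R) :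
    IsWeilRestriction π X.hom R.hom (univMap h) := by
  have w : ∀ {T : Over S} (φ : (Over.pullback π).obj T ⟶ (Over.pullback π).obj X),
      (φ.left ≫ pullback.fst X.hom π) ≫ X.hom = pullback.fst T.hom π ≫ T.hom := fun {T} φ ↦ by
    have h₁ : φ.left ≫ pullback.snd X.hom π = pullback.snd T.hom π := Over.w φ
    rw [Category.assoc, pullback.condition, ← Category.assoc, h₁, pullback.condition]
  have h₀ : ∀ {T : Over S} (t : T ⟶ R), ((Over.pullback π).map t).left ≫ univMap h =
      (show (Over.pullback π).obj T ⟶ (Over.pullback π).obj X from h.homEquiv t).left ≫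
        pullback.fst X.hom π := fun {T} t ↦ by
    rw [h.homEquiv_eq t]
    exact (Category.assoc _ _ _).symm
  refine isWeilRestriction_of_existsUnique (w _) fun T y hy ↦ ?_
  let ψ : (Over.pullback π).obj T ⟶ (Over.pullback π).obj X :=
    Over.homMk (pullback.lift y (pullback.snd T.hom π) (by rw [hy, pullback.condition]))
      (pullback.lift_snd _ _ _)
  have hψ : ψ.left ≫ pullback.fst X.hom π = y := pullback.lift_fst _ _ _
  refine ⟨h.homEquiv.symm ψ, ?_, fun t ht ↦ ?_⟩
  · exact (h₀ _).trans ((congrArg (fun φ : (Over.pullback π).obj T ⟶ (Over.pullback π).obj X ↦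
      φ.left ≫ pullback.fst X.hom π) (h.homEquiv.apply_symm_apply ψ)).trans hψ)
  · refine (Equiv.eq_symm_apply h.homEquiv).mpr ?_
    refine Over.OverMorphism.ext (pullback.hom_ext ?_ ?_)
    · exact ((h₀ t).symm.trans ht).trans hψ.symm
    · exact (Over.w (show (Over.pullback π).obj T ⟶ (Over.pullback π).obj X from
        h.homEquiv t)).trans (Over.w ψ).symm

theorem isWeilRestriction_univJet {k : CommRingCat.{u}} {m : ℕ} {X J : Over (Spec k)}
    (h : (jetFunctor k m X).RepresentableBy J) :
    IsWeilRestriction (jetHom k m) X.hom J.hom (univJet h) := by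
  have w : ∀ {T : Over (Spec k)}
      (φ : (Over.map (jetHom k m)).obj ((Over.pullback (jetHom k m)).obj T) ⟶ X),
      φ.left ≫ X.hom = pullback.fst T.hom (jetHom k m) ≫ T.hom := fun {T} φ ↦
    (Over.w φ).trans pullback.condition.symm
  have h₀ : ∀ {T : Over (Spec k)} (t : T ⟶ J),
      ((Over.pullback (jetHom k m)).map t).left ≫ univJet h =
        (show (Over.map (jetHom k m)).obj ((Over.pullback (jetHom k m)).obj T) ⟶ X from
          h.homEquiv t).left := fun {T} t ↦ by
    rw [h.homEquiv_eq t]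
    rfl
  refine isWeilRestriction_of_existsUnique (w _) fun T y hy ↦ ?_
  let ψ : (Over.map (jetHom k m)).obj ((Over.pullback (jetHom k m)).obj T) ⟶ X :=
    Over.homMk y (hy.trans pullback.condition)
  refine ⟨h.homEquiv.symm ψ, ?_, fun t ht ↦ ?_⟩
  · exact (h₀ _).trans (congrArg
      (fun φ : (Over.map (jetHom k m)).obj ((Over.pullback (jetHom k m)).obj T) ⟶ X ↦ φ.left)
      (h.homEquiv.apply_symm_apply ψ))
  · refine (Equiv.eq_symm_apply h.homEquiv).mpr ?_
    exact Over.OverMorphism.ext ((h₀ t).symm.trans ht)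

end Representable

/-! ### Truncated polynomial algebras -/

section Jets

open Polynomial

variable (k : Type*) [CommRing k] (m : ℕ)

/-- The truncated polynomial algebra. -/
abbrev JetRing : Type _ := k[X] ⧸ Ideal.span {(X : k[X]) ^ (m + 1)}

/-- The coefficient of highest degree of a truncated polynomial. -/
def jetForm : JetRing k m →ₗ[k] k :=
  ((Ideal.span {(X : k[X]) ^ (m + 1)}).restrictScalars k).liftQ (lcoeff k m) fun p hp ↦ by
    obtain ⟨q, rfl⟩ := Ideal.mem_span_singleton.mp hp
    rw [LinearMap.mem_ker, lcoeff_apply, mul_comm, coeff_mul_X_pow', if_neg (by omega)]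

theorem jetForm_mk (p : k[X]) :
    jetForm k m (Ideal.Quotient.mk (Ideal.span {(X : k[X]) ^ (m + 1)}) p) = p.coeff m := rfl

/-- The coefficient of `t^m` in `t^(m - i) t^j` is one exactly when `i = j`; the subtraction is a
true one since `i ≤ m`. -/
theorem jetForm_dual (i j : Fin (m + 1)) :
    jetForm k m (Ideal.Quotient.mk _ (X ^ (m - (i : ℕ))) * Ideal.Quotient.mk _ (X ^ (j : ℕ))) =
      if i = j then 1 else 0 := by
  rw [← map_mul, jetForm_mk, ← pow_add, coeff_X_pow]
  refine if_congr ?_ rfl rfl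
  rw [Fin.ext_iff]
  omega

theorem isFrobeniusSystem_jetForm : IsFrobeniusSystem (jetForm k m)
    (fun i : Fin (m + 1) ↦ Ideal.Quotient.mk _ (X ^ (m - (i : ℕ))))
    fun j ↦ Ideal.Quotient.mk _ (X ^ (j : ℕ)) where
  eq_sum x := by
    obtain ⟨p, rfl⟩ := Ideal.Quotient.mk_surjective x
    have h₁ : ∀ i : Fin (m + 1), jetForm k m (Ideal.Quotient.mk _ p *
        Ideal.Quotient.mk _ (X ^ (m - (i : ℕ)))) = p.coeff i := fun i ↦ by
      rw [← map_mul, jetForm_mk, coeff_mul_X_pow', if_pos (by omega)]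
      congr 1
      omega
    simp only [h₁]
    have h₂ : ∀ i : Fin (m + 1), p.coeff i • Ideal.Quotient.mk (Ideal.span {(X : k[X]) ^ (m + 1)})
        (X ^ (i : ℕ)) = Ideal.Quotient.mk _ (p.coeff i • X ^ (i : ℕ)) := fun i ↦ rfl
    simp only [h₂]
    rw [← map_sum, Ideal.Quotient.mk_eq_mk_iff_sub_mem, Ideal.mem_span_singleton, X_pow_dvd_iff]
    intro d hd
    rw [coeff_sub, finsetSum_coeff, sub_eq_zero]
    simp only [coeff_smul, coeff_X_pow, smul_eq_mul, mul_ite, mul_one, mul_zero]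
    rw [Finset.sum_eq_single ⟨d, hd⟩]
    · simp
    · intro i _ hi
      exact if_neg fun h ↦ hi (Fin.ext h.symm)
    · simp

end Jets

theorem nonempty_traceChart_jetHom (k : CommRingCat.{u}) (m : ℕ) :
    Nonempty (TraceChart (jetHom k m) ⊤) :=
  nonempty_traceChart_spec (A := k) (B := .of (JetRing k m)) (isFrobeniusSystem_jetForm k m)
    (jetForm_dual k m)

end WeilDiff

end

theorem mainTheorem7 :
    (∀ {S' S : Scheme.{u}} (π : S' ⟶ S),
      WeilDiff.IsFiniteLocallyFree π → WeilDiff.IsGorensteinMorphism π →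
      ∀ (X R : Over S)
        (h : (WeilDiff.weilRestriction π ((Over.pullback π).obj X)).RepresentableBy R),
        Nonempty (WeilDiff.kaehler R.hom ≅
          (Scheme.Modules.pushforward (WeilDiff.univProj π R)).obj
            (WeilDiff.tensor
              ((Scheme.Modules.pullback (WeilDiff.univMap h)).obj (WeilDiff.kaehler X.hom))
              ((Scheme.Modules.pullback (WeilDiff.univBase π R)).obj
                (WeilDiff.dualizingSheaf π))))) ∧
    (∀ (k : CommRingCat.{u}) (m : ℕ) (X J : Over (Spec k))
        (h : (WeilDiff.jetFunctor k m X).RepresentableBy J),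
        Nonempty (WeilDiff.kaehler J.hom ≅
          (Scheme.Modules.pushforward (WeilDiff.univProj (WeilDiff.jetHom k m) J)).obj
            (WeilDiff.tensor
              ((Scheme.Modules.pullback (WeilDiff.univJet h)).obj (WeilDiff.kaehler X.hom))
              ((Scheme.Modules.pullback (WeilDiff.univBase (WeilDiff.jetHom k m) J)).obj
                (WeilDiff.dualizingSheaf (WeilDiff.jetHom k m)))))) := by
  refine ⟨fun {S' S} π hπ hπ' X R h ↦ ?_, fun k m X J h ↦ ?_⟩
  · have := hπ.finite
    exact (WeilDiff.isWeilRestriction_univMap h).nonempty_iso fun s ↦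
      hπ'.exists_traceChart hπ s
  · have : IsAffineHom (WeilDiff.jetHom k m) := by
      unfold WeilDiff.jetHom
      infer_instance
    -- The coefficient of `t^m` is a trace chart over the whole base, so no condition on fibres is
    -- involved and `k` may be any commutative ring.
    exact (WeilDiff.isWeilRestriction_univJet h).nonempty_iso fun s ↦
      ⟨⊤, trivial, WeilDiff.nonempty_traceChart_jetHom k m⟩
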